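/- Let $n\ge 1$, let $\mathbb B_n$ be the open unit ball of $\mathbb C^n$ with $\langle z,w\rangle=\sum_i z_i\overline{w_i}$, let $v$ be Lebesgue volume measure on $\mathbb B_n$ normalized so that $v(\mathbb B_n)=1$, and let $d\lambda_n(z)=(1-|z|^2)^{-(n+1)}\,dv(z)$. For $\alpha>-1$ let $dv_\alpha(z)=c_\alpha(1-|z|^2)^\alpha\,dv(z)$ with $c_\alpha>0$ chosen so that $v_\alpha(\mathbb B_n)=1$, and write $\langle g,h\rangle_\alpha=\int_{\mathbb B_n} g\,\overline h\,dv_\alpha$ and $\|g\|_\alpha=\langle g,g\rangle_\alpha^{1/2}$. Let $\beta(z,w)=\frac12\log\frac{1+|\varphi_z(w)|}{1-|\varphi_z(w)|}$ be the hyperbolic distance on $\mathbb B_n$ induced by the Bergman metric, where $\varphi_z$ is the involutive Möbius automorphism of $\mathbb B_n$ that exchanges $0$ and $z$. For $r>0$ let $D(z,r)=\{w\in\mathbb B_n:\beta(z,w)<r\}$. For $f\in L^2(\mathbb B_n,dv_\alpha)$ and $z\in\mathbb B_n$ put \[ \widehat f_r(z)=\frac1{v_\alpha(D(z,r))}\int_{D(z,r)}f\,dv_\alpha,\qquad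 MO_r(f)(z)=\left[\frac1{v_\alpha(D(z,r))}\int_{D(z,r)}|f(w)-\widehat f_r(z)|^2\,dv_\alpha(w)\right]^{1/2}. \] For $t\ge 0$ let $K_z^t(w)=(1-\langle w,z\rangle)^{-(n+1+\alpha+t)}$ (principal branch), $h_z^t=K_z^t/\|K_z^t\|_\alpha$, $B_{\alpha,t}(g)(z)=\langle g h_z^t,h_z^t\rangle_\alpha$ for $g\in L^1(\mathbb B_n,dv_\alpha)$, and \[ MO_{\alpha,t}(f)(z)=\left(B_{\alpha,t}(|f|^2)(z)-|B_{\alpha,t}(f)(z)|^2\right)^{1/2}. \] \textbf{Theorem.} Let $n\ge 1$, $\alpha>-1$, $r>0$, $0<p<\infty$ and $t\ge 0$ with $p>\dfrac{2n}{n+1+\alpha+2t}$. There is a constant $C>0$, depending only on $n,\alpha,r,p,t$, such that for every $f\in L^2(\mathbb B_n,dv_\alpha)$ \[ \int_{\mathbb B_n} MO_{\alpha,t}(f)(z)^p\,d\lambda_n(z)\le C\int_{\mathbb B_n} MO_r(f)(z)^p\,d\lambda_n(z), \] where both integrals take values in $[0,\infty]$. -/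

import Mathlib

open MeasureTheory
open scoped ComplexConjugate

namespace UnitBall

noncomputable section

/-- The open unit ball of `ℂⁿ` (Euclidean norm). -/
def unitBall (n : ℕ) : Set (EuclideanSpace ℂ (Fin n)) := Metric.ball 0 1

/-- The inner product `⟨z, w⟩ = ∑ zᵢ conj(wᵢ)`, linear in the first variable. -/
def cdot {n : ℕ} (z w : EuclideanSpace ℂ (Fin n)) : ℂ := ∑ i, z i * conj (w i)

/-- Lebesgue volume measure `v` on the unit ball, normalized so that the ball has volume one. -/
def normVolume (n : ℕ) : Measure (EuclideanSpace ℂ (Fin n)) :=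
  (volume (unitBall n))⁻¹ • volume.restrict (unitBall n)

/-- The normalizing constant `c_α`: the inverse of the integral of `(1 - |z|²)^α` with respect
to `v`. -/
def weightConst (n : ℕ) (α : ℝ) : ENNReal :=
  (∫⁻ z, ENNReal.ofReal ((1 - ‖z‖ ^ 2) ^ α) ∂(normVolume n))⁻¹

/-- The weighted probability measure `dv_α = c_α (1 - |z|²)^α dv` on the unit ball. -/
def weightedVolume (n : ℕ) (α : ℝ) : Measure (EuclideanSpace ℂ (Fin n)) :=
  weightConst n α • (normVolume n).withDensity fun z => ENNReal.ofReal ((1 - ‖z‖ ^ 2) ^ α)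

/-- The Möbius invariant measure `dλ_n = dv / (1 - |z|²)^(n+1)` on the unit ball. -/
def invariantVolume (n : ℕ) : Measure (EuclideanSpace ℂ (Fin n)) :=
  (normVolume n).withDensity fun z => ENNReal.ofReal (((1 - ‖z‖ ^ 2) ^ (n + 1))⁻¹)

/-- The orthogonal projection of `w` onto the complex line spanned by `a` (zero if `a = 0`). -/
def lineProj {n : ℕ} (a w : EuclideanSpace ℂ (Fin n)) : EuclideanSpace ℂ (Fin n) :=
  (cdot w a / cdot a a) • a

/-- The involutive Möbius automorphism `φ_a` of the unit ball exchanging `0` and `a`: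
`φ_a(w) = (a - P_a w - √(1 - |a|²) (w - P_a w)) / (1 - ⟨w, a⟩)`. -/
def moebius {n : ℕ} (a w : EuclideanSpace ℂ (Fin n)) : EuclideanSpace ℂ (Fin n) :=
  (1 - cdot w a)⁻¹ • (a - lineProj a w - (Real.sqrt (1 - ‖a‖ ^ 2) : ℂ) • (w - lineProj a w))

/-- The hyperbolic distance induced by the Bergman metric,
`β(z, w) = (1/2) log ((1 + |φ_z(w)|) / (1 - |φ_z(w)|))`, for `z`, `w` in the unit ball. -/
def bergmanDist {n : ℕ} (z w : EuclideanSpace ℂ (Fin n)) : ℝ :=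
  (1 / 2) * Real.log ((1 + ‖moebius z w‖) / (1 - ‖moebius z w‖))

/-- The Bergman metric ball `D(z, r)`. -/
def bergmanBall {n : ℕ} (z : EuclideanSpace ℂ (Fin n)) (r : ℝ) :
    Set (EuclideanSpace ℂ (Fin n)) :=
  {w | w ∈ unitBall n ∧ bergmanDist z w < r}

/-- The averaging function: the `v_α`-mean of `f` over `D(z, r)`. -/
def localMean {n : ℕ} (α r : ℝ) (f : EuclideanSpace ℂ (Fin n) → ℂ)
    (z : EuclideanSpace ℂ (Fin n)) : ℂ :=
  ⨍ w in bergmanBall z r, f w ∂(weightedVolume n α)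

/-- The local mean oscillation `MO_r(f)(z)`. -/
def localMO {n : ℕ} (α r : ℝ) (f : EuclideanSpace ℂ (Fin n) → ℂ)
    (z : EuclideanSpace ℂ (Fin n)) : ℝ :=
  Real.sqrt (⨍ w in bergmanBall z r, ‖f w - localMean α r f z‖ ^ 2 ∂(weightedVolume n α))

/-- The kernel `K_z^t(w) = 1 / (1 - ⟨w, z⟩)^(n+1+α+t)` (principal branch; the base has positive
real part for `z`, `w` in the unit ball). -/
def kernelK {n : ℕ} (α t : ℝ) (z w : EuclideanSpace ℂ (Fin n)) : ℂ :=
  1 / (1 - cdot w z) ^ (((n + 1 + α + t : ℝ)) : ℂ)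

/-- The norm of `K_z^t` in `L²(v_α)`. -/
def kernelNorm {n : ℕ} (α t : ℝ) (z : EuclideanSpace ℂ (Fin n)) : ℝ :=
  Real.sqrt (∫ w, ‖kernelK α t z w‖ ^ 2 ∂(weightedVolume n α))

/-- The normalized kernel `h_z^t = K_z^t / ‖K_z^t‖_α`. -/
def kernelH {n : ℕ} (α t : ℝ) (z w : EuclideanSpace ℂ (Fin n)) : ℂ :=
  kernelK α t z w / (kernelNorm α t z : ℂ)

/-- The Berezin type transform `B_{α,t}(g)(z) = ⟨g h_z^t, h_z^t⟩_α`. -/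
def berezin {n : ℕ} (α t : ℝ) (g : EuclideanSpace ℂ (Fin n) → ℂ)
    (z : EuclideanSpace ℂ (Fin n)) : ℂ :=
  ∫ w, g w * kernelH α t z w * conj (kernelH α t z w) ∂(weightedVolume n α)

/-- The generalized mean oscillation
`MO_{α,t}(f)(z) = (B_{α,t}(|f|²)(z) - |B_{α,t}(f)(z)|²)^(1/2)`; the number `B_{α,t}(|f|²)(z)` is
real. -/
def globalMO {n : ℕ} (α t : ℝ) (f : EuclideanSpace ℂ (Fin n) → ℂ)
    (z : EuclideanSpace ℂ (Fin n)) : ℝ :=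
  Real.sqrt ((berezin α t (fun w => ((‖f w‖ ^ 2 : ℝ) : ℂ)) z).re - ‖berezin α t f z‖ ^ 2)

end

end UnitBall

/-! Write a = n+1+α, b = a+2t, q = p/2, and k_{A,B}(z,w) = (1-|z|²)^B (1-|w|²)^A / |1-⟨w,z⟩|^(A+B)
(`berKernel`). Since |h_z^t|² dv_α is a probability measure, the quantity under the root in the
global oscillation is a variance, hence at most the second moment of f about any constant c. A lower
bound for the kernel norm replaces |h_z^t|² dv_α by a multiple of k_{a,b}(z,w) dλ(w)
(`ofReal_globalMO_rpow_le`). The choice of c is the mean of f over a small ball around z.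

The difference f(w) - c is split at the mean of f over the small ball around w. The first part is
local and is handled by Tonelli (`lintegral_berKernel_sub_pavg_le`). The difference of the two means
is estimated by a chain of balls along the geodesic from z to w. A link of the chain costs the
oscillation of f near that link; the j-th link lies where 1-|φ_z(u)|² is at most a multiple of κ^j,
so inserting the weight (1-|φ_z(u)|²)^(-ε) makes the sum over links geometric. Every u met on the
way has w in its shadow as seen from z, namely |1-⟨w,u⟩| |1-⟨u,z⟩| ≤ C (1-|u|²) |1-⟨w,z⟩|
(`enorm_pavg_sub_pavg_sq_le_shadow`). By the Forelli-Rudin estimate, the integral of k_{A,B}(z,·)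
over the shadow of u is at most a multiple of k_{A,B}(z,u) (`lintegral_shadow_berKernel_le`).
Altogether the squared global oscillation at z is bounded by the integral of k_{a-ε,b-ε}(z,u) times
the squared local oscillation at u, against dλ(u).

It remains to bound this positive operator on L^q(λ). For q ≥ 1 this is Jensen and Tonelli
(`lintegral_rpow_berKernel_le_of_one_le`). For q < 1 the oscillation over a small ball is dominated
by that over larger balls with nearby centres, which allows passing to the kernel k^q, again of the
same type (`lintegral_rpow_berKernel_le_of_lt_one`); its integral in z is bounded once (b-ε)q > n.
The hypothesis on p says bq > n, which leaves room for ε. -/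

namespace UnitBall

open Set

variable {n : ℕ}

/-! ### The inner product, the defect and the quasi-distance. -/

/-- The defect `1 - |z|²`. -/
noncomputable def defect (z : EuclideanSpace ℂ (Fin n)) : ℝ := 1 - ‖z‖ ^ 2

/-- The nonisotropic quasi-distance `|1 - ⟨w, z⟩|`. -/
noncomputable def qdist (z w : EuclideanSpace ℂ (Fin n)) : ℝ := ‖1 - cdot w z‖

lemma cdot_eq_inner (z w : EuclideanSpace ℂ (Fin n)) : cdot z w = inner ℂ w z := by
  simp [cdot, PiLp.inner_apply]

lemma cdot_add_left (x y z : EuclideanSpace ℂ (Fin n)) : cdot (x + y) z = cdot x z + cdot y z := by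
  simp [cdot_eq_inner]

lemma cdot_sub_left (x y z : EuclideanSpace ℂ (Fin n)) : cdot (x - y) z = cdot x z - cdot y z := by
  simp [cdot_eq_inner]

lemma cdot_smul_left (c : ℂ) (x z : EuclideanSpace ℂ (Fin n)) :
    cdot (c • x) z = c * cdot x z := by
  simp [cdot_eq_inner]

lemma cdot_sub_right (x y z : EuclideanSpace ℂ (Fin n)) : cdot x (y - z) = cdot x y - cdot x z := by
  simp [cdot_eq_inner]

lemma cdot_smul_right (c : ℂ) (x z : EuclideanSpace ℂ (Fin n)) :
    cdot x (c • z) = conj c * cdot x z := by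
  simp [cdot_eq_inner, mul_comm]

lemma conj_cdot (x y : EuclideanSpace ℂ (Fin n)) : conj (cdot x y) = cdot y x := by
  simp [cdot_eq_inner]

lemma cdot_self (x : EuclideanSpace ℂ (Fin n)) : cdot x x = ((‖x‖ ^ 2 : ℝ) : ℂ) := by
  rw [cdot_eq_inner, inner_self_eq_norm_sq_to_K]; simp

lemma norm_cdot_le (x y : EuclideanSpace ℂ (Fin n)) : ‖cdot x y‖ ≤ ‖x‖ * ‖y‖ := by
  rw [cdot_eq_inner, mul_comm]; exact norm_inner_le_norm y x

lemma mem_unitBall {z : EuclideanSpace ℂ (Fin n)} : z ∈ unitBall n ↔ ‖z‖ < 1 := by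
  simp [unitBall]

lemma defect_pos {z : EuclideanSpace ℂ (Fin n)} (hz : z ∈ unitBall n) : 0 < defect z := by
  rw [mem_unitBall] at hz
  have := norm_nonneg z
  unfold defect; nlinarith

lemma mem_unitBall_of_defect_pos {z : EuclideanSpace ℂ (Fin n)} (hz : 0 < defect z) :
    z ∈ unitBall n := by
  rw [mem_unitBall]
  unfold defect at hz; nlinarith [norm_nonneg z]

lemma defect_le_one (z : EuclideanSpace ℂ (Fin n)) : defect z ≤ 1 := by
  unfold defect; nlinarith [norm_nonneg z]

lemma qdist_comm (z w : EuclideanSpace ℂ (Fin n)) : qdist z w = qdist w z := by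
  unfold qdist
  rw [← Complex.norm_conj, map_sub, conj_cdot, map_one]

lemma one_sub_norm_mul_le_qdist (z w : EuclideanSpace ℂ (Fin n)) :
    1 - ‖z‖ * ‖w‖ ≤ qdist z w := by
  have h1 := norm_cdot_le w z
  have h2 := norm_sub_norm_le (1 : ℂ) (cdot w z)
  rw [norm_one] at h2
  unfold qdist; nlinarith

lemma qdist_le_one_add (z w : EuclideanSpace ℂ (Fin n)) : qdist z w ≤ 1 + ‖z‖ * ‖w‖ := by
  have h1 := norm_cdot_le w z
  have h2 := norm_sub_le (1 : ℂ) (cdot w z)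
  rw [norm_one] at h2
  unfold qdist; nlinarith

/-- Chain |1-⟨w,z⟩| ≥ 1-|z||w| ≥ 1-|z| with 2(1-|z|) - (1-|z|²) = (1-|z|)². -/
lemma defect_le_two_mul_qdist {z w : EuclideanSpace ℂ (Fin n)} (hw : w ∈ unitBall n) :
    defect z ≤ 2 * qdist z w := by
  rw [mem_unitBall] at hw
  have h := one_sub_norm_mul_le_qdist z w
  have := norm_nonneg z
  have := norm_nonneg w
  unfold defect
  nlinarith [sq_nonneg (1 - ‖z‖)]

lemma qdist_pos {z w : EuclideanSpace ℂ (Fin n)} (hz : z ∈ unitBall n) (hw : w ∈ unitBall n) :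
    0 < qdist z w := by
  have := defect_le_two_mul_qdist (z := z) hw
  have := defect_pos hz
  linarith

lemma one_sub_cdot_ne_zero {z w : EuclideanSpace ℂ (Fin n)} (hz : z ∈ unitBall n)
    (hw : w ∈ unitBall n) : 1 - cdot w z ≠ 0 :=
  norm_pos_iff.mp (qdist_pos hz hw)

lemma norm_sub_sq_eq (a b : EuclideanSpace ℂ (Fin n)) :
    ‖a - b‖ ^ 2 = 2 * (1 - cdot a b).re - defect a - defect b := by
  rw [@norm_sub_sq ℂ, ← cdot_eq_inner, ← conj_cdot]
  simp [defect]; ring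

/-- The quasi-triangle inequality for `|1 - ⟨z, w⟩|`. -/
lemma qdist_triangle {a b c : EuclideanSpace ℂ (Fin n)} (ha : a ∈ unitBall n) (hb : b ∈ unitBall n)
    (hc : c ∈ unitBall n) : qdist a b ≤ 3 * (qdist a c + qdist c b) := by
  -- The cross term is quadratic in the Euclidean distances, and |a-c|² is at most 2|1-⟨a,c⟩|; so
  -- Cauchy-Schwarz and AM-GM bring it down to the scale of the quasi-distance.
  have e : 1 - cdot a b
      = (1 - cdot a c) + (1 - cdot c b) - (defect c : ℂ) + cdot (a - c) (c - b) := by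
    simp only [cdot_sub_left, cdot_sub_right, cdot_self, defect]
    push_cast; ring
  have h1 : qdist a b ≤ qdist a c + qdist c b + defect c + ‖a - c‖ * ‖c - b‖ := by
    rw [qdist_comm a b, qdist_comm a c, qdist_comm c b]
    unfold qdist
    rw [e]
    have hd : ‖(defect c : ℂ)‖ = defect c := by
      rw [Complex.norm_real, Real.norm_of_nonneg (defect_pos hc).le]
    calc _ ≤ ‖(1 - cdot a c) + (1 - cdot c b) - (defect c : ℂ)‖ + ‖cdot (a - c) (c - b)‖ :=
          norm_add_le _ _
      _ ≤ (‖1 - cdot a c‖ + ‖1 - cdot c b‖) + ‖(defect c : ℂ)‖ + ‖a - c‖ * ‖c - b‖ := by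
          gcongr
          · exact (norm_sub_le _ _).trans (by gcongr; exact norm_add_le _ _)
          · exact norm_cdot_le _ _
      _ = _ := by rw [hd]
  have h2 : ‖a - c‖ ^ 2 ≤ 2 * qdist a c := by
    rw [norm_sub_sq_eq, qdist_comm]
    have := Complex.re_le_norm (1 - cdot a c)
    have := defect_pos ha
    have := defect_pos hc
    unfold qdist; linarith
  have h3 : ‖c - b‖ ^ 2 ≤ 2 * qdist c b := by
    rw [norm_sub_sq_eq, qdist_comm]
    have := Complex.re_le_norm (1 - cdot c b)
    have := defect_pos hb
    have := defect_pos hc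
    unfold qdist; linarith
  have h4 : defect c ≤ 2 * qdist a c := by
    rw [qdist_comm]; exact defect_le_two_mul_qdist ha
  have h5 : defect c ≤ 2 * qdist c b := defect_le_two_mul_qdist hb
  nlinarith [sq_nonneg (‖a - c‖ - ‖c - b‖)]

/-! ### Möbius automorphisms and the pseudo-hyperbolic metric. -/

lemma cdot_zero_right (x : EuclideanSpace ℂ (Fin n)) : cdot x 0 = 0 := by simp [cdot_eq_inner]
lemma cdot_zero_left (x : EuclideanSpace ℂ (Fin n)) : cdot 0 x = 0 := by simp [cdot_eq_inner]

lemma moebius_zero_left (w : EuclideanSpace ℂ (Fin n)) : moebius 0 w = -w := by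
  simp [moebius, lineProj, cdot_zero_right]

lemma moebius_zero_right (a : EuclideanSpace ℂ (Fin n)) : moebius a 0 = a := by
  simp [moebius, lineProj, cdot_zero_left]

lemma cdot_lineProj_self (a w : EuclideanSpace ℂ (Fin n)) : cdot (lineProj a w) a = cdot w a := by
  by_cases h : a = 0
  · simp [h, cdot_zero_right]
  · have : cdot a a ≠ 0 := by
      rw [cdot_self]; simpa using h
    rw [lineProj, cdot_smul_left, div_mul_cancel₀ _ this]

lemma sqrt_sq_defect {a : EuclideanSpace ℂ (Fin n)} (ha : a ∈ unitBall n) :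
    ((Real.sqrt (1 - ‖a‖ ^ 2) : ℝ) : ℂ) ^ 2 = (defect a : ℂ) := by
  rw [← Complex.ofReal_pow, Real.sq_sqrt (show 0 ≤ 1 - ‖a‖ ^ 2 from (defect_pos ha).le)]; rfl

/-- The fundamental identity for the automorphisms `φ_a`. -/
lemma one_sub_cdot_moebius {a z w : EuclideanSpace ℂ (Fin n)} (ha : a ∈ unitBall n)
    (hz : z ∈ unitBall n) (hw : w ∈ unitBall n) :
    1 - cdot (moebius a z) (moebius a w)
      = defect a * (1 - cdot z w) / ((1 - cdot z a) * (1 - cdot a w)) := by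
  have hs := sqrt_sq_defect ha
  have h1 := one_sub_cdot_ne_zero ha hz
  have h2 := one_sub_cdot_ne_zero hw ha
  rw [eq_div_iff (mul_ne_zero h1 h2)]
  by_cases h0 : a = 0
  · subst h0
    simp [moebius_zero_left, cdot_zero_left, cdot_zero_right, defect]
    simp [cdot]
  have haa : cdot a a ≠ 0 := by rw [cdot_self]; simpa using h0
  set s : ℂ := ((Real.sqrt (1 - ‖a‖ ^ 2) : ℝ) : ℂ)
  have hsc : conj s = s := Complex.conj_ofReal _
  have hN : cdot (moebius a z) (moebius a w) * ((1 - cdot z a) * (1 - cdot a w))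
      = cdot (a - lineProj a z - s • (z - lineProj a z))
          (a - lineProj a w - s • (w - lineProj a w)) := by
    rw [moebius, moebius, cdot_smul_left, cdot_smul_right]
    simp only [map_inv₀, map_sub, map_one, conj_cdot]
    field_simp
    rfl
  rw [sub_mul, hN, ← hs]
  simp only [cdot_sub_left, cdot_sub_right, lineProj, cdot_smul_left, cdot_smul_right, hsc,
    map_div₀, conj_cdot]
  have hA : (s ^ 2 : ℂ) = 1 - cdot a a := by rw [hs, cdot_self, defect]; push_cast; ring
  field_simp
  linear_combination (cdot a w * cdot z a - cdot a a) * hA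

/-- The pseudo-hyperbolic distance. -/
noncomputable def pdist (z w : EuclideanSpace ℂ (Fin n)) : ℝ := ‖moebius z w‖

/-- The diagonal case of `one_sub_cdot_moebius`. -/
lemma defect_moebius {a z : EuclideanSpace ℂ (Fin n)} (ha : a ∈ unitBall n)
    (hz : z ∈ unitBall n) :
    defect (moebius a z) = defect a * defect z / qdist a z ^ 2 := by
  have h := one_sub_cdot_moebius ha hz hz
  have h2 : (1 - cdot z a) * (1 - cdot a z) = ((qdist a z ^ 2 : ℝ) : ℂ) := by
    have : 1 - cdot a z = conj (1 - cdot z a) := by simp [conj_cdot]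
    rw [this, Complex.mul_conj, qdist, Complex.normSq_eq_norm_sq]
  rw [h2, cdot_self, cdot_self] at h
  unfold defect at h ⊢
  exact_mod_cast h

lemma moebius_mem {a z : EuclideanSpace ℂ (Fin n)} (ha : a ∈ unitBall n)
    (hz : z ∈ unitBall n) : moebius a z ∈ unitBall n := by
  apply mem_unitBall_of_defect_pos
  rw [defect_moebius ha hz]
  have := defect_pos ha
  have := defect_pos hz
  have := qdist_pos ha hz
  positivity

lemma qdist_moebius {a z w : EuclideanSpace ℂ (Fin n)} (ha : a ∈ unitBall n)
    (hz : z ∈ unitBall n) (hw : w ∈ unitBall n) :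
    qdist (moebius a z) (moebius a w) = defect a * qdist z w / (qdist a z * qdist a w) := by
  rw [qdist, one_sub_cdot_moebius ha hw hz, norm_div, norm_mul, norm_mul, Complex.norm_real,
    Real.norm_of_nonneg (defect_pos ha).le, qdist_comm a z]
  simp only [qdist]
  rw [mul_comm ‖1 - cdot w a‖]

lemma pdist_sq {z w : EuclideanSpace ℂ (Fin n)} (hz : z ∈ unitBall n) (hw : w ∈ unitBall n) :
    pdist z w ^ 2 = 1 - defect z * defect w / qdist z w ^ 2 := by
  rw [← defect_moebius hz hw, defect, pdist]; ring

lemma pdist_nonneg (z w : EuclideanSpace ℂ (Fin n)) : 0 ≤ pdist z w := norm_nonneg _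

lemma pdist_comm {z w : EuclideanSpace ℂ (Fin n)} (hz : z ∈ unitBall n) (hw : w ∈ unitBall n) :
    pdist z w = pdist w z := by
  rw [← sq_eq_sq₀ (pdist_nonneg _ _) (pdist_nonneg _ _), pdist_sq hz hw, pdist_sq hw hz,
    qdist_comm, mul_comm (defect z)]

lemma pdist_moebius {a z w : EuclideanSpace ℂ (Fin n)} (ha : a ∈ unitBall n)
    (hz : z ∈ unitBall n) (hw : w ∈ unitBall n) :
    pdist (moebius a z) (moebius a w) = pdist z w := by
  rw [← sq_eq_sq₀ (pdist_nonneg _ _) (pdist_nonneg _ _), pdist_sq hz hw,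
    pdist_sq (moebius_mem ha hz) (moebius_mem ha hw), qdist_moebius ha hz hw,
    defect_moebius ha hz, defect_moebius ha hw]
  have := defect_pos ha
  have := defect_pos hz
  have := qdist_pos ha hz
  have := qdist_pos ha hw
  have := qdist_pos hz hw
  field_simp

/-- Bounding |1-⟨w,z⟩| by 1+|z||w| gives the sharper value (|z|+|w|)/(1+|z||w|). This is the
triangle inequality through the origin; invariance moves it to any intermediate point. -/
lemma pdist_le_norm_add_norm {z w : EuclideanSpace ℂ (Fin n)} (hz : z ∈ unitBall n)
    (hw : w ∈ unitBall n) : pdist z w ≤ ‖z‖ + ‖w‖ := by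
  have h0 := norm_nonneg z
  have h0' := norm_nonneg w
  refine abs_le_of_sq_le_sq' ?_ (by positivity) |>.2
  rw [pdist_sq hz hw]
  have hq := qdist_pos hz hw
  have h1 := qdist_le_one_add z w
  have h2 : defect z * defect w / (1 + ‖z‖ * ‖w‖) ^ 2 ≤ defect z * defect w / qdist z w ^ 2 := by
    have := defect_pos hz
    have := defect_pos hw
    gcongr
  have h3 : 1 - defect z * defect w / (1 + ‖z‖ * ‖w‖) ^ 2
      = (‖z‖ + ‖w‖) ^ 2 / (1 + ‖z‖ * ‖w‖) ^ 2 := by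
    have : 0 < 1 + ‖z‖ * ‖w‖ := by positivity
    unfold defect; field_simp; ring
  have h4 : (‖z‖ + ‖w‖) ^ 2 / (1 + ‖z‖ * ‖w‖) ^ 2 ≤ (‖z‖ + ‖w‖) ^ 2 :=
    div_le_self (by positivity) (one_le_pow₀ (by nlinarith [mul_nonneg h0 h0']))
  linarith

lemma pdist_triangle {a z w : EuclideanSpace ℂ (Fin n)} (ha : a ∈ unitBall n)
    (hz : z ∈ unitBall n) (hw : w ∈ unitBall n) : pdist z w ≤ pdist z a + pdist a w := by
  rw [← pdist_moebius ha hz hw, pdist_comm hz ha]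
  exact pdist_le_norm_add_norm (moebius_mem ha hz) (moebius_mem ha hw)

/-- Both sides are combinations of a and z, and matching coefficients only uses that the square root
in φ_a squares to 1-|a|². -/
lemma moebius_moebius {a z : EuclideanSpace ℂ (Fin n)} (ha : a ∈ unitBall n)
    (hz : z ∈ unitBall n) : moebius a (moebius a z) = z := by
  by_cases h0 : a = 0
  · subst h0; simp [moebius_zero_left]
  have haa : cdot a a ≠ 0 := by rw [cdot_self]; simpa using h0
  have hs := sqrt_sq_defect ha
  have hd : (defect a : ℂ) ≠ 0 := by exact_mod_cast (defect_pos ha).ne'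
  have h1 := one_sub_cdot_ne_zero ha hz
  have hA : (defect a : ℂ) = 1 - cdot a a := by rw [cdot_self, defect]; push_cast; ring
  set s : ℂ := ((Real.sqrt (1 - ‖a‖ ^ 2) : ℝ) : ℂ) with hsdef
  have hm : moebius a z = (1 - cdot z a)⁻¹ • (a - lineProj a z - s • (z - lineProj a z)) := rfl
  have hc : cdot (moebius a z) a = (cdot a a - cdot z a) / (1 - cdot z a) := by
    rw [hm, cdot_smul_left]
    simp only [cdot_sub_left, cdot_smul_left, cdot_lineProj_self]
    field_simp; ring
  have hc' : 1 - cdot (moebius a z) a = defect a / (1 - cdot z a) := by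
    rw [hc, hA]; field_simp; ring
  have hL : lineProj a (moebius a z) = ((cdot a a - cdot z a) / (1 - cdot z a) / cdot a a) • a := by
    rw [lineProj, hc]
  rw [moebius, hc', hL, hm, ← hsdef, lineProj]
  have : ∀ (x y p q : ℂ), x = p → y = q → x • a + y • z = p • a + q • z := by
    rintro x y p q rfl rfl; rfl
  trans (((defect a / (1 - cdot z a))⁻¹ * (1 - (cdot a a - cdot z a) / (1 - cdot z a) / cdot a a
      - s * ((1 - cdot z a)⁻¹ * (1 - cdot z a / cdot a a + s * (cdot z a / cdot a a))
        - (cdot a a - cdot z a) / (1 - cdot z a) / cdot a a))) • a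
      + ((defect a / (1 - cdot z a))⁻¹ * (s * ((1 - cdot z a)⁻¹ * s))) • z)
  · module
  · conv_rhs => rw [show z = (0 : ℂ) • a + (1 : ℂ) • z by simp]
    apply this
    · field_simp
      linear_combination (-(cdot z a)) * hA - (cdot z a) * hs
    · field_simp
      linear_combination hs

/-- Points at pseudo-hyperbolic distance less than `s` have comparable defects. -/
lemma defect_le_of_pdist_lt {s : ℝ} (hs1 : s < 1) {z w : EuclideanSpace ℂ (Fin n)}
    (hz : z ∈ unitBall n) (hw : w ∈ unitBall n) (h : pdist z w < s) :
    qdist z w ≤ 2 / (1 - s ^ 2) * defect z ∧ defect w ≤ 4 / (1 - s ^ 2) * defect z := by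
  have h0 := pdist_nonneg z w
  have hs : 0 < 1 - s ^ 2 := by nlinarith
  have hq := qdist_pos hz hw
  have e := pdist_sq hz hw
  have hdz := defect_pos hz
  have hdw := defect_pos hw
  have h1 : (1 - s ^ 2) * qdist z w ^ 2 ≤ defect z * defect w := by
    rw [← le_div_iff₀ (by positivity)]; nlinarith
  have h2 : defect w ≤ 2 * qdist z w := by
    rw [qdist_comm]; exact defect_le_two_mul_qdist hz
  have h3 : qdist z w ≤ 2 / (1 - s ^ 2) * defect z := by
    rw [div_mul_eq_mul_div, le_div_iff₀ hs]
    have : (1 - s ^ 2) * qdist z w * qdist z w ≤ 2 * defect z * qdist z w := by nlinarith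
    nlinarith [le_of_mul_le_mul_right this hq]
  refine ⟨h3, ?_⟩
  calc defect w ≤ 2 * (2 / (1 - s ^ 2) * defect z) := by linarith
    _ = _ := by ring

/-- The quasi-triangle inequality through z, where |1-⟨w,z⟩| is at most a multiple of 1-|z|² and
hence of |1-⟨x,z⟩|. The constant is 15 = 3·(4+1). -/
lemma qdist_le_of_pdist_lt {s : ℝ} (hs1 : s < 1) {z w x : EuclideanSpace ℂ (Fin n)}
    (hz : z ∈ unitBall n) (hw : w ∈ unitBall n) (hx : x ∈ unitBall n) (h : pdist z w < s) :
    qdist w x ≤ 15 / (1 - s ^ 2) * qdist z x := by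
  have h0 := pdist_nonneg z w
  have hs : 0 < 1 - s ^ 2 := by nlinarith
  have h1 := (defect_le_of_pdist_lt hs1 hz hw h).1
  have h2 := qdist_triangle hw hx hz
  have h3 := defect_le_two_mul_qdist (z := z) hx
  have h4 := qdist_pos hz hx
  rw [qdist_comm w z] at h2
  have h5 : 1 ≤ 1 / (1 - s ^ 2) := by
    rw [le_div_iff₀ hs]; nlinarith [sq_nonneg s]
  calc qdist w x ≤ 3 * (2 / (1 - s ^ 2) * (2 * qdist z x) + 1 * qdist z x) := by
        have : 2 / (1 - s ^ 2) * defect z ≤ 2 / (1 - s ^ 2) * (2 * qdist z x) := by gcongr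
        linarith
    _ ≤ 3 * (2 / (1 - s ^ 2) * (2 * qdist z x) + 1 / (1 - s ^ 2) * qdist z x) := by gcongr
    _ = _ := by ring

/-! ### Measurability, and Lebesgue volume of nonisotropic and pseudo-hyperbolic balls. -/

lemma continuous_qdist :
    Continuous fun p : EuclideanSpace ℂ (Fin n) × EuclideanSpace ℂ (Fin n) => qdist p.1 p.2 := by
  have h : Continuous fun p : EuclideanSpace ℂ (Fin n) × EuclideanSpace ℂ (Fin n) =>
      cdot p.2 p.1 := by
    simp only [cdot_eq_inner]
    fun_prop
  simp only [qdist]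
  exact (continuous_const.sub h).norm

lemma measurable_qdist {X : Type*} [MeasurableSpace X] {f g : X → EuclideanSpace ℂ (Fin n)}
    (hf : Measurable f) (hg : Measurable g) : Measurable fun x => qdist (f x) (g x) := by
  have h : Measurable fun p : EuclideanSpace ℂ (Fin n) × EuclideanSpace ℂ (Fin n) =>
      qdist p.1 p.2 := continuous_qdist.measurable
  have h2 := h.comp (hf.prodMk hg)
  exact h2

lemma measurable_defect : Measurable (defect (n := n)) := by
  unfold defect; fun_prop

lemma measurableSet_unitBall : MeasurableSet (unitBall n) := measurableSet_ball

/-- The linear map scaling the complex line through the unit vector `e` by `c * k ^ 2` and its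
orthogonal complement by `c * k`. -/
noncomputable def anisoMap (e : EuclideanSpace ℂ (Fin n)) (c k : ℝ) :
    EuclideanSpace ℂ (Fin n) →ₗ[ℂ] EuclideanSpace ℂ (Fin n) :=
  ((c * k : ℝ) : ℂ) • LinearMap.transvection (((k - 1 : ℝ) : ℂ) • (innerₛₗ ℂ e)) e

lemma anisoMap_apply (e x : EuclideanSpace ℂ (Fin n)) (c k : ℝ) :
    anisoMap e c k x = ((c * k : ℝ) : ℂ) • (x + (((k - 1 : ℝ) : ℂ) * cdot x e) • e) := by
  simp [anisoMap, LinearMap.transvection.apply, cdot_eq_inner]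

/-- The real determinant of a complex linear map is the squared modulus of its complex determinant,
here (ck)^n k. -/
lemma volume_anisoMap_image {e : EuclideanSpace ℂ (Fin n)} (he : ‖e‖ = 1) (c k : ℝ)
    (s : Set (EuclideanSpace ℂ (Fin n))) :
    volume (anisoMap e c k '' s) = ENNReal.ofReal ((c * k) ^ (2 * n) * k ^ 2) * volume s := by
  have h := Measure.addHaar_image_linearMap (volume : Measure (EuclideanSpace ℂ (Fin n)))
    ((anisoMap e c k).restrictScalars ℝ) s
  rw [LinearMap.det_restrictScalars, Algebra.norm_complex_apply] at h
  have hd : LinearMap.det (anisoMap e c k) = (((c * k) ^ n * k : ℝ) : ℂ) := by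
    rw [anisoMap, LinearMap.det_smul, LinearMap.transvection.det]
    simp [he]
  rw [hd, Complex.normSq_ofReal] at h
  rw [abs_of_nonneg (mul_self_nonneg _)] at h
  rw [show (c * k) ^ (2 * n) * k ^ 2 = (c * k) ^ n * k * ((c * k) ^ n * k) by ring]
  exact h

/-- The nonisotropic ball `{w : |1 - ⟨w, a⟩| < R}` has volume at most a multiple of `R ^ (n + 1)`. -/
lemma volume_qball_le (n : ℕ) : ∃ C : ℝ, 0 < C ∧ ∀ a ∈ unitBall n, ∀ R : ℝ, 0 < R →
    volume {w | w ∈ unitBall n ∧ qdist a w < R} ≤ ENNReal.ofReal (C * R ^ (n + 1)) := by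
  have hfin : volume (unitBall n) ≠ ⊤ := measure_ball_lt_top.ne
  set V := (volume (unitBall n)).toReal with hV
  have hVe : volume (unitBall n) = ENNReal.ofReal V := (ENNReal.ofReal_toReal hfin).symm
  have hV0 : 0 ≤ V := ENNReal.toReal_nonneg
  refine ⟨(2 ^ (n + 1) + 5 ^ (2 * n)) * (V + 1), by positivity, fun a ha R hR => ?_⟩
  have hsub : {w | w ∈ unitBall n ∧ qdist a w < R} ⊆ unitBall n := fun w hw => hw.1
  -- For R ≥ 1/2 the volume of the whole ball suffices, at the price of 2^(n+1). Below that, the set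
  -- is empty unless |a| > 1/2, so that a has a direction.
  by_cases hcase : 1 / 2 ≤ R
  · refine (measure_mono hsub).trans ?_
    rw [hVe]
    apply ENNReal.ofReal_le_ofReal
    have h1 : (1 / 2 : ℝ) ^ (n + 1) ≤ R ^ (n + 1) := by gcongr
    have h2 : (2 : ℝ) ^ (n + 1) * (1 / 2) ^ (n + 1) = 1 := by
      rw [← mul_pow]; norm_num
    have h3 : 1 ≤ (2 : ℝ) ^ (n + 1) * R ^ (n + 1) := by
      rw [← h2]; gcongr
    have h4 : (0 : ℝ) ≤ 5 ^ (2 * n) * R ^ (n + 1) := by positivity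
    nlinarith [mul_nonneg hV0 h4, mul_nonneg hV0 (sub_nonneg.2 h3)]
  · push Not at hcase
    by_cases ha2 : ‖a‖ ≤ 1 / 2
    · have : {w | w ∈ unitBall n ∧ qdist a w < R} = ∅ := by
        ext w
        simp only [mem_ofPred_eq, mem_empty_iff_false, iff_false, not_and, not_lt]
        intro hw
        rw [mem_unitBall] at hw
        have := one_sub_norm_mul_le_qdist a w
        nlinarith [norm_nonneg a, norm_nonneg w]
      rw [this]; simp
    push Not at ha2
    have ha0 : (0 : ℝ) < ‖a‖ := by linarith
    obtain ⟨e, hedef⟩ : ∃ e : EuclideanSpace ℂ (Fin n), e = ((‖a‖⁻¹ : ℝ) : ℂ) • a := ⟨_, rfl⟩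
    have he : ‖e‖ = 1 := by
      rw [hedef, norm_smul, Complex.norm_real, norm_inv, norm_norm, inv_mul_cancel₀ ha0.ne']
    have hee : cdot e e = 1 := by rw [cdot_self, he]; simp
    set k := Real.sqrt R with hk
    have hk0 : 0 < k := Real.sqrt_pos.2 hR
    have hk2 : k ^ 2 = R := Real.sq_sqrt hR.le
    -- The ball lies in an ellipsoid about the boundary point e = a/|a|, of size R along the complex
    -- line of e and √R across it; its volume is of order R² · R^(n-1).
    have hincl : {w | w ∈ unitBall n ∧ qdist a w < R}
        ⊆ (fun x => e + x) '' (anisoMap e 5 k '' unitBall n) := by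
      rintro w ⟨hw, hq⟩
      set l := cdot w e with hl
      have hl' : (‖a‖ : ℂ) * l = cdot w a := by
        rw [hl, hedef, cdot_smul_right]
        have : (‖a‖ : ℂ) ≠ 0 := by exact_mod_cast ha0.ne'
        simp only [Complex.conj_ofReal]
        push_cast
        field_simp
      have hna : ‖a‖ < 1 := mem_unitBall.1 ha
      have hnw : ‖w‖ < 1 := mem_unitBall.1 hw
      have h1 : ‖1 - l‖ ≤ 4 * R := by
        have h2 : ‖a‖ * ‖1 - l‖ ≤ 2 * R := by
          have e1 : ((‖a‖ : ℝ) : ℂ) * (1 - l) = (1 - cdot w a) - ((1 - ‖a‖ : ℝ) : ℂ) := by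
            rw [← hl']; push_cast; ring
          have h3 : 1 - ‖a‖ ≤ qdist a w := by
            have := one_sub_norm_mul_le_qdist a w
            nlinarith
          calc ‖a‖ * ‖1 - l‖ = ‖((‖a‖ : ℝ) : ℂ) * (1 - l)‖ := by
                rw [norm_mul, Complex.norm_real, norm_norm]
            _ ≤ ‖1 - cdot w a‖ + ‖((1 - ‖a‖ : ℝ) : ℂ)‖ := by rw [e1]; exact norm_sub_le _ _
            _ ≤ R + R := by
                rw [Complex.norm_real, Real.norm_of_nonneg (by linarith)]
                unfold qdist at *
                linarith
            _ = _ := by ring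
        nlinarith [norm_nonneg (1 - l)]
      have hye : cdot (w - l • e) e = 0 := by
        rw [cdot_sub_left, cdot_smul_left, hee, ← hl]; ring
      have hort : ∀ m m' : ℂ, ‖m • e + m' • (w - l • e)‖ ^ 2
          = ‖m‖ ^ 2 + ‖m'‖ ^ 2 * ‖w - l • e‖ ^ 2 := by
        intro m m'
        rw [@norm_add_sq ℂ, inner_smul_left, inner_smul_right, ← cdot_eq_inner, hye, norm_smul,
          norm_smul, he]
        simp; ring
      have hy2 : ‖w - l • e‖ ^ 2 ≤ 8 * R := by
        have h2 := hort l 1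
        rw [norm_one, one_smul, add_sub_cancel] at h2
        have h3 : 1 - ‖l‖ ≤ 4 * R := by
          have := norm_sub_norm_le (1 : ℂ) l
          rw [norm_one] at this; linarith
        have : ‖l‖ ≤ 1 := by
          have := norm_cdot_le w e
          rw [he, ← hl] at this; linarith
        nlinarith [norm_nonneg l, norm_nonneg w]
      -- The factor 5 works because the rescaled components have squared norms at most 16/25 and
      -- 8/25, with sum below 1.
      refine ⟨w - e, ⟨((l - 1) / (5 * R : ℝ)) • e + ((1 : ℂ) / (5 * k : ℝ)) • (w - l • e), ?_, ?_⟩,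
        by simp⟩
      · rw [mem_unitBall, ← sq_lt_one_iff₀ (norm_nonneg _), hort, norm_div, norm_div,
          Complex.norm_real, Complex.norm_real, Real.norm_of_nonneg (by positivity),
          Real.norm_of_nonneg (by positivity), norm_one, ← norm_neg, neg_sub, div_pow, div_pow,
          mul_pow 5 k, hk2]
        have h3 : ‖1 - l‖ ^ 2 ≤ (4 * R) ^ 2 := by gcongr
        have h4 : ‖1 - l‖ ^ 2 / (5 * R) ^ 2 ≤ (4 * R) ^ 2 / (5 * R) ^ 2 := by gcongr
        have h5 : (1 : ℝ) ^ 2 / (5 ^ 2 * R) * ‖w - l • e‖ ^ 2 ≤ 1 ^ 2 / (5 ^ 2 * R) * (8 * R) := by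
          gcongr
        have h6 : (4 * R) ^ 2 / (5 * R) ^ 2 = 16 / 25 := by field_simp; norm_num
        have h7 : 1 ^ 2 / (5 ^ 2 * R) * (8 * R) = 8 / 25 := by field_simp; norm_num
        linarith
      · have hkc : (k : ℂ) ≠ 0 := by exact_mod_cast hk0.ne'
        have hRc : (R : ℂ) = (k : ℂ) ^ 2 := by rw [← hk2]; push_cast; rfl
        rw [anisoMap_apply, cdot_add_left, cdot_smul_left, cdot_smul_left, hye, hee]
        push_cast
        rw [hRc]
        have : w - e = (l - 1) • e + (w - l • e) := by module
        rw [this]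
        generalize w - l • e = y
        have key : ∀ (x y' p q : ℂ), x = p → y' = q → x • e + y' • y = p • e + q • y := by
          rintro x y' p q rfl rfl; rfl
        trans ((5 * k * ((l - 1) / (5 * k ^ 2) + (k - 1) * ((l - 1) / (5 * k ^ 2)))) • e
          + (5 * k * (1 / (5 * k)) : ℂ) • y)
        · module
        · conv_rhs => rw [← one_smul ℂ y]
          apply key <;> field_simp
          ring
    refine (measure_mono hincl).trans ?_
    rw [image_add_left, measure_preimage_add, volume_anisoMap_image he, hVe,
      ← ENNReal.ofReal_mul (by positivity)]
    apply ENNReal.ofReal_le_ofReal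
    have h5 : (5 * k) ^ (2 * n) * k ^ 2 = 5 ^ (2 * n) * R ^ (n + 1) := by
      rw [← hk2]; ring
    rw [h5]
    have : (0 : ℝ) ≤ R ^ (n + 1) := by positivity
    have h6 : (5 : ℝ) ^ (2 * n) * R ^ (n + 1) * V ≤ 5 ^ (2 * n) * R ^ (n + 1) * (V + 1) := by
      gcongr; linarith
    have h7 : 0 ≤ (2 : ℝ) ^ (n + 1) * R ^ (n + 1) * (V + 1) := by positivity
    linarith

/-- Small pseudo-hyperbolic balls contain large anisotropic boxes. -/
lemma volume_pball_ge (hn : 1 ≤ n) {s : ℝ} (hs : 0 < s) : ∃ c : ℝ, 0 < c ∧ ∀ z ∈ unitBall n,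
    ENNReal.ofReal (c * defect z ^ (n + 1))
      ≤ volume {w | w ∈ unitBall n ∧ pdist z w < s} := by
  have hfin : volume (unitBall n) ≠ ⊤ := measure_ball_lt_top.ne
  have hpos : 0 < volume (unitBall n) := Metric.measure_ball_pos _ _ one_pos
  set V := (volume (unitBall n)).toReal with hV
  have hVe : volume (unitBall n) = ENNReal.ofReal V := (ENNReal.ofReal_toReal hfin).symm
  have hV0 : 0 < V := ENNReal.toReal_pos hpos.ne' hfin
  -- The bound 1/4 keeps the ellipsoid about z inside the unit ball; the bound s/4 makes the
  -- pseudo-hyperbolic distance to z less than s.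
  set c := min (1 / 4) (s / 4) with hc
  have hc0 : 0 < c := by positivity
  have hc1 : c ≤ 1 / 4 := min_le_left _ _
  have hc2 : c ≤ s / 4 := min_le_right _ _
  refine ⟨c ^ (2 * n) * V, by positivity, fun z hz => ?_⟩
  have hd := defect_pos hz
  set h := defect z with hh
  have hh1 : h ≤ 1 := defect_le_one z
  obtain ⟨e, he, hze⟩ : ∃ e : EuclideanSpace ℂ (Fin n), ‖e‖ = 1 ∧ z = (‖z‖ : ℂ) • e := by
    by_cases h0 : z = 0
    · refine ⟨EuclideanSpace.single ⟨0, hn⟩ 1, by simp, by simp [h0]⟩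
    · have : ‖z‖ ≠ 0 := norm_ne_zero_iff.2 h0
      refine ⟨((‖z‖⁻¹ : ℝ) : ℂ) • z, ?_, ?_⟩
      · rw [norm_smul, Complex.norm_real, norm_inv, norm_norm, inv_mul_cancel₀ this]
      · rw [smul_smul, ← Complex.ofReal_mul, mul_inv_cancel₀ this]; simp
  have hee : cdot e e = 1 := by rw [cdot_self, he]; simp
  set k := Real.sqrt h with hk
  have hk0 : 0 < k := Real.sqrt_pos.2 hd
  have hk2 : k ^ 2 = h := Real.sq_sqrt hd.le
  have hincl : (fun x => z + x) '' (anisoMap e c k '' unitBall n)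
      ⊆ {w | w ∈ unitBall n ∧ pdist z w < s} := by
    rintro _ ⟨_, ⟨y, hy, rfl⟩, rfl⟩
    rw [mem_unitBall] at hy
    set x := anisoMap e c k y with hx
    have hye : ‖cdot y e‖ ≤ 1 := by
      have := norm_cdot_le y e
      rw [he] at this; linarith
    have hxe : cdot x e = (c * h : ℝ) * cdot y e := by
      rw [hx, anisoMap_apply, cdot_smul_left, cdot_add_left, cdot_smul_left, hee, ← hk2]
      push_cast; ring
    have hnz : ‖z‖ < 1 := mem_unitBall.1 hz
    have hxz : ‖cdot x z‖ ≤ c * h := by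
      rw [hze, cdot_smul_right, hxe, norm_mul, norm_mul, Complex.norm_real,
        Real.norm_of_nonneg (by positivity), Complex.norm_conj, Complex.norm_real, norm_norm]
      calc _ ≤ 1 * (c * h * 1) := by gcongr
        _ = _ := by ring
    have hxx : ‖x‖ ^ 2 ≤ c ^ 2 * h := by
      have e1 : x = ((c * k : ℝ) : ℂ) • ((y - (cdot y e) • e) + ((k : ℂ) * cdot y e) • e) := by
        rw [hx, anisoMap_apply]; push_cast; module
      have hye0 : cdot (y - cdot y e • e) e = 0 := by
        rw [cdot_sub_left, cdot_smul_left, hee]; ring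
      have hort : ∀ m : ℂ, ‖(y - (cdot y e) • e) + m • e‖ ^ 2
          = ‖y - (cdot y e) • e‖ ^ 2 + ‖m‖ ^ 2 := by
        intro m
        rw [@norm_add_sq ℂ, inner_smul_right, ← inner_conj_symm, ← cdot_eq_inner, hye0, norm_smul,
          he]
        simp
      have h1 := hort (cdot y e)
      rw [sub_add_cancel] at h1
      rw [e1, norm_smul, mul_pow, hort, Complex.norm_real, Real.norm_of_nonneg (by positivity),
        mul_pow, hk2, norm_mul, Complex.norm_real, Real.norm_of_nonneg hk0.le, mul_pow, hk2]
      have h2 : ‖y‖ ^ 2 ≤ 1 := by nlinarith [norm_nonneg y]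
      have h3 : h * ‖cdot y e‖ ^ 2 ≤ 1 * ‖cdot y e‖ ^ 2 := by gcongr
      calc _ ≤ c ^ 2 * h * 1 := by gcongr; linarith
        _ = _ := by ring
    have hre : |(cdot x z).re| ≤ c * h := (Complex.abs_re_le_norm _).trans hxz
    have hre' := abs_le.1 hre
    have e2 : defect (z + x) = h - 2 * (cdot x z).re - ‖x‖ ^ 2 := by
      rw [defect, @norm_add_sq ℂ, ← cdot_eq_inner, hh, defect]
      simp only [RCLike.re_to_complex]; ring
    have hball : z + x ∈ unitBall n := by
      apply mem_unitBall_of_defect_pos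
      rw [e2]
      nlinarith [mul_nonneg hc0.le hd.le]
    refine ⟨hball, ?_⟩
    have e3 : 1 - cdot (z + x) z = (h : ℂ) - cdot x z := by
      rw [cdot_add_left, cdot_self, hh, defect]; push_cast; ring
    have e4 : qdist z (z + x) ^ 2 = h ^ 2 - 2 * h * (cdot x z).re + ‖cdot x z‖ ^ 2 := by
      rw [qdist, e3, ← Complex.normSq_eq_norm_sq, ← Complex.normSq_eq_norm_sq, Complex.normSq_apply,
        Complex.normSq_apply]
      simp; ring
    have hq := qdist_pos hz hball
    have h5 : h / 2 ≤ qdist z (z + x) := by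
      have := defect_le_two_mul_qdist (z := z) hball
      linarith
    refine lt_of_pow_lt_pow_left₀ 2 hs.le ?_
    -- The terms linear in Re⟨x,z⟩ cancel: |1-⟨z+x,z⟩|² - h(1-|z+x|²) = |⟨x,z⟩|² + h|x|² ≤ 2c²h² ≤
    -- s²h²/8, whereas s²|1-⟨z+x,z⟩|² ≥ s²h²/4.
    rw [pdist_sq hz hball, ← hh, e2, sub_lt_comm, lt_div_iff₀ (by positivity), e4]
    have h6 : (h / 2) ^ 2 ≤ qdist z (z + x) ^ 2 := by gcongr
    rw [e4] at h6
    have h7 : ‖cdot x z‖ ^ 2 ≤ (c * h) ^ 2 := by gcongr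
    have h8 : h * ‖x‖ ^ 2 ≤ h * (c ^ 2 * h) := by gcongr
    have h9 : c ^ 2 ≤ (s / 4) ^ 2 := by gcongr
    have h10 : s ^ 2 * (h / 2) ^ 2
        ≤ s ^ 2 * (h ^ 2 - 2 * h * (cdot x z).re + ‖cdot x z‖ ^ 2) := by gcongr
    have h11 : c ^ 2 * h ^ 2 ≤ (s / 4) ^ 2 * h ^ 2 := by gcongr
    have h12 : 0 < s ^ 2 * h ^ 2 := by positivity
    nlinarith
  refine le_trans ?_ (measure_mono hincl)
  rw [image_add_left, measure_preimage_add, volume_anisoMap_image he, hVe,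
    ← ENNReal.ofReal_mul (by positivity)]
  apply ENNReal.ofReal_le_ofReal
  have h5 : (c * k) ^ (2 * n) * k ^ 2 = c ^ (2 * n) * h ^ (n + 1) := by
    rw [← hk2]; ring
  rw [h5]
  apply le_of_eq; ring

/-! ### Weighted volume of nonisotropic balls and the Forelli-Rudin estimate. -/

lemma lintegral_comp_smul_eq {f : EuclideanSpace ℂ (Fin n) → ENNReal} (hf : Measurable f) {s : ℝ}
    (hs : 0 < s) :
    ∫⁻ x, f (s⁻¹ • x) = ENNReal.ofReal (s ^ (2 * n)) * ∫⁻ x, f x := by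
  have h := Measure.map_addHaar_smul (volume : Measure (EuclideanSpace ℂ (Fin n)))
    (inv_ne_zero hs.ne')
  have hfr : Module.finrank ℝ (EuclideanSpace ℂ (Fin n)) = 2 * n := by
    rw [← Module.finrank_mul_finrank ℝ ℂ]; simp
  rw [← lintegral_map hf (measurable_const_smul (s⁻¹)), h, lintegral_smul_measure, hfr,
    smul_eq_mul, inv_pow, inv_inv, abs_of_nonneg (by positivity)]

lemma lintegral_rpow_sub_le {γ m : ℝ} (hγ : -1 < γ) (hm : m ≤ 1) :
    ∫⁻ s in Ioo m 1, ENNReal.ofReal ((s - m) ^ γ)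
      ≤ ENNReal.ofReal ((1 - m) ^ (γ + 1) / (γ + 1)) := by
  have h1 : IntervalIntegrable (fun s : ℝ => (s - m) ^ γ) volume m 1 := by
    have := (intervalIntegral.intervalIntegrable_rpow' (a := 0) (b := 1 - m) hγ).comp_sub_right m
    simpa using this
  have h2 : ∫ s in m..1, (s - m) ^ γ = (1 - m) ^ (γ + 1) / (γ + 1) := by
    rw [intervalIntegral.integral_comp_sub_right (fun x => x ^ γ) m, sub_self,
      integral_rpow (Or.inl hγ), Real.zero_rpow (by linarith), sub_zero]
  rw [intervalIntegrable_iff_integrableOn_Ioc_of_le hm] at h1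
  rw [intervalIntegral.integral_of_le hm] at h2
  rw [← h2, ofReal_integral_eq_lintegral_ofReal h1]
  · exact lintegral_mono_set Ioo_subset_Ioc_self
  · filter_upwards [ae_restrict_mem measurableSet_Ioc] with s hs
    exact Real.rpow_nonneg (by linarith [hs.1]) _

lemma measurableSet_qball (a : EuclideanSpace ℂ (Fin n)) (R : ℝ) :
    MeasurableSet {w | w ∈ unitBall n ∧ qdist a w < R} :=
  measurableSet_unitBall.inter
    (measurableSet_lt (measurable_qdist measurable_const measurable_id) measurable_const)

/-- For γ < 0 the weight blows up at the sphere, so the volume bound alone is not enough. Averaging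
over dilations w ↦ s⁻¹w with 1-s < R/4 smears the singularity: for fixed w the integral in s is of
order R^(γ+1), and the dilated set stays in a ball of radius 2R. Dividing by the length R/4 of the
range of s gives the exponent n+1+γ. -/
lemma lintegral_qball_of_neg {γ : ℝ} (hγ : -1 < γ) (hγ0 : γ < 0) : ∃ C : ℝ, 0 < C ∧
    ∀ a ∈ unitBall n, ∀ R : ℝ, 0 < R → R ≤ 2 →
      ∫⁻ w in {w | w ∈ unitBall n ∧ qdist a w < R}, ENNReal.ofReal (defect w ^ γ)
        ≤ ENNReal.ofReal (C * R ^ ((n : ℝ) + 1 + γ)) := by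
  obtain ⟨C, hC, hvol⟩ := volume_qball_le n
  refine ⟨2 ^ (2 * n) * (1 / 4) ^ γ / (γ + 1) * C * 2 ^ (n + 1), ?_, fun a ha R hR hR2 => ?_⟩
  · have : 0 < γ + 1 := by linarith
    positivity
  have hγ1 : 0 < γ + 1 := by linarith
  set Q := {w | w ∈ unitBall n ∧ qdist a w < R} with hQ
  set Q2 := {w | w ∈ unitBall n ∧ qdist a w < 2 * R} with hQ2
  set F : EuclideanSpace ℂ (Fin n) → ENNReal :=
    Q.indicator fun w => ENNReal.ofReal (defect w ^ γ) with hF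
  have hFm : Measurable F :=
    (measurable_defect.pow_const γ).ennreal_ofReal.indicator (measurableSet_qball a R)
  set r := R / 4 with hr
  have hr0 : 0 < r := by positivity
  have hr1 : r ≤ 1 / 2 := by linarith
  rw [← lintegral_indicator (measurableSet_qball a R)]
  change ∫⁻ w, F w ≤ _
  -- The assumption R ≤ 2 gives s > 1/2, hence a Jacobian bounded below.
  have hlow : ENNReal.ofReal ((1 / 2) ^ (2 * n) * r) * ∫⁻ w, F w
      ≤ ∫⁻ s in Ioo (1 - r) 1, ∫⁻ w, F (s⁻¹ • w) := by
    calc _ = ∫⁻ s in Ioo (1 - r) 1, ENNReal.ofReal ((1 / 2) ^ (2 * n)) * ∫⁻ w, F w := by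
          rw [setLIntegral_const, Real.volume_Ioo, sub_sub_cancel,
            ENNReal.ofReal_mul (by positivity)]
          ring
      _ ≤ _ := by
          refine setLIntegral_mono' measurableSet_Ioo fun s hs => ?_
          have : 1 / 2 < s := by linarith [hs.1]
          rw [lintegral_comp_smul_eq hFm (by linarith)]
          gcongr
  have hup : ∫⁻ s in Ioo (1 - r) 1, ∫⁻ w, F (s⁻¹ • w)
      ≤ ENNReal.ofReal (r ^ (γ + 1) / (γ + 1)) * volume Q2 := by
    rw [lintegral_lintegral_swap]
    · calc _ ≤ ∫⁻ w, Q2.indicator (fun _ => ENNReal.ofReal (r ^ (γ + 1) / (γ + 1))) w := by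
            refine lintegral_mono fun w => ?_
            by_cases hw : w ∈ Q2
            · rw [indicator_of_mem hw]
              -- On the support, 1-|w/s|² ≥ s-|w| ≥ s-m, which reduces the integrand to a
              -- one-variable power.
              set m := max ‖w‖ (1 - r) with hm
              have hm1 : m ≤ 1 := max_le (mem_unitBall.1 hw.1).le (by linarith)
              calc ∫⁻ s in Ioo (1 - r) 1, F (s⁻¹ • w)
                  ≤ ∫⁻ s in Ioo (1 - r) 1,
                      (Ioo m 1).indicator (fun s => ENNReal.ofReal ((s - m) ^ γ)) s := by
                    refine setLIntegral_mono' measurableSet_Ioo fun s hs => ?_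
                    have hs0 : 0 < s := by linarith [hs.1]
                    rw [hF]
                    by_cases hsw : s⁻¹ • w ∈ Q
                    · rw [indicator_of_mem hsw]
                      have h1 : ‖s⁻¹ • w‖ = ‖w‖ / s := by
                        rw [norm_smul, norm_inv, Real.norm_of_nonneg hs0.le]; field_simp
                      have h2 : ‖w‖ < s := by
                        have := mem_unitBall.1 hsw.1
                        rwa [h1, div_lt_one hs0] at this
                      have hms : m < s := max_lt h2 hs.1
                      rw [indicator_of_mem (show s ∈ Ioo m 1 from ⟨hms, hs.2⟩)]
                      apply ENNReal.ofReal_le_ofReal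
                      refine Real.rpow_le_rpow_of_nonpos (by linarith) ?_ hγ0.le
                      have h3 : ‖w‖ ≤ m := le_max_left _ _
                      rw [defect, h1, div_pow, le_sub_iff_add_le, ← le_sub_iff_add_le',
                        div_le_iff₀ (by positivity)]
                      have h4 := norm_nonneg w
                      have h5 : s < 1 := hs.2
                      have h6 : ‖w‖ ^ 2 ≤ ‖w‖ * s := by nlinarith
                      have h7 : (1 - (s - ‖w‖)) * s ^ 2 ≤ (1 - (s - m)) * s ^ 2 := by
                        gcongr
                      nlinarith [mul_nonneg (mul_nonneg hs0.le (sub_nonneg.2 h2.le))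
                        (sub_nonneg.2 h5.le), mul_nonneg (sub_nonneg.2 h2.le)
                        (sub_nonneg.2 h5.le)]
                    · rw [indicator_of_notMem hsw]; exact bot_le
                _ ≤ ∫⁻ s, (Ioo m 1).indicator (fun s => ENNReal.ofReal ((s - m) ^ γ)) s :=
                    setLIntegral_le_lintegral _ _
                _ = ∫⁻ s in Ioo m 1, ENNReal.ofReal ((s - m) ^ γ) :=
                    lintegral_indicator measurableSet_Ioo _
                _ ≤ _ := by
                    refine (lintegral_rpow_sub_le hγ hm1).trans ?_
                    have : 1 - r ≤ m := le_max_right _ _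
                    gcongr; linarith
            · rw [indicator_of_notMem hw]
              refine (setLIntegral_congr_fun (g := fun _ => 0) measurableSet_Ioo
                fun s hs => ?_).trans_le (by simp)
              have hs0 : 0 < s := by linarith [hs.1]
              refine indicator_of_notMem (fun hsw => hw ?_) _
              have e : w = s • (s⁻¹ • w) := by rw [smul_smul, mul_inv_cancel₀ hs0.ne', one_smul]
              set x := s⁻¹ • w
              have hx1 := mem_unitBall.1 hsw.1
              rw [e]
              refine ⟨?_, ?_⟩
              · rw [mem_unitBall, norm_smul, Real.norm_of_nonneg hs0.le]
                nlinarith [hs.2, norm_nonneg x]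
              · have h1 : cdot (s • x) a = s * cdot x a := by
                  rw [← cdot_smul_left]; rfl
                have hna := mem_unitBall.1 ha
                have h3 := norm_cdot_le x a
                have h4 : ‖((1 - s : ℝ) : ℂ) * cdot x a‖ ≤ (1 - s) * 1 := by
                  rw [norm_mul, Complex.norm_real, Real.norm_of_nonneg (by linarith [hs.2])]
                  gcongr
                  · linarith [hs.2]
                  · nlinarith [norm_nonneg x, norm_nonneg a]
                have h2 : qdist a (s • x) ≤ qdist a x + (1 - s) * 1 := by
                  unfold qdist
                  rw [h1, show 1 - (s : ℂ) * cdot x a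
                    = (1 - cdot x a) + ((1 - s : ℝ) : ℂ) * cdot x a by push_cast; ring]
                  exact (norm_add_le _ _).trans (by gcongr)
                linarith [hs.1, hsw.2]
        _ = _ := by
            rw [lintegral_indicator (measurableSet_qball a (2 * R)), setLIntegral_const]
    · refine (hFm.comp ?_).aemeasurable
      exact (measurable_fst.inv).smul measurable_snd
  have hcomb := hlow.trans (hup.trans (mul_le_mul_right (hvol a ha (2 * R) (by positivity)) _))
  rw [← ENNReal.ofReal_mul (by positivity)] at hcomb
  have hc0 : 0 < (1 / 2 : ℝ) ^ (2 * n) * r := by positivity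
  have := (ENNReal.le_div_iff_mul_le (Or.inl (ENNReal.ofReal_pos.2 hc0).ne')
    (Or.inl ENNReal.ofReal_ne_top)).2 ((mul_comm _ _).trans_le hcomb)
  refine this.trans ?_
  rw [← ENNReal.ofReal_div_of_pos hc0]
  apply ENNReal.ofReal_le_ofReal
  rw [div_le_iff₀ hc0]
  apply le_of_eq
  have e1 : r ^ (γ + 1) = (1 / 4) ^ γ * R ^ γ * r := by
    rw [Real.rpow_add_one hr0.ne', hr, ← Real.mul_rpow (by norm_num) hR.le]
    congr 2; ring
  have e2 : R ^ ((n : ℝ) + 1 + γ) = R ^ (n + 1) * R ^ γ := by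
    rw [Real.rpow_add hR]; norm_cast
  rw [e1, e2, one_div (2 : ℝ), inv_pow, mul_pow]
  field_simp

/-- The weighted volume of a nonisotropic ball. -/
lemma lintegral_qball {γ : ℝ} (hγ : -1 < γ) : ∃ C : ℝ, 0 < C ∧
    ∀ a ∈ unitBall n, ∀ R : ℝ, 0 < R →
      ∫⁻ w in {w | w ∈ unitBall n ∧ qdist a w < R}, ENNReal.ofReal (defect w ^ γ)
        ≤ ENNReal.ofReal (C * R ^ ((n : ℝ) + 1 + γ)) := by
  rcases lt_or_ge γ 0 with hγ0 | hγ0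
  · obtain ⟨C, hC, h⟩ := lintegral_qball_of_neg (n := n) hγ hγ0
    refine ⟨C, hC, fun a ha R hR => ?_⟩
    rcases le_or_gt R 2 with h2 | h2
    · exact h a ha R hR h2
    -- Quasi-distances within the ball are below 2, so radius 2 already captures everything.
    · refine (lintegral_mono_set ?_).trans ((h a ha 2 two_pos le_rfl).trans ?_)
      · rintro w ⟨hw, -⟩
        refine ⟨hw, ?_⟩
        have := qdist_le_one_add a w
        rw [mem_unitBall] at ha hw
        nlinarith [norm_nonneg a, norm_nonneg w]
      · gcongr
        have : (0 : ℝ) ≤ n := n.cast_nonneg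
        linarith
  · obtain ⟨C, hC, hvol⟩ := volume_qball_le n
    refine ⟨2 ^ γ * C, by positivity, fun a ha R hR => ?_⟩
    calc _ ≤ ∫⁻ w in {w | w ∈ unitBall n ∧ qdist a w < R}, ENNReal.ofReal ((2 * R) ^ γ) := by
          refine setLIntegral_mono' (measurableSet_qball a R) fun w hw => ?_
          have := defect_le_two_mul_qdist (z := w) ha
          rw [qdist_comm] at this
          have h2 := hw.2
          have := (defect_pos hw.1).le
          gcongr
          linarith
      _ ≤ ENNReal.ofReal ((2 * R) ^ γ) * ENNReal.ofReal (C * R ^ (n + 1)) := by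
          rw [setLIntegral_const]
          gcongr
          exact hvol a ha R hR
      _ = _ := by
          rw [← ENNReal.ofReal_mul (by positivity), Real.mul_rpow (by norm_num) hR.le,
            Real.rpow_add hR]
          congr 1
          norm_cast
          ring

/-- The upper Forelli-Rudin estimate. -/
lemma lintegral_forelliRudin {γ b : ℝ} (hγ : -1 < γ) (hb : 0 < b) : ∃ C : ℝ, 0 < C ∧
    ∀ a ∈ unitBall n,
      ∫⁻ w in unitBall n, ENNReal.ofReal (defect w ^ γ * qdist a w ^ (-((n : ℝ) + 1 + γ + b)))
        ≤ ENNReal.ofReal (C * defect a ^ (-b)) := by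
  obtain ⟨C, hC, hq⟩ := lintegral_qball (n := n) hγ
  set M := (n : ℝ) + 1 + γ + b with hM
  have hn0 : (0 : ℝ) ≤ n := n.cast_nonneg
  have hM0 : 0 < M := by linarith
  refine ⟨M * C / b * (1 / 2) ^ (-b), by positivity, fun a ha => ?_⟩
  have hda := defect_pos ha
  -- Layer cake: the power -M of the quasi-distance is an integral of M R^(-M-1) over R above it.
  -- Only R > (1-|a|²)/2 matters, since the quasi-distance never falls below this; after the
  -- exchange of integrals this lower limit produces the power -b.
  have key : ∀ w ∈ unitBall n, ENNReal.ofReal (defect w ^ γ * qdist a w ^ (-M))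
      = ∫⁻ R in Ioi (defect a / 2), ENNReal.ofReal (defect w ^ γ) *
          (Ioi (qdist a w)).indicator (fun R => ENNReal.ofReal (M * R ^ (-M - 1))) R := by
    intro w hw
    have hdw := defect_pos hw
    have hqp := qdist_pos ha hw
    have hqa := defect_le_two_mul_qdist (z := a) hw
    have hsub : Ioi (defect a / 2) ∩ Ioi (qdist a w) = Ioi (qdist a w) := by
      rw [inter_eq_right]; exact Ioi_subset_Ioi (by linarith)
    rw [lintegral_const_mul' _ _ ENNReal.ofReal_ne_top, setLIntegral_indicator measurableSet_Ioi,
      inter_comm, hsub, ENNReal.ofReal_mul (by positivity)]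
    congr 1
    rw [← ofReal_integral_eq_lintegral_ofReal]
    · rw [integral_const_mul, integral_Ioi_rpow_of_lt (by linarith) hqp]
      congr 1
      rw [show -M - 1 + 1 = -M by ring]; field_simp
    · exact (integrableOn_Ioi_rpow_of_lt (by linarith) hqp).const_mul _
    · filter_upwards [ae_restrict_mem measurableSet_Ioi] with R hR
      have : 0 < R := hqp.trans hR
      positivity
  rw [setLIntegral_congr_fun measurableSet_unitBall key, lintegral_lintegral_swap]
  · calc _ ≤ ∫⁻ R in Ioi (defect a / 2), ENNReal.ofReal (M * C * R ^ (-b - 1)) := by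
          refine setLIntegral_mono' measurableSet_Ioi fun R hR => ?_
          have hR0 : 0 < R := lt_trans (by positivity) hR
          calc _ ≤ ∫⁻ w in unitBall n, {w | w ∈ unitBall n ∧ qdist a w < R}.indicator
                  (fun w => ENNReal.ofReal (M * R ^ (-M - 1)) * ENNReal.ofReal (defect w ^ γ)) w := by
                refine setLIntegral_mono' measurableSet_unitBall fun w hw => ?_
                by_cases h : qdist a w < R
                · rw [indicator_of_mem (show R ∈ Ioi (qdist a w) from h), indicator_of_mem
                    (show w ∈ {w | w ∈ unitBall n ∧ qdist a w < R} from ⟨hw, h⟩), mul_comm]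
                · rw [indicator_of_notMem (show R ∉ Ioi (qdist a w) from h), mul_zero]
                  exact bot_le
            _ ≤ ∫⁻ w, {w | w ∈ unitBall n ∧ qdist a w < R}.indicator
                  (fun w => ENNReal.ofReal (M * R ^ (-M - 1)) * ENNReal.ofReal (defect w ^ γ)) w :=
                setLIntegral_le_lintegral _ _
            _ = ENNReal.ofReal (M * R ^ (-M - 1)) *
                  ∫⁻ w in {w | w ∈ unitBall n ∧ qdist a w < R}, ENNReal.ofReal (defect w ^ γ) := by
                rw [lintegral_indicator (measurableSet_qball a R),
                  lintegral_const_mul' _ _ ENNReal.ofReal_ne_top]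
            _ ≤ ENNReal.ofReal (M * R ^ (-M - 1)) *
                  ENNReal.ofReal (C * R ^ ((n : ℝ) + 1 + γ)) := by
                gcongr; exact hq a ha R hR0
            _ = _ := by
                rw [← ENNReal.ofReal_mul (by positivity)]
                congr 1
                rw [show -b - 1 = (-M - 1) + ((n : ℝ) + 1 + γ) by rw [hM]; ring,
                  Real.rpow_add hR0 (-M - 1)]
                ring
      _ = _ := by
          rw [← ofReal_integral_eq_lintegral_ofReal]
          · rw [integral_const_mul, integral_Ioi_rpow_of_lt (by linarith) (by positivity)]
            congr 1
            rw [show -b - 1 + 1 = -b by ring, div_eq_mul_one_div (defect a),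
              Real.mul_rpow hda.le (by norm_num)]
            field_simp
          · exact (integrableOn_Ioi_rpow_of_lt (by linarith) (by positivity)).const_mul _
          · filter_upwards [ae_restrict_mem measurableSet_Ioi] with R hR
            have : 0 < R := lt_trans (by positivity) hR
            positivity
  · have h1 : Measurable fun p : EuclideanSpace ℂ (Fin n) × ℝ =>
        ENNReal.ofReal (defect p.1 ^ γ) :=
      ((measurable_defect.pow_const γ).ennreal_ofReal).comp measurable_fst
    have h2 : Measurable fun p : EuclideanSpace ℂ (Fin n) × ℝ =>
        {p : EuclideanSpace ℂ (Fin n) × ℝ | qdist a p.1 < p.2}.indicator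
          (fun p => ENNReal.ofReal (M * p.2 ^ (-M - 1))) p := by
      refine Measurable.indicator ?_ ?_
      · exact ((measurable_snd.pow_const _).const_mul M).ennreal_ofReal
      · exact measurableSet_lt (measurable_qdist measurable_const measurable_fst) measurable_snd
    exact (h1.mul h2).aemeasurable

/-! ### Pseudo-hyperbolic balls and their invariant volume. -/

/-- Pseudo-hyperbolic balls. -/
def pball (z : EuclideanSpace ℂ (Fin n)) (s : ℝ) : Set (EuclideanSpace ℂ (Fin n)) :=
  {w | w ∈ unitBall n ∧ pdist z w < s}

lemma continuous_cdot_comp {X : Type*} [TopologicalSpace X] {f g : X → EuclideanSpace ℂ (Fin n)}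
    (hf : Continuous f) (hg : Continuous g) : Continuous fun x => cdot (f x) (g x) := by
  simp only [cdot_eq_inner]
  fun_prop

lemma measurable_pdist_prod : Measurable
    fun p : EuclideanSpace ℂ (Fin n) × EuclideanSpace ℂ (Fin n) => pdist p.1 p.2 := by
  have h1 : Measurable fun p : EuclideanSpace ℂ (Fin n) × EuclideanSpace ℂ (Fin n) =>
      cdot p.2 p.1 := (continuous_cdot_comp continuous_snd continuous_fst).measurable
  have h2 : Measurable fun p : EuclideanSpace ℂ (Fin n) × EuclideanSpace ℂ (Fin n) =>
      cdot p.1 p.1 := (continuous_cdot_comp continuous_fst continuous_fst).measurable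
  have h3 : Measurable fun p : EuclideanSpace ℂ (Fin n) × EuclideanSpace ℂ (Fin n) =>
      lineProj p.1 p.2 := (h1.div h2).smul measurable_fst
  have h4 : Measurable fun p : EuclideanSpace ℂ (Fin n) × EuclideanSpace ℂ (Fin n) =>
      (Real.sqrt (1 - ‖p.1‖ ^ 2) : ℂ) :=
    Complex.measurable_ofReal.comp (measurable_const.sub (measurable_fst.norm.pow_const 2)).sqrt
  have h5 : Measurable fun p : EuclideanSpace ℂ (Fin n) × EuclideanSpace ℂ (Fin n) =>
      moebius p.1 p.2 :=
    (measurable_const.sub h1).inv.smul ((measurable_fst.sub h3).sub (h4.smul (measurable_snd.sub h3)))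
  exact h5.norm

lemma measurableSet_pball_prod (s : ℝ) : MeasurableSet
    {p : EuclideanSpace ℂ (Fin n) × EuclideanSpace ℂ (Fin n) | p.2 ∈ pball p.1 s} :=
  (measurable_snd measurableSet_unitBall).inter
    (measurableSet_lt measurable_pdist_prod measurable_const)

lemma measurableSet_pball (z : EuclideanSpace ℂ (Fin n)) (s : ℝ) : MeasurableSet (pball z s) :=
  (measurable_prodMk_left (x := z)) (measurableSet_pball_prod s)

lemma mem_pball_comm {z w : EuclideanSpace ℂ (Fin n)} {s : ℝ} (hz : z ∈ unitBall n)
    (hw : w ∈ pball z s) : z ∈ pball w s :=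
  ⟨hz, by rw [pdist_comm hw.1 hz]; exact hw.2⟩

lemma pball_subset_pball {z w : EuclideanSpace ℂ (Fin n)} {s s' d : ℝ} (hz : z ∈ unitBall n)
    (hw : w ∈ unitBall n) (h : pdist z w ≤ d) (hs : d + s ≤ s') : pball w s ⊆ pball z s' := by
  rintro x ⟨hx, hxw⟩
  have := pdist_triangle hw hz hx
  exact ⟨hx, by linarith⟩

lemma pdist_self {z : EuclideanSpace ℂ (Fin n)} (hz : z ∈ unitBall n) : pdist z z = 0 := by
  have h := pdist_sq hz hz
  have h1 : qdist z z = defect z := by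
    rw [qdist, cdot_self, ← Complex.ofReal_one, ← Complex.ofReal_sub, Complex.norm_real,
      Real.norm_of_nonneg (show 0 ≤ 1 - ‖z‖ ^ 2 from (defect_pos hz).le)]
    rfl
  have := defect_pos hz
  rw [h1, ← sq, div_self (by positivity), sub_self] at h
  exact pow_eq_zero_iff two_ne_zero |>.1 h

lemma lintegral_invariantVolume (f : EuclideanSpace ℂ (Fin n) → ENNReal) :
    ∫⁻ w, f w ∂(invariantVolume n) = (volume (unitBall n))⁻¹ *
      ∫⁻ w in unitBall n, ENNReal.ofReal ((defect w ^ (n + 1))⁻¹) * f w := by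
  rw [invariantVolume, lintegral_withDensity_eq_lintegral_mul_non_measurable]
  · rw [normVolume, lintegral_smul_measure]; rfl
  · exact ((measurable_defect.pow_const _).inv).ennreal_ofReal
  · exact Filter.Eventually.of_forall fun _ => ENNReal.ofReal_lt_top

lemma volume_unitBall_ne_zero : volume (unitBall n) ≠ 0 :=
  (Metric.measure_ball_pos _ _ one_pos).ne'

lemma volume_unitBall_ne_top : volume (unitBall n) ≠ ⊤ := measure_ball_lt_top.ne

lemma ae_mem_unitBall : ∀ᵐ w ∂(invariantVolume n), w ∈ unitBall n := by
  refine (withDensity_absolutelyContinuous _ _).ae_le ?_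
  refine Measure.ae_smul_measure ?_ _
  exact ae_restrict_mem measurableSet_unitBall

/-- Since dv = (1-|w|²)^(n+1) dλ on the ball, the weight exponent becomes n+1+α. The estimates are
phrased against λ because balls of a fixed radius below 1 have comparable λ-mass there. -/
lemma lintegral_weightedVolume (α : ℝ) (f : EuclideanSpace ℂ (Fin n) → ENNReal) :
    ∫⁻ w, f w ∂(weightedVolume n α) = weightConst n α *
      ∫⁻ w, ENNReal.ofReal (defect w ^ ((n : ℝ) + 1 + α)) * f w ∂(invariantVolume n) := by
  rw [lintegral_invariantVolume, weightedVolume, lintegral_smul_measure,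
    lintegral_withDensity_eq_lintegral_mul_non_measurable]
  · rw [normVolume, lintegral_smul_measure, smul_eq_mul, smul_eq_mul]
    congr 2
    refine setLIntegral_congr_fun measurableSet_unitBall fun w hw => ?_
    have h := defect_pos hw
    rw [← mul_assoc, ← ENNReal.ofReal_mul (by positivity)]
    change ENNReal.ofReal (defect w ^ α) * f w = _
    congr 2
    rw [Real.rpow_add h, show (n : ℝ) + 1 = ((n + 1 : ℕ) : ℝ) by push_cast; ring,
      Real.rpow_natCast]
    field_simp
  · exact (measurable_defect.pow_const _).ennreal_ofReal
  · exact Filter.Eventually.of_forall fun _ => ENNReal.ofReal_lt_top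

lemma setLIntegral_weightedVolume (α : ℝ) {S : Set (EuclideanSpace ℂ (Fin n))}
    (hS : MeasurableSet S) (f : EuclideanSpace ℂ (Fin n) → ENNReal) :
    ∫⁻ w in S, f w ∂(weightedVolume n α) = weightConst n α *
      ∫⁻ w in S, ENNReal.ofReal (defect w ^ ((n : ℝ) + 1 + α)) * f w ∂(invariantVolume n) := by
  rw [← lintegral_indicator hS, ← lintegral_indicator hS, lintegral_weightedVolume]
  congr 2
  ext w
  by_cases hw : w ∈ S <;> simp [hw]

lemma lintegral_weightConst (α : ℝ) : weightConst n α
    = (∫⁻ w, ENNReal.ofReal (defect w ^ ((n : ℝ) + 1 + α)) ∂(invariantVolume n))⁻¹ := by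
  rw [weightConst, lintegral_invariantVolume, normVolume, lintegral_smul_measure, smul_eq_mul]
  congr 2
  refine setLIntegral_congr_fun measurableSet_unitBall fun w hw => ?_
  have h := defect_pos hw
  rw [← ENNReal.ofReal_mul (by positivity)]
  change ENNReal.ofReal (defect w ^ α) = _
  congr 1
  rw [Real.rpow_add h, show (n : ℝ) + 1 = ((n + 1 : ℕ) : ℝ) by push_cast; ring,
    Real.rpow_natCast]
  field_simp

/-- The Forelli-Rudin estimate with respect to the invariant volume. -/
lemma lintegral_invariant_forelliRudin {A b : ℝ} (hA : (n : ℝ) < A) (hb : 0 < b) :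
    ∃ C : ℝ, 0 < C ∧ ∀ a ∈ unitBall n,
      ∫⁻ w, ENNReal.ofReal (defect w ^ A * qdist a w ^ (-(A + b))) ∂(invariantVolume n)
        ≤ ENNReal.ofReal (C * defect a ^ (-b)) := by
  obtain ⟨C, hC, h⟩ := lintegral_forelliRudin (n := n) (γ := A - (n + 1)) (by linarith) hb
  have hV : (volume (unitBall n))⁻¹ ≠ ⊤ := ENNReal.inv_ne_top.2 volume_unitBall_ne_zero
  have hV0 : (volume (unitBall n))⁻¹ ≠ 0 := ENNReal.inv_ne_zero.2 volume_unitBall_ne_top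
  refine ⟨(volume (unitBall n))⁻¹.toReal * C, mul_pos (ENNReal.toReal_pos hV0 hV) hC,
    fun a ha => ?_⟩
  rw [lintegral_invariantVolume, mul_assoc, ENNReal.ofReal_mul ENNReal.toReal_nonneg,
    ENNReal.ofReal_toReal hV]
  gcongr
  refine (setLIntegral_congr_fun measurableSet_unitBall fun w hw => ?_).trans_le (h a ha)
  have h := defect_pos hw
  have hq := qdist_pos ha hw
  rw [← ENNReal.ofReal_mul (by positivity), ← mul_assoc]
  congr 2
  · rw [Real.rpow_sub h, show (n : ℝ) + 1 = ((n + 1 : ℕ) : ℝ) by push_cast; ring,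
      Real.rpow_natCast]
    field_simp
  · congr 1; ring

/-- This is the integrability of (1-|w|²)^α, read off from the Forelli-Rudin estimate at the origin,
where the quasi-distance is identically 1. -/
lemma weightConst_ne_zero {α : ℝ} (hα : -1 < α) : weightConst n α ≠ 0 := by
  rw [lintegral_weightConst]
  apply ENNReal.inv_ne_zero.2
  obtain ⟨C, hC, h⟩ := lintegral_invariant_forelliRudin (n := n) (A := (n : ℝ) + 1 + α) (b := 1)
    (by linarith) one_pos
  have h0 := h 0 (by simp [mem_unitBall])
  simp only [qdist, cdot_zero_right, sub_zero, norm_one, Real.one_rpow, mul_one] at h0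
  exact ne_top_of_le_ne_top ENNReal.ofReal_ne_top h0

lemma weightConst_ne_top (α : ℝ) : weightConst n α ≠ ⊤ := by
  rw [weightConst]
  apply ENNReal.inv_ne_top.2
  rw [normVolume, lintegral_smul_measure, smul_eq_mul]
  refine mul_ne_zero (ENNReal.inv_ne_zero.2 volume_unitBall_ne_top) ?_
  rw [← zero_lt_iff, lintegral_pos_iff_support]
  · refine lt_of_lt_of_le (zero_lt_iff.2 (volume_unitBall_ne_zero (n := n))) ?_
    rw [← Measure.restrict_apply_self]
    refine measure_mono fun w hw => ?_
    have := defect_pos hw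
    have h2 : (0 : ℝ) < (1 - ‖w‖ ^ 2) ^ α := Real.rpow_pos_of_pos this _
    simpa [Function.mem_support] using h2
  · exact (measurable_defect.pow_const _).ennreal_ofReal

/-- Comparability in both directions is assumed so that exponents of either sign are covered. -/
lemma rpow_le_mul_rpow {x y K : ℝ} (e : ℝ) (hx : 0 < x) (hy : 0 < y) (hK : 0 < K)
    (hxy : x ≤ K * y) (hyx : y ≤ K * x) : x ^ e ≤ K ^ |e| * y ^ e := by
  rcases le_total 0 e with he | he
  · rw [abs_of_nonneg he, ← Real.mul_rpow hK.le hy.le]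
    gcongr
  · rw [abs_of_nonpos he, Real.rpow_neg hK.le, ← Real.inv_rpow hK.le,
      ← Real.mul_rpow (by positivity) hy.le]
    refine Real.rpow_le_rpow_of_nonpos (by positivity) ?_ he
    rw [inv_mul_le_iff₀ hK]; exact hyx

lemma defect_rpow_le {s : ℝ} (hs : s < 1) {z w : EuclideanSpace ℂ (Fin n)}
    (hz : z ∈ unitBall n) (hw : w ∈ pball z s) (e : ℝ) :
    defect w ^ e ≤ (4 / (1 - s ^ 2)) ^ |e| * defect z ^ e := by
  have h0 := pdist_nonneg z w
  have h2 := hw.2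
  have : 0 < 1 - s ^ 2 := by nlinarith
  have hz' := mem_pball_comm hz hw
  exact rpow_le_mul_rpow e (defect_pos hw.1) (defect_pos hz) (by positivity)
    (defect_le_of_pdist_lt hs hz hw.1 hw.2).2 (defect_le_of_pdist_lt hs hw.1 hz hz'.2).2

lemma qdist_rpow_le {s : ℝ} (hs : s < 1) {z w x : EuclideanSpace ℂ (Fin n)}
    (hz : z ∈ unitBall n) (hw : w ∈ pball z s) (hx : x ∈ unitBall n) (e : ℝ) :
    qdist w x ^ e ≤ (15 / (1 - s ^ 2)) ^ |e| * qdist z x ^ e := by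
  have h0 := pdist_nonneg z w
  have h2 := hw.2
  have : 0 < 1 - s ^ 2 := by nlinarith
  have hz' := mem_pball_comm hz hw
  exact rpow_le_mul_rpow e (qdist_pos hw.1 hx) (qdist_pos hz hx) (by positivity)
    (qdist_le_of_pdist_lt hs hz hw.1 hx hw.2) (qdist_le_of_pdist_lt hs hw.1 hz hx hz'.2)

/-- Pseudo-hyperbolic balls have invariant volume bounded below. -/
lemma invariantVolume_pball_ge (hn : 1 ≤ n) {s : ℝ} (hs : 0 < s) : ∃ c : ℝ, 0 < c ∧
    ∀ z ∈ unitBall n, ENNReal.ofReal c ≤ invariantVolume n (pball z s) := by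
  -- The comparison of defects needs a radius below 1, and s is only known to be positive; shrinking
  -- the ball is harmless for a lower bound.
  set s' := min s (1 / 2) with hs'
  have hs'0 : 0 < s' := by positivity
  have hs'1 : s' < 1 := (min_le_right _ _).trans_lt (by norm_num)
  obtain ⟨c, hc, h⟩ := volume_pball_ge hn hs'0
  have hd : 0 < 1 - s' ^ 2 := by nlinarith
  have hV : (volume (unitBall n))⁻¹ ≠ ⊤ := ENNReal.inv_ne_top.2 volume_unitBall_ne_zero
  have hV0 : (volume (unitBall n))⁻¹ ≠ 0 := ENNReal.inv_ne_zero.2 volume_unitBall_ne_top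
  set K := 4 / (1 - s' ^ 2) with hK
  have hK0 : 0 < K := by positivity
  refine ⟨(volume (unitBall n))⁻¹.toReal * ((K ^ (n + 1))⁻¹ * c),
    mul_pos (ENNReal.toReal_pos hV0 hV) (by positivity), fun z hz => ?_⟩
  have hdz := defect_pos hz
  have hsub : pball z s' ⊆ pball z s := fun w hw => ⟨hw.1, hw.2.trans_le (min_le_left _ _)⟩
  refine le_trans ?_ (measure_mono hsub)
  rw [← lintegral_indicator_one (measurableSet_pball z s'), lintegral_invariantVolume,
    ENNReal.ofReal_mul ENNReal.toReal_nonneg, ENNReal.ofReal_toReal hV]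
  gcongr
  have e : ∀ w, ENNReal.ofReal (defect w ^ (n + 1))⁻¹ * (pball z s').indicator 1 w
      = (pball z s').indicator (fun w => ENNReal.ofReal (defect w ^ (n + 1))⁻¹) w := by
    intro w; by_cases hw : w ∈ pball z s' <;> simp [hw]
  simp_rw [e]
  rw [setLIntegral_indicator (measurableSet_pball z s'),
    inter_eq_left.2 (fun w hw => hw.1 : pball z s' ⊆ unitBall n)]
  calc ENNReal.ofReal ((K ^ (n + 1))⁻¹ * c)
      = ENNReal.ofReal (((K * defect z) ^ (n + 1))⁻¹) * ENNReal.ofReal (c * defect z ^ (n + 1)) := by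
        rw [← ENNReal.ofReal_mul (by positivity)]
        congr 1
        rw [mul_pow]
        field_simp
    _ ≤ ENNReal.ofReal (((K * defect z) ^ (n + 1))⁻¹) * volume (pball z s') := by
        gcongr; exact h z hz
    _ = ∫⁻ w in pball z s', ENNReal.ofReal (((K * defect z) ^ (n + 1))⁻¹) := by
        rw [setLIntegral_const]
    _ ≤ _ := by
        refine setLIntegral_mono' (measurableSet_pball z s') fun w hw => ?_
        have h1 := (defect_le_of_pdist_lt hs'1 hz hw.1 hw.2).2
        have := defect_pos hw.1
        gcongr

/-- Pseudo-hyperbolic balls have bounded invariant volume. -/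
lemma invariantVolume_pball_le {s : ℝ} (hs : s < 1) : ∃ C : ℝ, 0 < C ∧
    ∀ z ∈ unitBall n, invariantVolume n (pball z s) ≤ ENNReal.ofReal C := by
  by_cases hs0 : s ≤ 0
  · refine ⟨1, one_pos, fun z hz => ?_⟩
    have : pball z s = ∅ := by
      ext w
      simp only [mem_empty_iff_false, iff_false]
      rintro ⟨-, h⟩
      have := pdist_nonneg z w
      linarith
    rw [this]; simp
  push Not at hs0
  have hd : 0 < 1 - s ^ 2 := by nlinarith
  -- On the ball, 1-|w|² and |1-⟨w,z⟩| are comparable to 1-|z|², so this integrand times 1-|z|² is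
  -- bounded below there and the estimate bounds the mass of the ball.
  obtain ⟨C, hC, h⟩ := lintegral_invariant_forelliRudin (n := n) (A := (n : ℝ) + 1) (b := 1)
    (by linarith) one_pos
  set K := 4 / (1 - s ^ 2) with hK
  have hK0 : 0 < K := by positivity
  set a := (n : ℝ) + 1 with ha
  have ha0 : 0 < a := by positivity
  refine ⟨K ^ |a| * K ^ (a + 1) * C, by positivity, fun z hz => ?_⟩
  have hdz := defect_pos hz
  calc invariantVolume n (pball z s) = ∫⁻ w in pball z s, 1 ∂(invariantVolume n) := by simp
    _ ≤ ∫⁻ w in pball z s, ENNReal.ofReal (K ^ |a| * K ^ (a + 1) * defect z) *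
          ENNReal.ofReal (defect w ^ a * qdist z w ^ (-(a + 1))) ∂(invariantVolume n) := by
        refine setLIntegral_mono' (measurableSet_pball z s) fun w hw => ?_
        have hdw := defect_pos hw.1
        have hq := qdist_pos hz hw.1
        rw [← ENNReal.ofReal_mul (by positivity), ← ENNReal.ofReal_one]
        apply ENNReal.ofReal_le_ofReal
        have h1 := defect_rpow_le hs hw.1 (mem_pball_comm hz hw) a
        have h2 : qdist z w ≤ K * defect z := by
          refine (defect_le_of_pdist_lt hs hz hw.1 hw.2).1.trans ?_
          rw [hK]; gcongr; norm_num
        have h3 : (K * defect z) ^ (-(a + 1)) ≤ qdist z w ^ (-(a + 1)) :=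
          Real.rpow_le_rpow_of_nonpos hq h2 (by linarith)
        calc (1 : ℝ) = defect z ^ a * (K ^ (a + 1) * defect z * (K * defect z) ^ (-(a + 1))) := by
              rw [Real.mul_rpow hK0.le hdz.le, Real.rpow_neg hK0.le, Real.rpow_neg hdz.le,
                Real.rpow_add_one hdz.ne' a]
              field_simp
          _ ≤ (K ^ |a| * defect w ^ a) * (K ^ (a + 1) * defect z * qdist z w ^ (-(a + 1))) := by
              gcongr
          _ = _ := by ring
    _ ≤ ENNReal.ofReal (K ^ |a| * K ^ (a + 1) * defect z) *
          ∫⁻ w, ENNReal.ofReal (defect w ^ a * qdist z w ^ (-(a + 1))) ∂(invariantVolume n) := by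
        rw [lintegral_const_mul' _ _ ENNReal.ofReal_ne_top]
        gcongr
        exact Measure.restrict_le_self
    _ ≤ ENNReal.ofReal (K ^ |a| * K ^ (a + 1) * defect z) *
          ENNReal.ofReal (C * defect z ^ (-1 : ℝ)) := by
        gcongr; exact h z hz
    _ = _ := by
        rw [← ENNReal.ofReal_mul (by positivity)]
        congr 1
        rw [Real.rpow_neg_one]
        field_simp

/-! ### Mean oscillation over a set in a general measure space. -/

lemma rpow_lintegral_le {X : Type*} [MeasurableSpace X] {μ : Measure X} {g : X → ENNReal}
    (hg : AEMeasurable g μ) {q : ℝ} (hq : 1 ≤ q) :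
    (∫⁻ x, g x ∂μ) ^ q ≤ μ univ ^ (q - 1) * ∫⁻ x, g x ^ q ∂μ := by
  rcases hq.eq_or_lt with rfl | hq1
  · simp
  have hq0 : 0 < q := by linarith
  have hc : q.HolderConjugate (q / (q - 1)) := Real.HolderConjugate.conjExponent hq1
  have h := ENNReal.lintegral_mul_le_Lp_mul_Lq μ hc hg (aemeasurable_const (b := (1 : ENNReal)))
  simp only [Pi.mul_apply, mul_one, ENNReal.one_rpow, lintegral_const, one_mul] at h
  calc _ ≤ ((∫⁻ x, g x ^ q ∂μ) ^ (1 / q) * μ univ ^ (1 / (q / (q - 1)))) ^ q := by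
        gcongr
    _ = _ := by
        rw [ENNReal.mul_rpow_of_nonneg _ _ hq0.le, ← ENNReal.rpow_mul, ← ENNReal.rpow_mul,
          one_div_mul_cancel hq0.ne', ENNReal.rpow_one, mul_comm]
        congr 2
        field_simp

lemma enorm_sub_sq_le (x y c : ℂ) : ‖x - y‖ₑ ^ 2 ≤ 2 * ‖x - c‖ₑ ^ 2 + 2 * ‖y - c‖ₑ ^ 2 := by
  have h : ‖x - y‖ ^ 2 ≤ 2 * ‖x - c‖ ^ 2 + 2 * ‖y - c‖ ^ 2 := by
    have h1 : ‖x - y‖ ≤ ‖x - c‖ + ‖y - c‖ := by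
      rw [show x - y = (x - c) - (y - c) by ring]; exact norm_sub_le _ _
    nlinarith [sq_nonneg (‖x - c‖ - ‖y - c‖), norm_nonneg (x - y)]
  simp only [← ofReal_norm, ← ENNReal.ofReal_pow (norm_nonneg _)]
  rw [← ENNReal.ofReal_ofNat 2, ← ENNReal.ofReal_mul (by norm_num),
    ← ENNReal.ofReal_mul (by norm_num), ← ENNReal.ofReal_add (by positivity) (by positivity)]
  exact ENNReal.ofReal_le_ofReal h

section Oscillation

variable {X : Type*} [MeasurableSpace X] {ν : Measure X}

/-- The mean square oscillation of `f` over the set `S`. -/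
noncomputable def setOsc (ν : Measure X) (S : Set X) (f : X → ℂ) : ENNReal :=
  (ν S)⁻¹ * ∫⁻ w in S, ‖f w - ⨍ x in S, f x ∂ν‖ₑ ^ 2 ∂ν

/-- Jensen for the normalized restriction of ν to S. -/
lemma enorm_setAverage_sub_sq_le {S : Set X} {f : X → ℂ} (hf : IntegrableOn f S ν)
    (h0 : ν S ≠ 0) (h1 : ν S ≠ ⊤) (c : ℂ) :
    ‖(⨍ x in S, f x ∂ν) - c‖ₑ ^ 2 ≤ (ν S)⁻¹ * ∫⁻ w in S, ‖f w - c‖ₑ ^ 2 ∂ν := by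
  set P := (ν S)⁻¹ • ν.restrict S with hP
  have hPu : P univ = 1 := by
    rw [hP, Measure.smul_apply, Measure.restrict_apply_univ, smul_eq_mul,
      ENNReal.inv_mul_cancel h0 h1]
  have : IsProbabilityMeasure P := ⟨hPu⟩
  have hfP : Integrable f P := hf.smul_measure (ENNReal.inv_ne_top.2 h0)
  have h := rpow_lintegral_le (μ := P) (hfP.sub (integrable_const c)).1.enorm (q := 2) one_le_two
  rw [hPu, ENNReal.one_rpow, one_mul] at h
  simp only [ENNReal.rpow_two, Pi.sub_apply] at h
  rw [setAverage_eq', ← hP]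
  calc _ = ‖∫ x, (f x - c) ∂P‖ₑ ^ 2 := by
        rw [integral_sub hfP (integrable_const c)]; simp
    _ ≤ (∫⁻ x, ‖f x - c‖ₑ ∂P) ^ 2 := by gcongr; exact enorm_integral_le_lintegral_enorm _
    _ ≤ _ := h
    _ = _ := by rw [hP, lintegral_smul_measure, smul_eq_mul]

/-- Jensen over S with c the mean over T; enlarging the domain from S to T costs the ratio of the
measures. -/
lemma enorm_setAverage_sub_setAverage_sq_le {S T : Set X} {f : X → ℂ} (hf : IntegrableOn f S ν)
    (h0 : ν S ≠ 0) (h1 : ν T ≠ ⊤) (hST : S ⊆ T) {K : ENNReal} (hK : ν T ≤ K * ν S) :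
    ‖(⨍ x in S, f x ∂ν) - ⨍ x in T, f x ∂ν‖ₑ ^ 2 ≤ K * setOsc ν T f := by
  have h1' : ν S ≠ ⊤ := ne_top_of_le_ne_top h1 (measure_mono hST)
  have h0' : ν T ≠ 0 := fun h => h0 (measure_mono_null hST h)
  refine (enorm_setAverage_sub_sq_le hf h0 h1' _).trans ?_
  rw [setOsc, ← mul_assoc]
  gcongr
  rw [← div_eq_mul_inv, ENNReal.le_div_iff_mul_le (Or.inl h0') (Or.inl h1), mul_comm,
    ← div_eq_mul_inv, ENNReal.div_le_iff h0 h1']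
  exact hK

lemma setOsc_le_mul_setOsc {S T : Set X} {f : X → ℂ} (hf : IntegrableOn f S ν)
    (h0 : ν S ≠ 0) (h1 : ν T ≠ ⊤) (hST : S ⊆ T) {K : ENNReal} (hK : ν T ≤ K * ν S) :
    setOsc ν S f ≤ 4 * K * setOsc ν T f := by
  have h1' : ν S ≠ ⊤ := ne_top_of_le_ne_top h1 (measure_mono hST)
  have h0' : ν T ≠ 0 := fun h => h0 (measure_mono_null hST h)
  -- Both f and its mean over S are compared with the mean over T; each comparison contributes 2K.
  set m := ⨍ x in T, f x ∂ν with hm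
  have h2 := enorm_setAverage_sub_setAverage_sq_le hf h0 h1 hST hK
  have h3 : (ν S)⁻¹ * ∫⁻ w in S, ‖f w - m‖ₑ ^ 2 ∂ν ≤ K * setOsc ν T f := by
    rw [setOsc, ← mul_assoc]
    gcongr
    rw [← div_eq_mul_inv, ENNReal.le_div_iff_mul_le (Or.inl h0') (Or.inl h1), mul_comm,
      ← div_eq_mul_inv, ENNReal.div_le_iff h0 h1']
    exact hK
  calc setOsc ν S f ≤ (ν S)⁻¹ * ∫⁻ w in S, (2 * ‖f w - m‖ₑ ^ 2 + 2 * (K * setOsc ν T f)) ∂ν := by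
        rw [setOsc]
        gcongr with w
        refine (enorm_sub_sq_le _ _ m).trans ?_
        gcongr
    _ = 2 * ((ν S)⁻¹ * ∫⁻ w in S, ‖f w - m‖ₑ ^ 2 ∂ν) + 2 * (K * setOsc ν T f) := by
        rw [lintegral_add_right _ measurable_const, lintegral_const_mul' _ _ (by norm_num),
          setLIntegral_const, mul_add]
        congr 1
        · ring
        · rw [mul_comm _ (ν S), ← mul_assoc, ENNReal.inv_mul_cancel h0 h1', one_mul]
    _ ≤ 2 * (K * setOsc ν T f) + 2 * (K * setOsc ν T f) := by gcongr
    _ = _ := by ring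

/-- Allows f to be replaced by a measurable representative. -/
lemma setOsc_congr {S : Set X} {f g : X → ℂ} (h : f =ᵐ[ν] g) : setOsc ν S f = setOsc ν S g := by
  have h' : f =ᵐ[ν.restrict S] g := ae_restrict_of_ae h
  rw [setOsc, setOsc, average_congr h']
  congr 1
  refine lintegral_congr_ae ?_
  filter_upwards [h'] with x hx
  rw [hx]

end Oscillation

/-! ### Weighted volume of pseudo-hyperbolic balls. -/

lemma weightedVolume_univ {α : ℝ} (hα : -1 < α) : weightedVolume n α univ = 1 := by
  have h1 := weightConst_ne_zero (n := n) hα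
  have h2 := weightConst_ne_top (n := n) α
  rw [← lintegral_one, lintegral_weightedVolume]
  simp only [mul_one]
  rw [← inv_inv (∫⁻ w, _ ∂_), ← lintegral_weightConst, ENNReal.mul_inv_cancel h1 h2]

lemma isProbabilityMeasure_weightedVolume {α : ℝ} (hα : -1 < α) :
    IsProbabilityMeasure (weightedVolume n α) := ⟨weightedVolume_univ hα⟩

lemma sigmaFinite_invariantVolume : SigmaFinite (invariantVolume n) := by
  have : IsFiniteMeasure (normVolume n) := by
    refine ⟨?_⟩
    rw [normVolume, Measure.smul_apply, Measure.restrict_apply_univ, smul_eq_mul]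
    exact ENNReal.mul_lt_top (ENNReal.inv_ne_top.2 volume_unitBall_ne_zero).lt_top
      volume_unitBall_ne_top.lt_top
  exact SigmaFinite.withDensity_of_ne_top (Filter.Eventually.of_forall fun _ => ENNReal.ofReal_ne_top)

lemma weightedVolume_pball_eq (α : ℝ) (z : EuclideanSpace ℂ (Fin n)) (s : ℝ) :
    weightedVolume n α (pball z s) = weightConst n α *
      ∫⁻ w in pball z s, ENNReal.ofReal (defect w ^ ((n : ℝ) + 1 + α)) ∂(invariantVolume n) := by
  rw [← setLIntegral_one, setLIntegral_weightedVolume _ (measurableSet_pball z s)]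
  simp

lemma weightedVolume_pball_le {α : ℝ} {s : ℝ} (hs : s < 1) : ∃ C : ℝ, 0 < C ∧
    ∀ z ∈ unitBall n, weightedVolume n α (pball z s)
      ≤ ENNReal.ofReal (C * defect z ^ ((n : ℝ) + 1 + α)) := by
  by_cases hs0 : s ≤ 0
  · refine ⟨1, one_pos, fun z hz => ?_⟩
    have : pball z s = ∅ := by
      ext w
      simp only [mem_empty_iff_false, iff_false]
      rintro ⟨-, h⟩
      have := pdist_nonneg z w
      linarith
    rw [this]; simp
  push Not at hs0
  have hd : 0 < 1 - s ^ 2 := by nlinarith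
  obtain ⟨C, hC, h⟩ := invariantVolume_pball_le (n := n) hs
  set a := (n : ℝ) + 1 + α
  have hw0 := weightConst_ne_top (n := n) α
  refine ⟨((weightConst n α).toReal + 1) * ((4 / (1 - s ^ 2)) ^ |a|) * C, by positivity,
    fun z hz => ?_⟩
  have hdz := defect_pos hz
  rw [weightedVolume_pball_eq]
  calc _ ≤ weightConst n α * ∫⁻ w in pball z s,
        ENNReal.ofReal ((4 / (1 - s ^ 2)) ^ |a| * defect z ^ a) ∂(invariantVolume n) := by
        refine mul_le_mul_right ?_ _
        exact setLIntegral_mono' (measurableSet_pball z s) fun w hw =>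
          ENNReal.ofReal_le_ofReal (defect_rpow_le hs hz hw a)
    _ ≤ ENNReal.ofReal ((weightConst n α).toReal + 1) *
        (ENNReal.ofReal ((4 / (1 - s ^ 2)) ^ |a| * defect z ^ a) * ENNReal.ofReal C) := by
        rw [setLIntegral_const]
        gcongr
        · rw [← ENNReal.ofReal_toReal hw0]
          apply ENNReal.ofReal_le_ofReal
          rw [ENNReal.ofReal_toReal hw0]; linarith
        · exact h z hz
    _ = _ := by
        rw [← ENNReal.ofReal_mul (by positivity), ← ENNReal.ofReal_mul (by positivity)]
        congr 1; ring

lemma weightedVolume_pball_ge (hn : 1 ≤ n) {α : ℝ} (hα : -1 < α) {s : ℝ} (hs : 0 < s) :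
    ∃ c : ℝ, 0 < c ∧ ∀ z ∈ unitBall n,
      ENNReal.ofReal (c * defect z ^ ((n : ℝ) + 1 + α)) ≤ weightedVolume n α (pball z s) := by
  set s' := min s (1 / 2) with hs'
  have hs'0 : 0 < s' := by positivity
  have hs'1 : s' < 1 := (min_le_right _ _).trans_lt (by norm_num)
  have hd : 0 < 1 - s' ^ 2 := by nlinarith
  obtain ⟨c, hc, h⟩ := invariantVolume_pball_ge hn hs'0
  set a := (n : ℝ) + 1 + α
  have hw0 := weightConst_ne_top (n := n) α
  have hw1 := ENNReal.toReal_pos (weightConst_ne_zero (n := n) hα) hw0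
  refine ⟨(weightConst n α).toReal * ((4 / (1 - s' ^ 2)) ^ |a|)⁻¹ * c, by positivity,
    fun z hz => ?_⟩
  have hdz := defect_pos hz
  have hsub : pball z s' ⊆ pball z s := fun w hw => ⟨hw.1, hw.2.trans_le (min_le_left _ _)⟩
  refine le_trans ?_ (measure_mono hsub)
  rw [weightedVolume_pball_eq]
  calc _ = weightConst n α * (ENNReal.ofReal (((4 / (1 - s' ^ 2)) ^ |a|)⁻¹ * defect z ^ a)
          * ENNReal.ofReal c) := by
        nth_rw 2 [← ENNReal.ofReal_toReal hw0]
        rw [← ENNReal.ofReal_mul (by positivity), ← ENNReal.ofReal_mul (by positivity)]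
        congr 1; ring
    _ ≤ weightConst n α * ∫⁻ w in pball z s',
        ENNReal.ofReal (((4 / (1 - s' ^ 2)) ^ |a|)⁻¹ * defect z ^ a) ∂(invariantVolume n) := by
        rw [setLIntegral_const]
        gcongr
        exact h z hz
    _ ≤ _ := by
        refine mul_le_mul_right ?_ _
        refine setLIntegral_mono' (measurableSet_pball z s') fun w hw =>
          ENNReal.ofReal_le_ofReal ?_
        rw [inv_mul_le_iff₀ (by positivity)]
        exact defect_rpow_le hs'1 hw.1 (mem_pball_comm hz hw) a

lemma weightedVolume_pball_ne_zero (hn : 1 ≤ n) {α : ℝ} (hα : -1 < α) {s : ℝ} (hs : 0 < s)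
    {z : EuclideanSpace ℂ (Fin n)} (hz : z ∈ unitBall n) :
    weightedVolume n α (pball z s) ≠ 0 := by
  obtain ⟨c, hc, h⟩ := weightedVolume_pball_ge hn hα hs
  have hdz := defect_pos hz
  exact (lt_of_lt_of_le (ENNReal.ofReal_pos.2 (by positivity)) (h z hz)).ne'

lemma mem_pball_self {z : EuclideanSpace ℂ (Fin n)} (hz : z ∈ unitBall n) {s : ℝ} (hs : 0 < s) :
    z ∈ pball z s := ⟨hz, by rwa [pdist_self hz]⟩

/-- Nested pseudo-hyperbolic balls of fixed radii have comparable weighted volumes. -/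
lemma weightedVolume_pball_le_mul (hn : 1 ≤ n) {α : ℝ} (hα : -1 < α) {d s : ℝ} (hd : 0 < d)
    (hs : s < 1) : ∃ K : ℝ, 0 < K ∧ ∀ u ∈ unitBall n, ∀ w ∈ unitBall n, pball w d ⊆ pball u s →
      weightedVolume n α (pball u s) ≤ ENNReal.ofReal K * weightedVolume n α (pball w d) := by
  obtain ⟨C, hC, h⟩ := weightedVolume_pball_le (n := n) (α := α) hs
  obtain ⟨c, hc, h'⟩ := weightedVolume_pball_ge hn hα hd
  set a := (n : ℝ) + 1 + α
  -- The radius s is bounded only from above; for s ≤ -1 the outer ball is empty and cannot contain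
  -- w.
  by_cases hs0 : 1 - s ^ 2 ≤ 0
  · refine ⟨1, one_pos, fun u hu w hw hsub => ?_⟩
    have := (hsub (mem_pball_self hw hd)).2
    have := pdist_nonneg u w
    nlinarith
  push Not at hs0
  refine ⟨C * (4 / (1 - s ^ 2)) ^ |a| / c, by positivity, fun u hu w hw hsub => ?_⟩
  have hwu := hsub (mem_pball_self hw hd)
  have hdu := defect_pos hu
  have hdw := defect_pos hw
  calc _ ≤ ENNReal.ofReal (C * defect u ^ a) := h u hu
    _ ≤ ENNReal.ofReal (C * (4 / (1 - s ^ 2)) ^ |a| / c) * ENNReal.ofReal (c * defect w ^ a) := by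
        rw [← ENNReal.ofReal_mul (by positivity)]
        apply ENNReal.ofReal_le_ofReal
        have := defect_rpow_le hs hw (mem_pball_comm hu hwu) a
        calc C * defect u ^ a ≤ C * ((4 / (1 - s ^ 2)) ^ |a| * defect w ^ a) := by gcongr
          _ = _ := by field_simp
    _ ≤ _ := by gcongr; exact h' w hw

/-! ### Means and oscillations over pseudo-hyperbolic balls. -/

/-- The mean of `f` over a pseudo-hyperbolic ball. -/
noncomputable def pavg (α s : ℝ) (f : EuclideanSpace ℂ (Fin n) → ℂ)
    (u : EuclideanSpace ℂ (Fin n)) : ℂ := ⨍ w in pball u s, f w ∂(weightedVolume n α)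

/-- The mean square oscillation of `f` over a pseudo-hyperbolic ball. -/
noncomputable def posc (α s : ℝ) (f : EuclideanSpace ℂ (Fin n) → ℂ)
    (u : EuclideanSpace ℂ (Fin n)) : ENNReal := setOsc (weightedVolume n α) (pball u s) f

lemma measurable_weightedVolume_pball {α : ℝ} (hα : -1 < α) (s : ℝ) :
    Measurable fun u : EuclideanSpace ℂ (Fin n) => weightedVolume n α (pball u s) := by
  have := isProbabilityMeasure_weightedVolume (n := n) hα
  exact measurable_measure_prodMk_left (measurableSet_pball_prod s)

/-- Writing the ball as a section of a measurable subset of the product makes the mean a parametric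
integral. -/
lemma measurable_pavg {α : ℝ} (hα : -1 < α) (s : ℝ) {f : EuclideanSpace ℂ (Fin n) → ℂ}
    (hf : Measurable f) : Measurable (pavg α s f) := by
  have := isProbabilityMeasure_weightedVolume (n := n) hα
  have h1 : Measurable fun p : EuclideanSpace ℂ (Fin n) × EuclideanSpace ℂ (Fin n) =>
      {p : EuclideanSpace ℂ (Fin n) × EuclideanSpace ℂ (Fin n) | p.2 ∈ pball p.1 s}.indicator
        (fun p => f p.2) p := (hf.comp measurable_snd).indicator (measurableSet_pball_prod s)
  have h2 := (h1.stronglyMeasurable.integral_prod_right' (ν := weightedVolume n α)).measurable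
  have h3 : ∀ u, pavg α s f u = ((weightedVolume n α (pball u s)).toReal⁻¹ : ℝ) •
      ∫ w, {p : EuclideanSpace ℂ (Fin n) × EuclideanSpace ℂ (Fin n) | p.2 ∈ pball p.1 s}.indicator
        (fun p => f p.2) (u, w) ∂(weightedVolume n α) := by
    intro u
    rw [pavg, setAverage_eq, ← integral_indicator (measurableSet_pball u s)]
    rfl
  rw [show pavg α s f = _ from funext h3]
  exact ((measurable_weightedVolume_pball hα s).ennreal_toReal.inv).smul h2

lemma measurable_posc {α : ℝ} (hα : -1 < α) (s : ℝ) {f : EuclideanSpace ℂ (Fin n) → ℂ}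
    (hf : Measurable f) : Measurable (posc α s f) := by
  have := isProbabilityMeasure_weightedVolume (n := n) hα
  have h1 : Measurable fun p : EuclideanSpace ℂ (Fin n) × EuclideanSpace ℂ (Fin n) =>
      {p : EuclideanSpace ℂ (Fin n) × EuclideanSpace ℂ (Fin n) | p.2 ∈ pball p.1 s}.indicator
        (fun p => ‖f p.2 - pavg α s f p.1‖ₑ ^ 2) p :=
    (((hf.comp measurable_snd).sub ((measurable_pavg hα s hf).comp measurable_fst)).enorm.pow_const
      2).indicator (measurableSet_pball_prod s)
  have h2 := h1.lintegral_prod_right' (ν := weightedVolume n α)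
  have h3 : ∀ u, posc α s f u = (weightedVolume n α (pball u s))⁻¹ *
      ∫⁻ w, {p : EuclideanSpace ℂ (Fin n) × EuclideanSpace ℂ (Fin n) | p.2 ∈ pball p.1 s}.indicator
        (fun p => ‖f p.2 - pavg α s f p.1‖ₑ ^ 2) (u, w) ∂(weightedVolume n α) := by
    intro u
    rw [posc, setOsc, ← lintegral_indicator (measurableSet_pball u s)]
    rfl
  rw [show posc α s f = _ from funext h3]
  exact (measurable_weightedVolume_pball hα s).inv.mul h2

lemma integrableOn_of_memLp {α : ℝ} (hα : -1 < α) {f : EuclideanSpace ℂ (Fin n) → ℂ}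
    (hf : MemLp f 2 (weightedVolume n α)) (S : Set (EuclideanSpace ℂ (Fin n))) :
    IntegrableOn f S (weightedVolume n α) := by
  have := isProbabilityMeasure_weightedVolume (n := n) hα
  exact (hf.integrable one_le_two).integrableOn

/-- Means over balls contained in a common larger ball differ by at most its oscillation. -/
lemma enorm_pavg_sub_pavg_sq_le (hn : 1 ≤ n) {α : ℝ} (hα : -1 < α) {d s : ℝ} (hd : 0 < d)
    (hs : s < 1) : ∃ K : ℝ, 0 < K ∧ ∀ f : EuclideanSpace ℂ (Fin n) → ℂ,
      MemLp f 2 (weightedVolume n α) → ∀ u ∈ unitBall n, ∀ w ∈ unitBall n,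
        pball w d ⊆ pball u s →
          ‖pavg α d f w - pavg α s f u‖ₑ ^ 2 ≤ ENNReal.ofReal K * posc α s f u := by
  obtain ⟨K, hK, h⟩ := weightedVolume_pball_le_mul hn hα hd hs
  have := isProbabilityMeasure_weightedVolume (n := n) hα
  exact ⟨K, hK, fun f hf u hu w hw hsub => enorm_setAverage_sub_setAverage_sq_le
    (integrableOn_of_memLp hα hf _) (weightedVolume_pball_ne_zero hn hα hd hw)
    (measure_ne_top _ _) hsub (h u hu w hw hsub)⟩

lemma posc_le_mul_posc (hn : 1 ≤ n) {α : ℝ} (hα : -1 < α) {d s : ℝ} (hd : 0 < d)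
    (hs : s < 1) : ∃ K : ℝ, 0 < K ∧ ∀ f : EuclideanSpace ℂ (Fin n) → ℂ,
      MemLp f 2 (weightedVolume n α) → ∀ u ∈ unitBall n, ∀ w ∈ unitBall n,
        pball w d ⊆ pball u s → posc α d f w ≤ ENNReal.ofReal K * posc α s f u := by
  obtain ⟨K, hK, h⟩ := weightedVolume_pball_le_mul hn hα hd hs
  have := isProbabilityMeasure_weightedVolume (n := n) hα
  refine ⟨4 * K, by positivity, fun f hf u hu w hw hsub => ?_⟩
  rw [ENNReal.ofReal_mul (by norm_num), ENNReal.ofReal_ofNat]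
  exact setOsc_le_mul_setOsc
    (integrableOn_of_memLp hα hf _) (weightedVolume_pball_ne_zero hn hα hd hw)
    (measure_ne_top _ _) hsub (h u hu w hw hsub)

/-- Means over nearby balls differ by at most the oscillation integrated over a ball. -/
lemma enorm_pavg_sub_pavg_sq_le_lintegral (hn : 1 ≤ n) {α : ℝ} (hα : -1 < α) {d : ℝ} (hd : 0 < d)
    (hd1 : 4 * d < 1) : ∃ K : ℝ, 0 < K ∧ ∀ f : EuclideanSpace ℂ (Fin n) → ℂ,
      MemLp f 2 (weightedVolume n α) → ∀ x ∈ unitBall n, ∀ y ∈ unitBall n, pdist x y ≤ d →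
        ‖pavg α d f x - pavg α d f y‖ₑ ^ 2
          ≤ ENNReal.ofReal K * ∫⁻ u in pball x d, posc α (4 * d) f u ∂(invariantVolume n) := by
  obtain ⟨K, hK, h⟩ := enorm_pavg_sub_pavg_sq_le hn hα hd hd1
  obtain ⟨c, hc, hvol⟩ := invariantVolume_pball_ge hn hd
  refine ⟨4 * K / c, by positivity, fun f hf x hx y hy hxy => ?_⟩
  -- For each u near x, the ball of radius 4d about u contains both small balls, so its mean can
  -- serve as intermediate value. Averaging over u turns a pointwise oscillation into an integral,
  -- the form in which Tonelli applies later.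
  have h1 : ∀ u ∈ pball x d, ‖pavg α d f x - pavg α d f y‖ₑ ^ 2
      ≤ ENNReal.ofReal (4 * K) * posc α (4 * d) f u := by
    intro u hu
    have hux : pdist u x < d := (mem_pball_comm hx hu).2
    have huy : pdist u y ≤ 2 * d := by
      have := pdist_triangle hx hu.1 hy
      linarith
    have e1 := h f hf u hu.1 x hx (pball_subset_pball hu.1 hx hux.le (by linarith))
    have e2 := h f hf u hu.1 y hy (pball_subset_pball hu.1 hy huy (by linarith))
    calc _ ≤ _ := enorm_sub_sq_le _ _ (pavg α (4 * d) f u)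
      _ ≤ 2 * (ENNReal.ofReal K * posc α (4 * d) f u)
          + 2 * (ENNReal.ofReal K * posc α (4 * d) f u) := by gcongr
      _ = _ := by
          rw [ENNReal.ofReal_mul (by norm_num), ENNReal.ofReal_ofNat]; ring
  have h2 : ‖pavg α d f x - pavg α d f y‖ₑ ^ 2 * ENNReal.ofReal c
      ≤ ENNReal.ofReal (4 * K) * ∫⁻ u in pball x d, posc α (4 * d) f u ∂(invariantVolume n) := by
    calc _ ≤ ‖pavg α d f x - pavg α d f y‖ₑ ^ 2 * invariantVolume n (pball x d) := by
          gcongr; exact hvol x hx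
      _ = ∫⁻ u in pball x d, ‖pavg α d f x - pavg α d f y‖ₑ ^ 2 ∂(invariantVolume n) := by
          rw [setLIntegral_const]
      _ ≤ _ := by
          rw [← lintegral_const_mul' _ _ ENNReal.ofReal_ne_top]
          exact setLIntegral_mono' (measurableSet_pball x d) h1
  rw [← ENNReal.le_div_iff_mul_le (Or.inl (ENNReal.ofReal_pos.2 hc).ne')
    (Or.inl ENNReal.ofReal_ne_top)] at h2
  refine h2.trans_eq ?_
  rw [ENNReal.ofReal_div_of_pos hc, div_eq_mul_inv, div_eq_mul_inv]
  ring

/-! ### Chaining along geodesics, and shadows. -/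

lemma qdist_smul_smul {e : EuclideanSpace ℂ (Fin n)} (he : ‖e‖ = 1) {x y : ℝ} (hxy : x * y ≤ 1) :
    qdist ((x : ℂ) • e) ((y : ℂ) • e) = 1 - x * y := by
  rw [qdist, cdot_smul_left, cdot_smul_right, cdot_self, he, Complex.conj_ofReal]
  have : (1 : ℂ) - y * (x * ((1 ^ 2 : ℝ) : ℂ)) = ((1 - x * y : ℝ) : ℂ) := by push_cast; ring
  rw [this, Complex.norm_real, Real.norm_of_nonneg (by linarith)]

lemma defect_smul {e : EuclideanSpace ℂ (Fin n)} (he : ‖e‖ = 1) (x : ℝ) :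
    defect ((x : ℂ) • e) = 1 - x ^ 2 := by
  rw [defect, norm_smul, he, Complex.norm_real, mul_one, Real.norm_eq_abs, sq_abs]

lemma smul_mem_unitBall {e : EuclideanSpace ℂ (Fin n)} (he : ‖e‖ = 1) {x : ℝ} (hx : 0 ≤ x)
    (hx1 : x < 1) : (x : ℂ) • e ∈ unitBall n := by
  apply mem_unitBall_of_defect_pos
  rw [defect_smul he]; nlinarith

/-- The exact value is (y-x)/(1-xy). The weaker bound matches radii 1-κ^j, for which it equals 1-κ
on consecutive points. -/
lemma pdist_smul_smul_le {e : EuclideanSpace ℂ (Fin n)} (he : ‖e‖ = 1) {x y : ℝ} (hx : 0 ≤ x)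
    (hxy : x ≤ y) (hy : y < 1) : pdist ((x : ℂ) • e) ((y : ℂ) • e) ≤ (y - x) / (1 - x) := by
  have h1 : 0 < 1 - x * y := by nlinarith
  have hx1 : 0 < 1 - x := by linarith
  have h2 : pdist ((x : ℂ) • e) ((y : ℂ) • e) ^ 2 = ((y - x) / (1 - x * y)) ^ 2 := by
    rw [pdist_sq (smul_mem_unitBall he hx (by linarith)) (smul_mem_unitBall he (by linarith) hy),
      qdist_smul_smul he (by nlinarith), defect_smul he, defect_smul he]
    field_simp
    ring
  have h3 : pdist ((x : ℂ) • e) ((y : ℂ) • e) = (y - x) / (1 - x * y) := by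
    rwa [sq_eq_sq₀ (pdist_nonneg _ _) (div_nonneg (by linarith) h1.le)] at h2
  rw [h3]
  have : 0 ≤ y - x := by linarith
  gcongr
  nlinarith

/-- If `u` is close to a point on the geodesic from `z` to `w`, then `w` lies in the shadow of `u`
as seen from `z`. -/
lemma shadow_of_pdist_lt {d : ℝ} (hd1 : d < 1) {z w u p : EuclideanSpace ℂ (Fin n)}
    (hz : z ∈ unitBall n) (hw : w ∈ unitBall n) (hu : u ∈ unitBall n) (hp : p ∈ unitBall n)
    (hpw : qdist p (moebius z w) ≤ defect p) (hpu : pdist p (moebius z u) < d) :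
    qdist u w * qdist z u ≤ 36 / (1 - d ^ 2) ^ 2 * defect u * qdist z w := by
  have hbu := moebius_mem hz hu
  have hbw := moebius_mem hz hw
  have h0 := pdist_nonneg p (moebius z u)
  have hd : 0 < 1 - d ^ 2 := by nlinarith
  have h1 := (defect_le_of_pdist_lt hd1 hp hbu hpu).1
  have h2 := (defect_le_of_pdist_lt hd1 hbu hp (by rwa [pdist_comm hbu hp])).2
  have h3 := qdist_triangle hbu hbw hp
  rw [qdist_comm _ p] at h3
  have hdp := defect_pos hp
  -- Both φ_z(u) and φ_z(w) lie within a multiple of 1-|p|² of p in the quasi-distance, and 1-|p|²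
  -- is comparable to 1-|φ_z(u)|². The transformation rules then eliminate φ_z.
  have h4 : qdist (moebius z u) (moebius z w) ≤ 36 / (1 - d ^ 2) ^ 2 * defect (moebius z u) := by
    have e : 1 ≤ 1 / (1 - d ^ 2) := by
      rw [le_div_iff₀ hd]; nlinarith [sq_nonneg d]
    calc _ ≤ 3 * (2 / (1 - d ^ 2) * defect p + 1 * defect p) := by linarith
      _ ≤ 3 * (2 / (1 - d ^ 2) * defect p + 1 / (1 - d ^ 2) * defect p) := by gcongr
      _ = 9 / (1 - d ^ 2) * defect p := by ring
      _ ≤ 9 / (1 - d ^ 2) * (4 / (1 - d ^ 2) * defect (moebius z u)) := by gcongr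
      _ = _ := by field_simp; ring
  rw [qdist_moebius hz hu hw, defect_moebius hz hu] at h4
  have hqu := qdist_pos hz hu
  have hqw := qdist_pos hz hw
  have hdz := defect_pos hz
  have hdu := defect_pos hu
  have e1 : qdist u w * qdist z u
      = (defect z * qdist u w / (qdist z u * qdist z w)) * (qdist z u ^ 2 * qdist z w / defect z) := by
    field_simp
  have e2 : 36 / (1 - d ^ 2) ^ 2 * defect u * qdist z w
      = (36 / (1 - d ^ 2) ^ 2 * (defect z * defect u / qdist z u ^ 2))
        * (qdist z u ^ 2 * qdist z w / defect z) := by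
    field_simp
  rw [e1, e2]
  gcongr

/-- The difference of means over distant balls, bounded by an integral of oscillations over those
points having one centre in their shadow as seen from the other. -/
lemma enorm_pavg_sub_pavg_sq_le_shadow (hn : 1 ≤ n) {α : ℝ} (hα : -1 < α) {d : ℝ} (hd : 0 < d)
    (hd1 : 4 * d < 1) {ε : ℝ} (hε : 0 < ε) : ∃ C : ℝ, 0 < C ∧ ∃ C₁ : ℝ, 0 < C₁ ∧
      ∀ f : EuclideanSpace ℂ (Fin n) → ℂ, MemLp f 2 (weightedVolume n α) →
        ∀ z ∈ unitBall n, ∀ w ∈ unitBall n,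
          ‖pavg α d f w - pavg α d f z‖ₑ ^ 2 ≤ ENNReal.ofReal C *
            ∫⁻ u, {u | qdist u w * qdist z u ≤ C₁ * defect u * qdist z w}.indicator
              (fun u => ENNReal.ofReal ((defect z * defect u / qdist z u ^ 2) ^ (-ε)) *
                posc α (4 * d) f u) u ∂(invariantVolume n) := by
  obtain ⟨K, hK, hstep⟩ := enorm_pavg_sub_pavg_sq_le_lintegral hn hα hd hd1
  have hdd : 0 < 1 - d ^ 2 := by nlinarith
  -- With this κ, consecutive points of the chain are at pseudo-hyperbolic distance at most d.
  set κ := 1 - d with hκ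
  have hκ0 : 0 < κ := by linarith
  have hκ1 : κ < 1 := by linarith
  set D := 4 / (1 - d ^ 2) * 2 with hD
  have hD0 : 0 < D := by positivity
  -- The weight gains κ^(jε) for the squared difference at link j, hence q^j for the difference
  -- itself.
  set q := κ ^ (ε / 2) with hq
  have hq0 : 0 < q := by positivity
  have hq1 : q < 1 := Real.rpow_lt_one hκ0.le hκ1 (by positivity)
  refine ⟨((1 - q)⁻¹) ^ 2 * (K * D ^ ε), mul_pos (pow_pos (inv_pos.2 (by linarith)) 2) (by positivity), 36 / (1 - d ^ 2) ^ 2, by positivity,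
    fun f hf z hz w hw => ?_⟩
  set C₁ := 36 / (1 - d ^ 2) ^ 2
  set I := ∫⁻ u, {u | qdist u w * qdist z u ≤ C₁ * defect u * qdist z w}.indicator
    (fun u => ENNReal.ofReal ((defect z * defect u / qdist z u ^ 2) ^ (-ε)) *
                posc α (4 * d) f u) u ∂(invariantVolume n) with hI
  obtain ⟨b, hb⟩ : ∃ b, b = moebius z w := ⟨_, rfl⟩
  have hbB : b ∈ unitBall n := hb ▸ moebius_mem hz hw
  have hwb : moebius z b = w := by rw [hb, moebius_moebius hz hw]
  -- Here w = z and the left side vanishes; otherwise b determines the direction of the geodesic.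
  by_cases hb0 : b = 0
  · rw [hb0, moebius_zero_right] at hwb
    rw [← hwb]; simp
  set β := ‖b‖ with hβ
  have hβ0 : 0 < β := norm_pos_iff.2 hb0
  have hβ1 : β < 1 := mem_unitBall.1 hbB
  obtain ⟨e, he, hbe⟩ : ∃ e : EuclideanSpace ℂ (Fin n), ‖e‖ = 1 ∧ (β : ℂ) • e = b := by
    refine ⟨((β⁻¹ : ℝ) : ℂ) • b, ?_, ?_⟩
    · rw [norm_smul, Complex.norm_real, norm_inv, norm_norm, inv_mul_cancel₀ hβ0.ne']
    · rw [smul_smul, ← Complex.ofReal_mul, mul_inv_cancel₀ hβ0.ne']; simp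
  have hκj : ∀ j : ℕ, κ ^ j ≤ 1 := fun j => pow_le_one₀ hκ0.le hκ1.le
  -- Capping at β makes the chain reach b after finitely many links and stay there.
  set r : ℕ → ℝ := fun j => min (1 - κ ^ j) β with hr
  have hr0 : ∀ j, 0 ≤ r j := fun j => le_min (by linarith [hκj j]) hβ0.le
  have hr1 : ∀ j, r j < 1 := fun j => (min_le_right _ _).trans_lt hβ1
  have hrm : ∀ j, r j ≤ r (j + 1) := fun j => by
    refine min_le_min_right _ ?_
    have : κ ^ (j + 1) ≤ κ ^ j := pow_le_pow_of_le_one hκ0.le hκ1.le j.le_succ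
    linarith
  set p : ℕ → EuclideanSpace ℂ (Fin n) := fun j => (r j : ℂ) • e with hp
  have hpB : ∀ j, p j ∈ unitBall n := fun j => smul_mem_unitBall he (hr0 j) (hr1 j)
  have hwB : ∀ j, moebius z (p j) ∈ unitBall n := fun j => moebius_mem hz (hpB j)
  set F := pavg α d f with hF
  have hterm : ∀ j, ‖F (moebius z (p j)) - F (moebius z (p (j + 1)))‖ₑ
      ≤ (ENNReal.ofReal (K * D ^ ε) * I) ^ (1 / 2 : ℝ) * ENNReal.ofReal q ^ j := by
    intro j
    rcases lt_or_ge (1 - κ ^ j) β with hj | hj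
    · have hrj : r j = 1 - κ ^ j := min_eq_left hj.le
      have hpp : pdist (moebius z (p j)) (moebius z (p (j + 1))) ≤ d := by
        rw [pdist_moebius hz (hpB j) (hpB (j + 1))]
        refine (pdist_smul_smul_le he (hr0 j) (hrm j) (hr1 (j + 1))).trans ?_
        rw [hrj, sub_sub_cancel, div_le_iff₀ (by positivity)]
        have : r (j + 1) ≤ 1 - κ ^ (j + 1) := min_le_left _ _
        rw [pow_succ] at this
        nlinarith
      have hdp : defect (p j) ≤ 2 * κ ^ j := by
        rw [hp, defect_smul he, hrj]
        have : 0 < κ ^ j := by positivity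
        nlinarith
      -- For p_j on the segment from 0 to b this reads 1 - r_j β ≤ 1 - r_j².
      have hqb : qdist (p j) (moebius z w) ≤ defect (p j) := by
        rw [← hb, ← hbe, hp, qdist_smul_smul he (by nlinarith [hr0 j, hr1 j]), defect_smul he, hrj]
        nlinarith [hκj j]
      -- The ball at link j lies in the region whose shadow contains w, and there 1-|φ_z(u)|² ≤ D
      -- κ^j, so inserting the weight gains (D κ^j)^ε.
      have hball : ∫⁻ u in pball (moebius z (p j)) d, posc α (4 * d) f u ∂(invariantVolume n)
          ≤ ENNReal.ofReal ((D * κ ^ j) ^ ε) * I := by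
        rw [hI, ← lintegral_const_mul' _ _ ENNReal.ofReal_ne_top,
          ← lintegral_indicator (measurableSet_pball _ _)]
        refine lintegral_mono fun u => ?_
        by_cases hu : u ∈ pball (moebius z (p j)) d
        · have huB := hu.1
          have hpu : pdist (p j) (moebius z u) < d := by
            have := hu.2
            rwa [← pdist_moebius hz (hwB j) huB, moebius_moebius hz (hpB j)] at this
          have hsh := shadow_of_pdist_lt (by linarith : d < 1) hz hw huB (hpB j) hqb hpu
          rw [indicator_of_mem hu, indicator_of_mem (show u ∈ {u | qdist u w * qdist z u
            ≤ C₁ * defect u * qdist z w} from hsh), ← mul_assoc,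
            ← ENNReal.ofReal_mul (by positivity)]
          refine le_mul_of_one_le_left bot_le ?_
          rw [← ENNReal.ofReal_one]
          apply ENNReal.ofReal_le_ofReal
          rw [← defect_moebius hz huB]
          have hdm := defect_pos (moebius_mem hz huB)
          have h1 : defect (moebius z u) ≤ D * κ ^ j := by
            refine (defect_le_of_pdist_lt (by linarith : d < 1) (hpB j) (moebius_mem hz huB)
              hpu).2.trans ?_
            rw [hD, mul_assoc]; gcongr
          rw [Real.rpow_neg hdm.le, ← div_eq_mul_inv, one_le_div (by positivity)]
          gcongr
        · rw [indicator_of_notMem hu]; exact bot_le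
      have h2 : ‖F (moebius z (p j)) - F (moebius z (p (j + 1)))‖ₑ ^ 2
          ≤ (ENNReal.ofReal (K * D ^ ε) * I) * (ENNReal.ofReal q ^ j) ^ 2 := by
        refine (hstep f hf _ (hwB j) _ (hwB (j + 1)) hpp).trans ?_
        refine (mul_le_mul_right hball _).trans_eq ?_
        have e1 : (D * κ ^ j) ^ ε = D ^ ε * (q ^ j) ^ 2 := by
          rw [Real.mul_rpow hD0.le (by positivity), hq, ← Real.rpow_natCast κ j,
            ← Real.rpow_natCast _ j, ← Real.rpow_natCast _ 2, ← Real.rpow_mul hκ0.le,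
            ← Real.rpow_mul hκ0.le, ← Real.rpow_mul hκ0.le]
          congr 2; push_cast; ring
        rw [e1, ← ENNReal.ofReal_pow hq0.le, ← ENNReal.ofReal_pow (by positivity), ← mul_assoc,
          ← ENNReal.ofReal_mul hK.le, ← mul_assoc K, ENNReal.ofReal_mul (by positivity)]
        ring
      calc _ = (‖F (moebius z (p j)) - F (moebius z (p (j + 1)))‖ₑ ^ 2) ^ (1 / 2 : ℝ) := by
            rw [← ENNReal.rpow_natCast, ← ENNReal.rpow_mul]; norm_num
        _ ≤ ((ENNReal.ofReal (K * D ^ ε) * I) * (ENNReal.ofReal q ^ j) ^ 2) ^ (1 / 2 : ℝ) := by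
            gcongr
        _ = _ := by
            rw [ENNReal.mul_rpow_of_nonneg _ _ (by norm_num)]
            congr 1
            rw [← ENNReal.rpow_natCast _ 2, ← ENNReal.rpow_mul]; norm_num
    · have e1 : r j = β := min_eq_right hj
      have e2 : r (j + 1) = β :=
        le_antisymm (min_le_right _ _) (e1 ▸ hrm j)
      rw [hp]
      simp only [e1, e2, sub_self, enorm_zero]
      exact bot_le
  obtain ⟨N, hN⟩ : ∃ N : ℕ, κ ^ N < 1 - β := exists_pow_lt_of_lt_one (by linarith) hκ1
  have hpN : p N = b := by
    have : r N = β := min_eq_right (by linarith)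
    rw [← hbe, hp]; simp only [this]
  have hp0 : p 0 = 0 := by
    have : r 0 = 0 := by simp [hr, hβ0.le]
    rw [hp]; simp [this]
  have hsum := edist_le_range_sum_of_edist_le (f := fun j => F (moebius z (p j))) N
    (d := fun j => (ENNReal.ofReal (K * D ^ ε) * I) ^ (1 / 2 : ℝ) * ENNReal.ofReal q ^ j)
    (fun {k} _ => by rw [edist_eq_enorm_sub]; exact hterm k)
  rw [hpN, hp0, hwb, moebius_zero_right, edist_comm, edist_eq_enorm_sub, ← Finset.mul_sum] at hsum
  have hgeo : ∑ i ∈ Finset.range N, ENNReal.ofReal q ^ i ≤ ENNReal.ofReal ((1 - q)⁻¹) := by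
    refine (ENNReal.sum_le_tsum _).trans_eq ?_
    rw [ENNReal.tsum_geometric, ENNReal.ofReal_inv_of_pos (by linarith),
      ENNReal.ofReal_sub _ hq0.le, ENNReal.ofReal_one]
  calc _ ≤ ((ENNReal.ofReal (K * D ^ ε) * I) ^ (1 / 2 : ℝ) * ENNReal.ofReal ((1 - q)⁻¹)) ^ 2 := by
        gcongr
        exact hsum.trans (mul_le_mul_right hgeo _)
    _ = _ := by
        have : 0 ≤ (1 - q)⁻¹ := inv_nonneg.2 (by linarith)
        rw [mul_pow, ← ENNReal.rpow_natCast _ 2, ← ENNReal.rpow_mul]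
        rw [show (1 / 2 : ℝ) * (2 : ℕ) = 1 by norm_num, ENNReal.rpow_one,
          ENNReal.ofReal_mul (p := (1 - q)⁻¹ ^ 2) (by positivity), ENNReal.ofReal_pow this]
        ring

/-! ### The Forelli-Rudin kernels. -/

/-- The kernel `(1 - |z|²)^B (1 - |w|²)^A / |1 - ⟨w, z⟩|^(A + B)`. -/
noncomputable def berKernel (A B : ℝ) (z w : EuclideanSpace ℂ (Fin n)) : ℝ :=
  defect z ^ B * defect w ^ A * qdist z w ^ (-(A + B))

lemma measurable_berKernel (A B : ℝ) : Measurable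
    fun p : EuclideanSpace ℂ (Fin n) × EuclideanSpace ℂ (Fin n) => berKernel A B p.1 p.2 := by
  unfold berKernel
  exact (((measurable_defect.comp measurable_fst).pow_const _).mul
    ((measurable_defect.comp measurable_snd).pow_const _)).mul
    ((measurable_qdist measurable_fst measurable_snd).pow_const _)

lemma measurable_berKernel_right (A B : ℝ) (z : EuclideanSpace ℂ (Fin n)) :
    Measurable (berKernel A B z) := by
  unfold berKernel
  exact ((measurable_defect.pow_const _).const_mul _).mul
    ((measurable_qdist measurable_const measurable_id).pow_const _)

lemma berKernel_pos (A B : ℝ) {z w : EuclideanSpace ℂ (Fin n)} (hz : z ∈ unitBall n)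
    (hw : w ∈ unitBall n) : 0 < berKernel A B z w := by
  have := defect_pos hz
  have := defect_pos hw
  have := qdist_pos hz hw
  unfold berKernel; positivity

lemma berKernel_comm (A B : ℝ) (z w : EuclideanSpace ℂ (Fin n)) :
    berKernel A B z w = berKernel B A w z := by
  rw [berKernel, berKernel, qdist_comm, add_comm A B, mul_comm (defect z ^ B)]

/-- Powers stay within the family, which is what makes exponents q < 1 accessible to the
Forelli-Rudin estimate. -/
lemma berKernel_rpow (A B q : ℝ) {z w : EuclideanSpace ℂ (Fin n)} (hz : z ∈ unitBall n)
    (hw : w ∈ unitBall n) : berKernel A B z w ^ q = berKernel (A * q) (B * q) z w := by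
  have h1 := defect_pos hz
  have h2 := defect_pos hw
  have h3 := qdist_pos hz hw
  rw [berKernel, Real.mul_rpow (by positivity) (by positivity),
    Real.mul_rpow (by positivity) (by positivity), ← Real.rpow_mul h1.le, ← Real.rpow_mul h2.le,
    ← Real.rpow_mul h3.le, berKernel]
  congr 2; ring

/-- The weight (1-|φ_z(w)|²)^(-ε) created by chaining costs exactly ε in both exponents. -/
lemma berKernel_mul_rpow (A B ε : ℝ) {z w : EuclideanSpace ℂ (Fin n)} (hz : z ∈ unitBall n)
    (hw : w ∈ unitBall n) : berKernel A B z w * (defect z * defect w / qdist z w ^ 2) ^ (-ε)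
      = berKernel (A - ε) (B - ε) z w := by
  have h1 := defect_pos hz
  have h2 := defect_pos hw
  have h3 := qdist_pos hz hw
  rw [berKernel, berKernel, Real.div_rpow (by positivity) (by positivity),
    Real.mul_rpow h1.le h2.le, ← Real.rpow_natCast (qdist z w) 2, ← Real.rpow_mul h3.le,
    Real.rpow_sub h1, Real.rpow_sub h2, Real.rpow_neg h1.le, Real.rpow_neg h2.le,
    show -(A - ε + (B - ε)) = -(A + B) - ((2 : ℕ) * -ε) by push_cast; ring, Real.rpow_sub h3]
  field_simp

/-- The extra factor is a nonpositive power of 1-|φ_z(w)|², hence at least 1. -/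
lemma berKernel_le_berKernel_sub (A B : ℝ) {ε : ℝ} (hε : 0 ≤ ε) {z w : EuclideanSpace ℂ (Fin n)}
    (hz : z ∈ unitBall n) (hw : w ∈ unitBall n) :
    berKernel A B z w ≤ berKernel (A - ε) (B - ε) z w := by
  rw [← berKernel_mul_rpow A B ε hz hw]
  refine le_mul_of_one_le_right (berKernel_pos A B hz hw).le ?_
  have h := pdist_sq hz hw
  have h1 := defect_pos hz
  have h2 := defect_pos hw
  have h3 := qdist_pos hz hw
  have h4 : defect z * defect w / qdist z w ^ 2 ≤ 1 := by nlinarith [sq_nonneg (pdist z w)]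
  exact Real.one_le_rpow_of_pos_of_le_one_of_nonpos (by positivity) h4 (by linarith)

lemma berKernel_le_mul {s : ℝ} (hs : s < 1) (hs0 : 0 ≤ s) (A B : ℝ) : ∃ K : ℝ, 0 < K ∧
    ∀ z ∈ unitBall n, ∀ u ∈ unitBall n, ∀ w ∈ pball u s,
      berKernel A B z w ≤ K * berKernel A B z u := by
  have hd : 0 < 1 - s ^ 2 := by nlinarith
  refine ⟨(4 / (1 - s ^ 2)) ^ |A| * (15 / (1 - s ^ 2)) ^ |(-(A + B))|, by positivity,
    fun z hz u hu w hw => ?_⟩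
  have h1 := defect_rpow_le hs hu hw A
  have h2 := qdist_rpow_le hs hu hw hz (-(A + B))
  have := defect_pos hz
  have := defect_pos hw.1
  have := defect_pos hu
  have := qdist_pos hw.1 hz
  have := qdist_pos hu hz
  rw [berKernel, berKernel, qdist_comm z, qdist_comm z]
  calc _ ≤ defect z ^ B * ((4 / (1 - s ^ 2)) ^ |A| * defect u ^ A)
        * ((15 / (1 - s ^ 2)) ^ |(-(A + B))| * qdist u z ^ (-(A + B))) := by gcongr
    _ = _ := by ring

/-- The Forelli-Rudin estimate for `berKernel` in the second variable. -/
lemma lintegral_berKernel_le {A B : ℝ} (hA : (n : ℝ) < A) (hB : 0 < B) : ∃ C : ℝ, 0 < C ∧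
    ∀ z ∈ unitBall n,
      ∫⁻ w, ENNReal.ofReal (berKernel A B z w) ∂(invariantVolume n) ≤ ENNReal.ofReal C := by
  obtain ⟨C, hC, h⟩ := lintegral_invariant_forelliRudin hA hB
  refine ⟨C, hC, fun z hz => ?_⟩
  have hdz := defect_pos hz
  calc _ = ENNReal.ofReal (defect z ^ B) *
        ∫⁻ w, ENNReal.ofReal (defect w ^ A * qdist z w ^ (-(A + B))) ∂(invariantVolume n) := by
        rw [← lintegral_const_mul' _ _ ENNReal.ofReal_ne_top]
        congr with w
        rw [← ENNReal.ofReal_mul (by positivity), berKernel, mul_assoc]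
    _ ≤ ENNReal.ofReal (defect z ^ B) * ENNReal.ofReal (C * defect z ^ (-B)) := by
        gcongr; exact h z hz
    _ = _ := by
        rw [← ENNReal.ofReal_mul (by positivity), Real.rpow_neg hdz.le]
        congr 1; field_simp

/-- The integral of `berKernel` over the shadow of `u` is controlled by its value at `u`. -/
lemma lintegral_shadow_berKernel_le {A B : ℝ} (hA : (n : ℝ) < A) (hB : 0 < B) {C₁ : ℝ}
    (hC₁ : 0 < C₁) : ∃ C : ℝ, 0 < C ∧ ∀ z ∈ unitBall n, ∀ u ∈ unitBall n,
      ∫⁻ w, {w | qdist u w * qdist z u ≤ C₁ * defect u * qdist z w}.indicator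
        (fun w => ENNReal.ofReal (berKernel A B z w)) w ∂(invariantVolume n)
          ≤ ENNReal.ofReal (C * berKernel A B z u) := by
  obtain ⟨C, hC, h⟩ := lintegral_invariant_forelliRudin hA hB
  have hn0 : (0 : ℝ) ≤ n := n.cast_nonneg
  refine ⟨C₁ ^ (A + B) * C, by positivity, fun z hz u hu => ?_⟩
  have hdz := defect_pos hz
  have hdu := defect_pos hu
  have hq := qdist_pos hz hu
  set c := defect z ^ B * (C₁ * defect u) ^ (A + B) * qdist z u ^ (-(A + B)) with hc
  have hc0 : 0 < c := by positivity
  calc _ ≤ ∫⁻ w, ENNReal.ofReal c *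
        ENNReal.ofReal (defect w ^ A * qdist u w ^ (-(A + B))) ∂(invariantVolume n) := by
        refine lintegral_mono_ae ?_
        filter_upwards [ae_mem_unitBall] with w hw
        by_cases hS : w ∈ {w | qdist u w * qdist z u ≤ C₁ * defect u * qdist z w}
        · rw [indicator_of_mem hS, ← ENNReal.ofReal_mul hc0.le]
          apply ENNReal.ofReal_le_ofReal
          have hqu := qdist_pos hu hw
          have hqz := qdist_pos hz hw
          have hdw := defect_pos hw
          -- The shadow condition bounds |1-⟨w,z⟩| below, so the pole at z is traded for a pole at
          -- u, and the Forelli-Rudin estimate at u applies.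
          have h1 : (C₁ * defect u * qdist z w) ^ (-(A + B))
              ≤ (qdist u w * qdist z u) ^ (-(A + B)) :=
            Real.rpow_le_rpow_of_nonpos (by positivity) hS (by linarith)
          rw [Real.mul_rpow (by positivity) hqz.le, Real.mul_rpow hqu.le hq.le,
            Real.rpow_neg (by positivity : 0 ≤ C₁ * defect u),
            inv_mul_le_iff₀ (by positivity)] at h1
          rw [berKernel]
          calc _ ≤ defect z ^ B * defect w ^ A * ((C₁ * defect u) ^ (A + B) *
                (qdist u w ^ (-(A + B)) * qdist z u ^ (-(A + B)))) := by gcongr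
            _ = _ := by rw [hc]; ring
        · rw [indicator_of_notMem hS]; exact bot_le
    _ ≤ ENNReal.ofReal c * ENNReal.ofReal (C * defect u ^ (-B)) := by
        rw [lintegral_const_mul' _ _ ENNReal.ofReal_ne_top]
        gcongr; exact h u hu
    _ = _ := by
        rw [← ENNReal.ofReal_mul hc0.le]
        congr 1
        rw [hc, berKernel, Real.mul_rpow hC₁.le hdu.le, Real.rpow_neg hdu.le,
          Real.rpow_add hdu A B]
        field_simp

/-! ### Pointwise control of second moments by local oscillations. -/

/-- Comparison of the invariant volume with the normalized weighted volume on a ball. -/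
lemma setLIntegral_invariantVolume_le {α : ℝ} (hα : -1 < α) {s : ℝ} (hs0 : 0 ≤ s) (hs : s < 1) :
    ∃ C : ℝ, 0 < C ∧ ∀ u ∈ unitBall n, ∀ g : EuclideanSpace ℂ (Fin n) → ENNReal,
      ∫⁻ w in pball u s, g w ∂(invariantVolume n) ≤ ENNReal.ofReal C *
        ((weightedVolume n α (pball u s))⁻¹ *
          ∫⁻ w in pball u s, g w ∂(weightedVolume n α)) := by
  have := isProbabilityMeasure_weightedVolume (n := n) hα
  obtain ⟨C, hC, h⟩ := weightedVolume_pball_le (n := n) (α := α) hs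
  have hw0 := weightConst_ne_zero (n := n) hα
  have hw1 := weightConst_ne_top (n := n) α
  have hwp := ENNReal.toReal_pos hw0 hw1
  have hd : 0 < 1 - s ^ 2 := by nlinarith
  set a := (n : ℝ) + 1 + α with ha
  set K := (4 / (1 - s ^ 2)) ^ |a| with hK
  have hK0 : 0 < K := by positivity
  refine ⟨(weightConst n α).toReal⁻¹ * (C * K), by positivity, fun u hu g => ?_⟩
  have hdu := defect_pos hu
  set v := weightedVolume n α (pball u s) with hv
  -- The ball may be null, for instance when s = 0; its λ-measure then vanishes too, the density
  -- being positive.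
  by_cases hv0 : v = 0
  · have : ∫⁻ w in pball u s, g w ∂(invariantVolume n) = 0 := by
      have h2 : invariantVolume n (pball u s) = 0 := by
        rw [hv, weightedVolume_pball_eq, mul_eq_zero, or_iff_right hw0,
          lintegral_eq_zero_iff (measurable_defect.pow_const _).ennreal_ofReal] at hv0
        have h3 : ∀ᵐ w ∂((invariantVolume n).restrict (pball u s)), False := by
          filter_upwards [hv0, ae_restrict_mem (measurableSet_pball u s)] with w hw1 hw2
          have := defect_pos hw2.1
          simp only [Pi.zero_apply, ENNReal.ofReal_eq_zero] at hw1
          have : 0 < defect w ^ a := by positivity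
          linarith
        simpa [ae_iff] using h3
      exact setLIntegral_measure_zero _ _ h2
    rw [this]; exact bot_le
  have hv1 : v ≠ ⊤ := measure_ne_top _ _
  have hw : (weightConst n α)⁻¹ * ∫⁻ w in pball u s, g w ∂(weightedVolume n α)
      = ∫⁻ w in pball u s, ENNReal.ofReal (defect w ^ a) * g w ∂(invariantVolume n) := by
    rw [setLIntegral_weightedVolume _ (measurableSet_pball u s), ← mul_assoc,
      ENNReal.inv_mul_cancel hw0 hw1, one_mul]
  have key : v * ∫⁻ w in pball u s, g w ∂(invariantVolume n) ≤ ENNReal.ofReal (C * K) *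
      ((weightConst n α)⁻¹ * ∫⁻ w in pball u s, g w ∂(weightedVolume n α)) := by
    rw [hw, ← lintegral_const_mul' _ _ ENNReal.ofReal_ne_top, ← lintegral_const_mul' _ _ hv1]
    refine setLIntegral_mono' (measurableSet_pball u s) fun w hw => ?_
    rw [← mul_assoc]
    gcongr
    refine (h u hu).trans ?_
    rw [← ENNReal.ofReal_mul (by positivity)]
    apply ENNReal.ofReal_le_ofReal
    rw [mul_assoc]
    gcongr
    exact defect_rpow_le hs hw.1 (mem_pball_comm hu hw) a
  rw [mul_comm, ← ENNReal.le_div_iff_mul_le (Or.inl hv0) (Or.inl hv1)] at key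
  refine key.trans_eq ?_
  rw [ENNReal.ofReal_mul (p := (weightConst n α).toReal⁻¹) (by positivity),
    ENNReal.ofReal_inv_of_pos hwp, ENNReal.ofReal_toReal hw1,
    div_eq_mul_inv]
  ring

/-- Integrating the squared deviation from the mean over the centred small ball against
`berKernel` is controlled by the oscillation. -/
lemma lintegral_berKernel_sub_pavg_le (hn : 1 ≤ n) {α : ℝ} (hα : -1 < α) {d : ℝ} (hd : 0 < d)
    (hd1 : 4 * d < 1) (A B : ℝ) : ∃ C : ℝ, 0 < C ∧
      ∀ f : EuclideanSpace ℂ (Fin n) → ℂ, Measurable f → MemLp f 2 (weightedVolume n α) →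
        ∀ z ∈ unitBall n,
          ∫⁻ w, ENNReal.ofReal (berKernel A B z w) * ‖f w - pavg α d f w‖ₑ ^ 2
            ∂(invariantVolume n) ≤ ENNReal.ofReal C *
          ∫⁻ u, ENNReal.ofReal (berKernel A B z u) * posc α (4 * d) f u
            ∂(invariantVolume n) := by
  have := sigmaFinite_invariantVolume (n := n)
  have := isProbabilityMeasure_weightedVolume (n := n) hα
  obtain ⟨K, hK, hmean⟩ := enorm_pavg_sub_pavg_sq_le hn hα hd hd1
  obtain ⟨c, hc, hlow⟩ := invariantVolume_pball_ge hn hd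
  obtain ⟨V, hV, hup⟩ := invariantVolume_pball_le (n := n) (s := d) (by linarith)
  obtain ⟨D, hD, hcmp⟩ := setLIntegral_invariantVolume_le (n := n) hα (s := 4 * d)
    (by linarith) hd1
  obtain ⟨H, hH, hker⟩ := berKernel_le_mul (n := n) (s := d) (by linarith) hd.le A B
  refine ⟨c⁻¹ * (H * (2 * D + 2 * K * V)), by positivity, fun f hfm hf z hz => ?_⟩
  set m := pavg α (4 * d) f with hm
  set M := posc α (4 * d) f with hM
  have hmm : Measurable m := measurable_pavg hα _ hfm
  have hMm : Measurable M := measurable_posc hα _ hfm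
  -- The intermediate value is the mean m(u) at a nearby u. After Tonelli u is fixed, and
  -- integrating |f(w)-m(u)|² over w is controlled by the oscillation at u.
  set G : EuclideanSpace ℂ (Fin n) → EuclideanSpace ℂ (Fin n) → ENNReal := fun w u =>
    2 * ‖f w - m u‖ₑ ^ 2 + 2 * (ENNReal.ofReal K * M u) with hG
  have hsub : ∀ u ∈ unitBall n, ∀ w ∈ pball u d, pball w d ⊆ pball u (4 * d) :=
    fun u hu w hw => pball_subset_pball hu hw.1 hw.2.le (by linarith)
  have hpt : ∀ w ∈ unitBall n, ‖f w - pavg α d f w‖ₑ ^ 2 ≤ ENNReal.ofReal c⁻¹ *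
      ∫⁻ u in pball w d, G w u ∂(invariantVolume n) := by
    intro w hw
    have h1 : ∀ u ∈ pball w d, ‖f w - pavg α d f w‖ₑ ^ 2 ≤ G w u := by
      intro u hu
      refine (enorm_sub_sq_le _ _ (m u)).trans ?_
      change _ ≤ 2 * ‖f w - m u‖ₑ ^ 2 + 2 * (ENNReal.ofReal K * M u)
      gcongr
      exact hmean f hf u hu.1 w hw (hsub u hu.1 w (mem_pball_comm hw hu))
    have h2 : ‖f w - pavg α d f w‖ₑ ^ 2 * ENNReal.ofReal c
        ≤ ∫⁻ u in pball w d, G w u ∂(invariantVolume n) := by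
      calc _ ≤ ‖f w - pavg α d f w‖ₑ ^ 2 * invariantVolume n (pball w d) := by
            gcongr; exact hlow w hw
        _ = ∫⁻ u in pball w d, ‖f w - pavg α d f w‖ₑ ^ 2 ∂(invariantVolume n) := by
            rw [setLIntegral_const]
        _ ≤ _ := setLIntegral_mono' (measurableSet_pball w d) h1
    rw [← ENNReal.le_div_iff_mul_le (Or.inl (ENNReal.ofReal_pos.2 hc).ne')
      (Or.inl ENNReal.ofReal_ne_top)] at h2
    refine h2.trans_eq ?_
    rw [ENNReal.ofReal_inv_of_pos hc, div_eq_mul_inv, mul_comm]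
  have hGm : Measurable fun p : EuclideanSpace ℂ (Fin n) × EuclideanSpace ℂ (Fin n) =>
      {p : EuclideanSpace ℂ (Fin n) × EuclideanSpace ℂ (Fin n) | p.2 ∈ pball p.1 d}.indicator
        (fun p => ENNReal.ofReal (berKernel A B z p.1) * G p.1 p.2) p := by
    refine Measurable.indicator ?_ (measurableSet_pball_prod d)
    have hk1 : Measurable fun w => berKernel A B z w := measurable_berKernel_right A B z
    have h1 : Measurable fun p : EuclideanSpace ℂ (Fin n) × EuclideanSpace ℂ (Fin n) =>
        ‖f p.1 - m p.2‖ₑ ^ 2 :=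
      ((hfm.comp measurable_fst).sub (hmm.comp measurable_snd)).enorm.pow_const 2
    have h2 : Measurable fun p : EuclideanSpace ℂ (Fin n) × EuclideanSpace ℂ (Fin n) =>
        ENNReal.ofReal K * M p.2 := (hMm.comp measurable_snd).const_mul _
    have h3 : Measurable fun p : EuclideanSpace ℂ (Fin n) × EuclideanSpace ℂ (Fin n) =>
        ENNReal.ofReal (berKernel A B z p.1) := (hk1.comp measurable_fst).ennreal_ofReal
    exact h3.mul ((h1.const_mul 2).add (h2.const_mul 2))
  calc ∫⁻ w, ENNReal.ofReal (berKernel A B z w) * ‖f w - pavg α d f w‖ₑ ^ 2 ∂(invariantVolume n)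
      ≤ ∫⁻ w, ENNReal.ofReal c⁻¹ * ∫⁻ u, {p : EuclideanSpace ℂ (Fin n) ×
          EuclideanSpace ℂ (Fin n) | p.2 ∈ pball p.1 d}.indicator
          (fun p => ENNReal.ofReal (berKernel A B z p.1) * G p.1 p.2) (w, u)
          ∂(invariantVolume n) ∂(invariantVolume n) := by
        refine lintegral_mono_ae ?_
        filter_upwards [ae_mem_unitBall] with w hw
        calc _ ≤ ENNReal.ofReal (berKernel A B z w) * (ENNReal.ofReal c⁻¹ *
              ∫⁻ u in pball w d, G w u ∂(invariantVolume n)) := by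
              gcongr; exact hpt w hw
          _ = ENNReal.ofReal c⁻¹ * ∫⁻ u in pball w d, ENNReal.ofReal (berKernel A B z w) * G w u
                ∂(invariantVolume n) := by
              rw [lintegral_const_mul' _ _ ENNReal.ofReal_ne_top]; ring
          _ = _ := by rw [← lintegral_indicator (measurableSet_pball w d)]; rfl
    _ = ENNReal.ofReal c⁻¹ * ∫⁻ u, ∫⁻ w, {p : EuclideanSpace ℂ (Fin n) ×
          EuclideanSpace ℂ (Fin n) | p.2 ∈ pball p.1 d}.indicator
          (fun p => ENNReal.ofReal (berKernel A B z p.1) * G p.1 p.2) (w, u)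
          ∂(invariantVolume n) ∂(invariantVolume n) := by
        rw [lintegral_const_mul' _ _ ENNReal.ofReal_ne_top, lintegral_lintegral_swap]
        exact hGm.aemeasurable
    _ ≤ ENNReal.ofReal c⁻¹ * ∫⁻ u, ENNReal.ofReal (H * (2 * D + 2 * K * V)) *
          (ENNReal.ofReal (berKernel A B z u) * M u) ∂(invariantVolume n) := by
        refine mul_le_mul_right (lintegral_mono_ae ?_) _
        filter_upwards [ae_mem_unitBall] with u hu
        have hkpos := berKernel_pos A B hz hu
        calc _ ≤ ∫⁻ w, (pball u d).indicator (fun w =>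
              ENNReal.ofReal (H * berKernel A B z u) * G w u) w ∂(invariantVolume n) := by
              refine lintegral_mono_ae ?_
              filter_upwards [ae_mem_unitBall] with w hw
              by_cases hwu : u ∈ pball w d
              · have hwu' := mem_pball_comm hw hwu
                rw [indicator_of_mem (show (w, u) ∈ {p : EuclideanSpace ℂ (Fin n) ×
                  EuclideanSpace ℂ (Fin n) | p.2 ∈ pball p.1 d} from hwu), indicator_of_mem hwu']
                gcongr
                exact hker z hz u hu w hwu'
              · rw [indicator_of_notMem (show (w, u) ∉ {p : EuclideanSpace ℂ (Fin n) ×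
                  EuclideanSpace ℂ (Fin n) | p.2 ∈ pball p.1 d} from hwu)]
                exact bot_le
          _ = ENNReal.ofReal (H * berKernel A B z u) *
                (2 * ∫⁻ w in pball u d, ‖f w - m u‖ₑ ^ 2 ∂(invariantVolume n)
                  + 2 * (ENNReal.ofReal K * M u) * invariantVolume n (pball u d)) := by
              rw [lintegral_indicator (measurableSet_pball u d),
                lintegral_const_mul' _ _ ENNReal.ofReal_ne_top]
              congr 1
              rw [hG]
              simp only
              rw [lintegral_add_right _ measurable_const, lintegral_const_mul' _ _ (by norm_num),
                setLIntegral_const]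
          _ ≤ ENNReal.ofReal (H * berKernel A B z u) *
                (2 * (ENNReal.ofReal D * M u) + 2 * (ENNReal.ofReal K * M u) * ENNReal.ofReal V) := by
              gcongr
              · refine (lintegral_mono_set ?_).trans (hcmp u hu _)
                exact fun w hw => ⟨hw.1, hw.2.trans (by linarith)⟩
              · exact hup u hu
          _ = _ := by
              rw [ENNReal.ofReal_mul hH.le, ENNReal.ofReal_mul hH.le,
                ENNReal.ofReal_add (by positivity) (by positivity), ENNReal.ofReal_mul (by norm_num),
                ENNReal.ofReal_mul (by positivity), ENNReal.ofReal_mul (by norm_num),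
                ENNReal.ofReal_ofNat]
              ring
    _ = _ := by
        rw [lintegral_const_mul' _ _ ENNReal.ofReal_ne_top, ← mul_assoc,
          ← ENNReal.ofReal_mul (by positivity)]

/-- Integrating the squared difference of means against `berKernel`. -/
lemma lintegral_berKernel_pavg_sub_pavg_le (hn : 1 ≤ n) {α : ℝ} (hα : -1 < α) {d : ℝ} (hd : 0 < d)
    (hd1 : 4 * d < 1) {A B ε : ℝ} (hA : (n : ℝ) < A) (hB : 0 < B) (hε : 0 < ε) :
    ∃ C : ℝ, 0 < C ∧
      ∀ f : EuclideanSpace ℂ (Fin n) → ℂ, Measurable f → MemLp f 2 (weightedVolume n α) →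
        ∀ z ∈ unitBall n,
          ∫⁻ w, ENNReal.ofReal (berKernel A B z w) * ‖pavg α d f w - pavg α d f z‖ₑ ^ 2
            ∂(invariantVolume n) ≤ ENNReal.ofReal C *
          ∫⁻ u, ENNReal.ofReal (berKernel (A - ε) (B - ε) z u) * posc α (4 * d) f u
            ∂(invariantVolume n) := by
  have := sigmaFinite_invariantVolume (n := n)
  obtain ⟨C, hC, C₁, hC₁, hchain⟩ := enorm_pavg_sub_pavg_sq_le_shadow hn hα hd hd1 hε
  obtain ⟨D, hD, hshadow⟩ := lintegral_shadow_berKernel_le (n := n) hA hB hC₁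
  refine ⟨C * D, by positivity, fun f hfm hf z hz => ?_⟩
  set M := posc α (4 * d) f with hM
  have hMm : Measurable M := measurable_posc hα _ hfm
  set Y : EuclideanSpace ℂ (Fin n) → ENNReal := fun u =>
    ENNReal.ofReal ((defect z * defect u / qdist z u ^ 2) ^ (-ε)) * M u with hY
  have hqz : Measurable fun u : EuclideanSpace ℂ (Fin n) => qdist z u :=
    measurable_qdist measurable_const measurable_id
  have hYm : Measurable Y :=
    ((((measurable_defect.const_mul _).div (hqz.pow_const 2)).pow_const _).ennreal_ofReal).mul hMm
  -- The shadow relation as a subset of the product: for fixed w it is the domain of the chain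
  -- estimate, for fixed u it is the shadow of u.
  set S : Set (EuclideanSpace ℂ (Fin n) × EuclideanSpace ℂ (Fin n)) :=
    {p | qdist p.2 p.1 * qdist z p.2 ≤ C₁ * defect p.2 * qdist z p.1} with hS
  have hSm : MeasurableSet S := measurableSet_le
    ((measurable_qdist measurable_snd measurable_fst).mul (hqz.comp measurable_snd))
    (((measurable_defect.comp measurable_snd).const_mul _).mul (hqz.comp measurable_fst))
  have hk1 : Measurable fun w => ENNReal.ofReal (berKernel A B z w) :=
    (measurable_berKernel_right A B z).ennreal_ofReal
  have hint : Measurable fun p : EuclideanSpace ℂ (Fin n) × EuclideanSpace ℂ (Fin n) =>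
      S.indicator (fun p => ENNReal.ofReal (berKernel A B z p.1) * Y p.2) p :=
    ((hk1.comp measurable_fst).mul (hYm.comp measurable_snd)).indicator hSm
  calc _ ≤ ∫⁻ w, ENNReal.ofReal C * ∫⁻ u, S.indicator
          (fun p => ENNReal.ofReal (berKernel A B z p.1) * Y p.2) (w, u)
          ∂(invariantVolume n) ∂(invariantVolume n) := by
        refine lintegral_mono_ae ?_
        filter_upwards [ae_mem_unitBall] with w hw
        refine (mul_le_mul_right (hchain f hf z hz w hw) _).trans_eq ?_
        rw [← mul_assoc, mul_comm _ (ENNReal.ofReal C), mul_assoc,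
          ← lintegral_const_mul' _ _ ENNReal.ofReal_ne_top]
        congr 2 with u
        by_cases hu : (w, u) ∈ S
        · rw [indicator_of_mem hu, indicator_of_mem (show u ∈ {u | qdist u w * qdist z u
            ≤ C₁ * defect u * qdist z w} from hu)]
        · rw [indicator_of_notMem hu, indicator_of_notMem (show u ∉ {u | qdist u w * qdist z u
            ≤ C₁ * defect u * qdist z w} from hu), mul_zero]
    _ = ENNReal.ofReal C * ∫⁻ u, ∫⁻ w, S.indicator
          (fun p => ENNReal.ofReal (berKernel A B z p.1) * Y p.2) (w, u)
          ∂(invariantVolume n) ∂(invariantVolume n) := by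
        rw [lintegral_const_mul' _ _ ENNReal.ofReal_ne_top, lintegral_lintegral_swap]
        exact hint.aemeasurable
    _ ≤ ENNReal.ofReal C * ∫⁻ u, ENNReal.ofReal D *
          (ENNReal.ofReal (berKernel (A - ε) (B - ε) z u) * M u) ∂(invariantVolume n) := by
        refine mul_le_mul_right (lintegral_mono_ae ?_) _
        filter_upwards [ae_mem_unitBall] with u hu
        have hkpos := berKernel_pos A B hz hu
        have hmeas : Measurable ({w | qdist u w * qdist z u ≤ C₁ * defect u * qdist z w}.indicator
            (fun w => ENNReal.ofReal (berKernel A B z w))) := by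
          refine hk1.indicator (measurableSet_le ?_ ?_)
          · exact (measurable_qdist measurable_const measurable_id).mul_const _
          · exact hqz.const_mul _
        calc _ = ∫⁻ w, {w | qdist u w * qdist z u ≤ C₁ * defect u * qdist z w}.indicator
              (fun w => ENNReal.ofReal (berKernel A B z w)) w * Y u ∂(invariantVolume n) := by
              congr with w
              by_cases hu : (w, u) ∈ S
              · rw [indicator_of_mem hu, indicator_of_mem (show w ∈ {w | qdist u w * qdist z u
                  ≤ C₁ * defect u * qdist z w} from hu)]
              · rw [indicator_of_notMem hu, indicator_of_notMem (show w ∉ {w | qdist u w * qdist z u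
                  ≤ C₁ * defect u * qdist z w} from hu), zero_mul]
          _ ≤ ENNReal.ofReal (D * berKernel A B z u) * Y u := by
              rw [lintegral_mul_const _ hmeas]
              gcongr; exact hshadow z hz u hu
          _ = _ := by
              rw [hY, ← berKernel_mul_rpow A B ε hz hu, ENNReal.ofReal_mul hD.le,
                ENNReal.ofReal_mul hkpos.le]
              ring
    _ = _ := by
        rw [lintegral_const_mul' _ _ ENNReal.ofReal_ne_top, ← mul_assoc,
          ← ENNReal.ofReal_mul (by positivity)]

/-- The pointwise estimate of the global oscillation by local oscillations. -/
lemma lintegral_berKernel_sub_pavg_centre_le (hn : 1 ≤ n) {α : ℝ} (hα : -1 < α) {d : ℝ}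
    (hd : 0 < d) (hd1 : 4 * d < 1) {A B ε : ℝ} (hA : (n : ℝ) < A) (hB : 0 < B) (hε : 0 < ε) :
    ∃ C : ℝ, 0 < C ∧
      ∀ f : EuclideanSpace ℂ (Fin n) → ℂ, Measurable f → MemLp f 2 (weightedVolume n α) →
        ∀ z ∈ unitBall n,
          ∫⁻ w, ENNReal.ofReal (berKernel A B z w) * ‖f w - pavg α d f z‖ₑ ^ 2
            ∂(invariantVolume n) ≤ ENNReal.ofReal C *
          ∫⁻ u, ENNReal.ofReal (berKernel (A - ε) (B - ε) z u) * posc α (4 * d) f u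
            ∂(invariantVolume n) := by
  obtain ⟨C, hC, h1⟩ := lintegral_berKernel_sub_pavg_le hn hα hd hd1 A B
  obtain ⟨C', hC', h2⟩ := lintegral_berKernel_pavg_sub_pavg_le hn hα hd hd1 hA hB hε
  refine ⟨2 * C + 2 * C', by positivity, fun f hfm hf z hz => ?_⟩
  have hk1 : Measurable fun w => ENNReal.ofReal (berKernel A B z w) :=
    (measurable_berKernel_right A B z).ennreal_ofReal
  have hpm := measurable_pavg hα d hfm
  have hm1 : Measurable fun w => ENNReal.ofReal (berKernel A B z w) *
      ‖f w - pavg α d f w‖ₑ ^ 2 := hk1.mul ((hfm.sub hpm).enorm.pow_const 2)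
  set J := ∫⁻ u, ENNReal.ofReal (berKernel (A - ε) (B - ε) z u) * posc α (4 * d) f u
            ∂(invariantVolume n) with hJ
  calc _ ≤ ∫⁻ w, (2 * (ENNReal.ofReal (berKernel A B z w) * ‖f w - pavg α d f w‖ₑ ^ 2)
          + 2 * (ENNReal.ofReal (berKernel A B z w) * ‖pavg α d f w - pavg α d f z‖ₑ ^ 2))
          ∂(invariantVolume n) := by
        refine lintegral_mono fun w => ?_
        refine (mul_le_mul_right (enorm_sub_sq_le _ _ (pavg α d f w)) _).trans_eq ?_
        rw [← neg_sub (pavg α d f w) (pavg α d f z), enorm_neg]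
        ring
    _ = 2 * ∫⁻ w, ENNReal.ofReal (berKernel A B z w) * ‖f w - pavg α d f w‖ₑ ^ 2
          ∂(invariantVolume n)
        + 2 * ∫⁻ w, ENNReal.ofReal (berKernel A B z w) * ‖pavg α d f w - pavg α d f z‖ₑ ^ 2
          ∂(invariantVolume n) := by
        rw [lintegral_add_left (hm1.const_mul 2), lintegral_const_mul' _ _ (by norm_num),
          lintegral_const_mul' _ _ (by norm_num)]
    _ ≤ 2 * (ENNReal.ofReal C * J) + 2 * (ENNReal.ofReal C' * J) := by
        gcongr
        · refine (h1 f hfm hf z hz).trans ?_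
          refine mul_le_mul_right (lintegral_mono_ae ?_) _
          filter_upwards [ae_mem_unitBall] with u hu
          gcongr
          exact berKernel_le_berKernel_sub A B hε.le hz hu
        · exact h2 f hfm hf z hz
    _ = _ := by
        rw [ENNReal.ofReal_add (by positivity) (by positivity), ENNReal.ofReal_mul (by norm_num),
          ENNReal.ofReal_mul (by norm_num), ENNReal.ofReal_ofNat]
        ring

/-! ### Boundedness of the kernel operators in L^q. -/

/-- Boundedness of the integral operator with kernel `berKernel` on `L^q`, `q ≥ 1`. -/
lemma lintegral_rpow_berKernel_le_of_one_le {A B q : ℝ} (hA : (n : ℝ) < A) (hB : (n : ℝ) < B)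
    (hq : 1 ≤ q) : ∃ C : ℝ, 0 < C ∧ ∀ O : EuclideanSpace ℂ (Fin n) → ENNReal, Measurable O →
      ∫⁻ z, (∫⁻ u, ENNReal.ofReal (berKernel A B z u) * O u ∂(invariantVolume n)) ^ q
        ∂(invariantVolume n) ≤ ENNReal.ofReal C * ∫⁻ u, O u ^ q ∂(invariantVolume n) := by
  have := sigmaFinite_invariantVolume (n := n)
  have hn0 : (0 : ℝ) ≤ n := n.cast_nonneg
  obtain ⟨C, hC, h1⟩ := lintegral_berKernel_le (n := n) hA (by linarith : 0 < B)
  obtain ⟨D, hD, h2⟩ := lintegral_berKernel_le (n := n) hB (by linarith : 0 < A)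
  refine ⟨C ^ (q - 1) * D, by positivity, fun O hO => ?_⟩
  have hOq : Measurable fun u => O u ^ q := hO.pow_const q
  have hz : ∀ z ∈ unitBall n,
      (∫⁻ u, ENNReal.ofReal (berKernel A B z u) * O u ∂(invariantVolume n)) ^ q
        ≤ ENNReal.ofReal (C ^ (q - 1)) *
          ∫⁻ u, ENNReal.ofReal (berKernel A B z u) * O u ^ q ∂(invariantVolume n) := by
    intro z hz
    have hk : Measurable fun u => ENNReal.ofReal (berKernel A B z u) :=
      (measurable_berKernel_right A B z).ennreal_ofReal
    -- This measure has mass bounded uniformly in z, so Jensen moves the power q onto O.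
    set μ := (invariantVolume n).withDensity fun u => ENNReal.ofReal (berKernel A B z u) with hμ
    have hμu : μ univ ≤ ENNReal.ofReal C := by
      rw [hμ, withDensity_apply _ MeasurableSet.univ, Measure.restrict_univ]; exact h1 z hz
    have e : ∀ g : EuclideanSpace ℂ (Fin n) → ENNReal, Measurable g → ∫⁻ u, g u ∂μ
        = ∫⁻ u, ENNReal.ofReal (berKernel A B z u) * g u ∂(invariantVolume n) := fun g hg =>
      lintegral_withDensity_eq_lintegral_mul _ hk hg
    rw [← e O hO, ← e _ hOq]
    refine (rpow_lintegral_le hO.aemeasurable hq).trans ?_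
    rw [← ENNReal.ofReal_rpow_of_pos hC]
    have : 0 ≤ q - 1 := by linarith
    gcongr
  have hm : Measurable fun p : EuclideanSpace ℂ (Fin n) × EuclideanSpace ℂ (Fin n) =>
      ENNReal.ofReal (berKernel A B p.1 p.2) * O p.2 ^ q :=
    (measurable_berKernel A B).ennreal_ofReal.mul (hOq.comp measurable_snd)
  calc _ ≤ ∫⁻ z, ENNReal.ofReal (C ^ (q - 1)) *
          ∫⁻ u, ENNReal.ofReal (berKernel A B z u) * O u ^ q ∂(invariantVolume n)
          ∂(invariantVolume n) := by
        refine lintegral_mono_ae ?_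
        filter_upwards [ae_mem_unitBall] with z hz' using hz z hz'
    _ = ENNReal.ofReal (C ^ (q - 1)) * ∫⁻ u,
          ∫⁻ z, ENNReal.ofReal (berKernel A B z u) * O u ^ q ∂(invariantVolume n)
          ∂(invariantVolume n) := by
        rw [lintegral_const_mul' _ _ ENNReal.ofReal_ne_top, lintegral_lintegral_swap]
        exact hm.aemeasurable
    _ ≤ ENNReal.ofReal (C ^ (q - 1)) * ∫⁻ u, ENNReal.ofReal D * O u ^ q ∂(invariantVolume n) := by
        refine mul_le_mul_right (lintegral_mono_ae ?_) _
        filter_upwards [ae_mem_unitBall] with u hu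
        simp_rw [berKernel_comm A B _ u]
        rw [lintegral_mul_const _ (measurable_berKernel_right B A u).ennreal_ofReal]
        gcongr
        exact h2 u hu
    _ = _ := by
        rw [lintegral_const_mul' _ _ ENNReal.ofReal_ne_top, ← mul_assoc,
          ← ENNReal.ofReal_mul (by positivity)]

/-- For `q < 1` the integral operator with kernel `berKernel` satisfies an `L^q` bound on functions
that are locally dominated. -/
lemma lintegral_rpow_berKernel_le_of_lt_one (hn : 1 ≤ n) {A B q s : ℝ} (hA : 0 < A)
    (hB : (n : ℝ) < B * q) (hq0 : 0 < q) (hq : q < 1) (hs0 : 0 < s) (hs : s < 1) :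
    ∃ C : ℝ, 0 < C ∧ ∀ O N : EuclideanSpace ℂ (Fin n) → ENNReal, Measurable N →
      (∀ u ∈ unitBall n, ∀ v ∈ pball u s, O u ≤ N v) →
      ∫⁻ z, (∫⁻ u, ENNReal.ofReal (berKernel A B z u) * O u ∂(invariantVolume n)) ^ q
        ∂(invariantVolume n) ≤ ENNReal.ofReal C * ∫⁻ u, N u ^ q ∂(invariantVolume n) := by
  have := sigmaFinite_invariantVolume (n := n)
  obtain ⟨K, hK, hker⟩ := berKernel_le_mul (n := n) hs hs0.le A B
  obtain ⟨c, hc, hvol⟩ := invariantVolume_pball_ge hn hs0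
  obtain ⟨D, hD, h2⟩ := lintegral_berKernel_le (n := n) hB (by positivity : 0 < A * q)
  refine ⟨(K ^ q / c) ^ (1 - q) * D, by positivity, fun O N hN hON => ?_⟩
  have hNq : Measurable fun u => N u ^ q := hN.pow_const q
  have hz : ∀ z ∈ unitBall n,
      (∫⁻ u, ENNReal.ofReal (berKernel A B z u) * O u ∂(invariantVolume n)) ^ q
        ≤ ENNReal.ofReal ((K ^ q / c) ^ (1 - q)) *
          ∫⁻ u, ENNReal.ofReal (berKernel (A * q) (B * q) z u) * N u ^ q ∂(invariantVolume n) := by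
    intro z hz
    set J := ∫⁻ u, ENNReal.ofReal (berKernel (A * q) (B * q) z u) * N u ^ q
      ∂(invariantVolume n) with hJ
    have hkm : Measurable fun u => ENNReal.ofReal (berKernel (A * q) (B * q) z u) * N u ^ q :=
      (measurable_berKernel_right _ _ z).ennreal_ofReal.mul hNq
    have hkq : ∀ u ∈ unitBall n, ∀ x : ENNReal, (ENNReal.ofReal (berKernel A B z u) * x) ^ q
        = ENNReal.ofReal (berKernel (A * q) (B * q) z u) * x ^ q := by
      intro u hu x
      rw [ENNReal.mul_rpow_of_nonneg _ _ hq0.le, ENNReal.ofReal_rpow_of_pos (berKernel_pos A B hz hu),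
        berKernel_rpow A B q hz hu]
    -- Replacement for the embedding of little ℓ^q into ℓ^1: local domination of O by N,
    -- near-constancy of the kernel and the lower bound for the mass of balls bound each value by
    -- the full integral J.
    have hsup : ∀ u ∈ unitBall n, (ENNReal.ofReal (berKernel A B z u) * O u) ^ q
        ≤ ENNReal.ofReal (K ^ q / c) * J := by
      intro u hu
      have h3 : ∀ v ∈ pball u s, (ENNReal.ofReal (berKernel A B z u) * O u) ^ q
          ≤ ENNReal.ofReal (K ^ q) *
            (ENNReal.ofReal (berKernel (A * q) (B * q) z v) * N v ^ q) := by
        intro v hv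
        rw [← hkq v hv.1, ← ENNReal.ofReal_rpow_of_pos hK, ← ENNReal.mul_rpow_of_nonneg _ _ hq0.le]
        refine ENNReal.rpow_le_rpow ?_ hq0.le
        rw [← mul_assoc, ← ENNReal.ofReal_mul hK.le]
        gcongr
        · exact hker z hz v hv.1 u (mem_pball_comm hu hv)
        · exact hON u hu v hv
      have h4 : (ENNReal.ofReal (berKernel A B z u) * O u) ^ q * ENNReal.ofReal c
          ≤ ENNReal.ofReal (K ^ q) * J := by
        calc _ ≤ (ENNReal.ofReal (berKernel A B z u) * O u) ^ q * invariantVolume n (pball u s) := by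
              gcongr; exact hvol u hu
          _ = ∫⁻ v in pball u s, (ENNReal.ofReal (berKernel A B z u) * O u) ^ q
                ∂(invariantVolume n) := by rw [setLIntegral_const]
          _ ≤ ∫⁻ v in pball u s, ENNReal.ofReal (K ^ q) *
                (ENNReal.ofReal (berKernel (A * q) (B * q) z v) * N v ^ q) ∂(invariantVolume n) :=
              setLIntegral_mono' (measurableSet_pball u s) h3
          _ ≤ _ := by
              rw [lintegral_const_mul' _ _ ENNReal.ofReal_ne_top]
              gcongr
              exact setLIntegral_le_lintegral _ _
      rw [← ENNReal.le_div_iff_mul_le (Or.inl (ENNReal.ofReal_pos.2 hc).ne')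
        (Or.inl ENNReal.ofReal_ne_top)] at h4
      refine h4.trans_eq ?_
      rw [ENNReal.ofReal_div_of_pos hc, div_eq_mul_inv, div_eq_mul_inv]
      ring
    have hq1 : 0 ≤ (1 - q) / q := div_nonneg (by linarith) hq0.le
    -- With H = kernel · O, write H = (H^q)^((1-q)/q) · H^q, bound the first factor by its supremum
    -- and integrate the second; the q-th power is then linear in J.
    have hint : ∫⁻ u, ENNReal.ofReal (berKernel A B z u) * O u ∂(invariantVolume n)
        ≤ (ENNReal.ofReal (K ^ q / c) * J) ^ ((1 - q) / q) * J := by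
      rw [hJ, ← lintegral_const_mul _ hkm]
      refine lintegral_mono_ae ?_
      filter_upwards [ae_mem_unitBall] with u hu
      set H := ENNReal.ofReal (berKernel A B z u) * O u with hH
      have e1 : H = (H ^ q) ^ ((1 - q) / q) * H ^ q := by
        rw [← ENNReal.rpow_mul, ← ENNReal.rpow_add_of_nonneg _ _ (by positivity) hq0.le]
        rw [mul_div_cancel₀ _ hq0.ne', sub_add_cancel, ENNReal.rpow_one]
      rw [e1]
      gcongr
      · exact hsup u hu
      · rw [hH, hkq u hu]
        gcongr
        exact hON u hu u (mem_pball_self hu hs0)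
    calc _ ≤ ((ENNReal.ofReal (K ^ q / c) * J) ^ ((1 - q) / q) * J) ^ q := by gcongr
      _ = _ := by
          rw [ENNReal.mul_rpow_of_nonneg _ _ hq0.le, ← ENNReal.rpow_mul, div_mul_cancel₀ _ hq0.ne',
            ENNReal.mul_rpow_of_nonneg _ _ (by linarith), mul_assoc,
            ← ENNReal.rpow_add_of_nonneg _ _ (by linarith) hq0.le, sub_add_cancel,
            ENNReal.rpow_one, ENNReal.ofReal_rpow_of_pos (by positivity)]
  have hm : Measurable fun p : EuclideanSpace ℂ (Fin n) × EuclideanSpace ℂ (Fin n) =>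
      ENNReal.ofReal (berKernel (A * q) (B * q) p.1 p.2) * N p.2 ^ q :=
    (measurable_berKernel _ _).ennreal_ofReal.mul (hNq.comp measurable_snd)
  calc _ ≤ ∫⁻ z, ENNReal.ofReal ((K ^ q / c) ^ (1 - q)) *
          ∫⁻ u, ENNReal.ofReal (berKernel (A * q) (B * q) z u) * N u ^ q ∂(invariantVolume n)
          ∂(invariantVolume n) := by
        refine lintegral_mono_ae ?_
        filter_upwards [ae_mem_unitBall] with z hz' using hz z hz'
    _ = ENNReal.ofReal ((K ^ q / c) ^ (1 - q)) * ∫⁻ u,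
          ∫⁻ z, ENNReal.ofReal (berKernel (A * q) (B * q) z u) * N u ^ q ∂(invariantVolume n)
          ∂(invariantVolume n) := by
        rw [lintegral_const_mul' _ _ ENNReal.ofReal_ne_top, lintegral_lintegral_swap]
        exact hm.aemeasurable
    _ ≤ ENNReal.ofReal ((K ^ q / c) ^ (1 - q)) *
          ∫⁻ u, ENNReal.ofReal D * N u ^ q ∂(invariantVolume n) := by
        refine mul_le_mul_right (lintegral_mono_ae ?_) _
        filter_upwards [ae_mem_unitBall] with u hu
        -- Integration in the first variable exchanges the roles of the exponents, which is why Bq >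
        -- n is the condition.
        simp_rw [berKernel_comm (A * q) (B * q) _ u]
        rw [lintegral_mul_const _ (measurable_berKernel_right _ _ u).ennreal_ofReal]
        gcongr
        exact h2 u hu
    _ = _ := by
        rw [lintegral_const_mul' _ _ ENNReal.ofReal_ne_top, ← mul_assoc,
          ← ENNReal.ofReal_mul (by positivity)]

/-! ### Bergman balls, local and global mean oscillation in terms of the kernels. -/

lemma tanh_pos {r : ℝ} (hr : 0 < r) : 0 < Real.tanh r := by
  rw [Real.tanh_eq_sinh_div_cosh]
  exact div_pos (Real.sinh_pos_iff.2 hr) (Real.cosh_pos r)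

/-- The Bergman distance is artanh of the pseudo-hyperbolic distance. -/
lemma bergmanBall_eq_pball {z : EuclideanSpace ℂ (Fin n)} (hz : z ∈ unitBall n) (r : ℝ) :
    bergmanBall z r = pball z (Real.tanh r) := by
  ext w
  refine and_congr_right fun hw => ?_
  have h1 : ‖moebius z w‖ < 1 := mem_unitBall.1 (moebius_mem hz hw)
  have h0 := norm_nonneg (moebius z w)
  have hm : ‖moebius z w‖ ∈ Ioo (-1 : ℝ) 1 := ⟨by linarith, h1⟩
  have ht : Real.tanh r ∈ Ioo (-1 : ℝ) 1 := ⟨Real.neg_one_lt_tanh r, Real.tanh_lt_one r⟩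
  rw [pdist, ← Real.artanh_lt_artanh_iff hm ht, Real.artanh_tanh,
    Real.artanh_eq_half_log (Ioo_subset_Icc_self hm), bergmanDist]

lemma ofReal_localMO_rpow (hn : 1 ≤ n) {α : ℝ} (hα : -1 < α) {r : ℝ} (hr : 0 < r) {p : ℝ}
    (hp : 0 < p) {f : EuclideanSpace ℂ (Fin n) → ℂ} (hf : MemLp f 2 (weightedVolume n α))
    {z : EuclideanSpace ℂ (Fin n)} (hz : z ∈ unitBall n) :
    ENNReal.ofReal (localMO α r f z ^ p) = posc α (Real.tanh r) f z ^ (p / 2) := by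
  have := isProbabilityMeasure_weightedVolume (n := n) hα
  have hs : 0 < Real.tanh r := tanh_pos hr
  have h0 := weightedVolume_pball_ne_zero hn hα hs hz
  have hm : localMean α r f z = pavg α (Real.tanh r) f z := by
    rw [localMean, pavg, bergmanBall_eq_pball hz]
  rw [localMO, bergmanBall_eq_pball hz, hm]
  set m := pavg α (Real.tanh r) f z with hmdef
  have hi : Integrable (fun w => ‖f w - m‖ ^ 2) (weightedVolume n α) :=
    ((hf.sub (memLp_const m)).integrable_norm_pow (by norm_num))
  have hi' : Integrable (fun w => ‖f w - m‖ ^ 2)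
      ((weightedVolume n α (pball z (Real.tanh r)))⁻¹ •
        (weightedVolume n α).restrict (pball z (Real.tanh r))) :=
    hi.restrict.smul_measure (ENNReal.inv_ne_top.2 h0)
  have hx : ENNReal.ofReal (⨍ w in pball z (Real.tanh r), ‖f w - m‖ ^ 2 ∂(weightedVolume n α))
      = posc α (Real.tanh r) f z := by
    rw [setAverage_eq', ofReal_integral_eq_lintegral_ofReal hi'
      (Filter.Eventually.of_forall fun w => by positivity), lintegral_smul_measure, posc, setOsc,
      smul_eq_mul]
    congr 2 with w
    rw [ENNReal.ofReal_pow (norm_nonneg _), ofReal_norm]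
    rfl
  rw [← hx, Real.sqrt_eq_rpow, ← Real.rpow_mul, ← ENNReal.ofReal_rpow_of_nonneg _ (by positivity)]
  · congr 1; ring
  all_goals
    rw [setAverage_eq']
    exact integral_nonneg fun w => by positivity

lemma norm_kernelK (α t : ℝ) (z w : EuclideanSpace ℂ (Fin n)) :
    ‖kernelK α t z w‖ = qdist z w ^ (-((n : ℝ) + 1 + α + t)) := by
  rw [kernelK, norm_div, norm_one, Complex.norm_cpow_real, qdist, Real.rpow_neg (norm_nonneg _),
    one_div]

lemma measurable_kernelK (α t : ℝ) (z : EuclideanSpace ℂ (Fin n)) :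
    Measurable (kernelK α t z) := by
  have h : Measurable fun w : EuclideanSpace ℂ (Fin n) => cdot w z :=
    (continuous_cdot_comp continuous_id continuous_const).measurable
  exact measurable_const.div ((measurable_const.sub h).pow_const _)

lemma ae_weightedVolume_mem_unitBall (α : ℝ) : ∀ᵐ w ∂(weightedVolume n α), w ∈ unitBall n := by
  refine Measure.ae_smul_measure ?_ _
  refine (withDensity_absolutelyContinuous _ _).ae_le ?_
  refine Measure.ae_smul_measure ?_ _
  exact ae_restrict_mem measurableSet_unitBall

/-- For fixed z the kernel is bounded in w, which suffices for all integrability questions. -/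
lemma norm_kernelK_le {α t : ℝ} (hα : -1 < α) (ht : 0 ≤ t) {z w : EuclideanSpace ℂ (Fin n)}
    (hz : z ∈ unitBall n) (hw : w ∈ unitBall n) :
    ‖kernelK α t z w‖ ≤ (defect z / 2) ^ (-((n : ℝ) + 1 + α + t)) := by
  have hn0 : (0 : ℝ) ≤ n := n.cast_nonneg
  have := defect_pos hz
  have := defect_le_two_mul_qdist (z := z) hw
  rw [norm_kernelK]
  exact Real.rpow_le_rpow_of_nonpos (by positivity) (by linarith) (by linarith)

lemma integrable_norm_kernelK_sq {α t : ℝ} (hα : -1 < α) (ht : 0 ≤ t)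
    {z : EuclideanSpace ℂ (Fin n)} (hz : z ∈ unitBall n) :
    Integrable (fun w => ‖kernelK α t z w‖ ^ 2) (weightedVolume n α) := by
  have := isProbabilityMeasure_weightedVolume (n := n) hα
  refine Integrable.of_bound
    (((measurable_kernelK α t z).norm.pow_const 2).aestronglyMeasurable)
    (((defect z / 2) ^ (-((n : ℝ) + 1 + α + t))) ^ 2) ?_
  filter_upwards [ae_weightedVolume_mem_unitBall α] with w hw
  rw [Real.norm_of_nonneg (by positivity)]
  gcongr
  exact norm_kernelK_le hα ht hz hw

/-- Lower bound for the norms of the kernels. -/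
lemma kernelNorm_sq_ge (hn : 1 ≤ n) {α t : ℝ} (hα : -1 < α) (ht : 0 ≤ t) : ∃ c : ℝ, 0 < c ∧
    ∀ z ∈ unitBall n, c * defect z ^ (-((n : ℝ) + 1 + α + 2 * t)) ≤ kernelNorm α t z ^ 2 := by
  have := isProbabilityMeasure_weightedVolume (n := n) hα
  have hn0 : (0 : ℝ) ≤ n := n.cast_nonneg
  obtain ⟨c, hc, h⟩ := weightedVolume_pball_ge hn hα (s := 1 / 2) (by norm_num)
  set a := (n : ℝ) + 1 + α with ha
  -- On the ball of radius 1/2 about z the quasi-distance to z is at most 2/(1-1/4) = 8/3 times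
  -- 1-|z|².
  refine ⟨((8 / 3 : ℝ) ^ (-(a + t))) ^ 2 * c, by positivity, fun z hz => ?_⟩
  have hdz := defect_pos hz
  have hi := integrable_norm_kernelK_sq hα ht hz
  have hv : c * defect z ^ a ≤ (weightedVolume n α).real (pball z (1 / 2)) :=
    (ENNReal.ofReal_le_iff_le_toReal (measure_ne_top _ _)).1 (h z hz)
  rw [kernelNorm, Real.sq_sqrt (integral_nonneg fun w => by positivity)]
  calc _ = ((8 / 3 * defect z) ^ (-(a + t))) ^ 2 * (c * defect z ^ a) := by
        rw [Real.mul_rpow (by norm_num) hdz.le, mul_pow,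
          ← Real.rpow_natCast (defect z ^ (-(a + t))) 2, ← Real.rpow_mul hdz.le,
          show -(a + 2 * t) = -(a + t) * (2 : ℕ) + a by push_cast; ring, Real.rpow_add hdz]
        ring
    _ ≤ ((8 / 3 * defect z) ^ (-(a + t))) ^ 2 * (weightedVolume n α).real (pball z (1 / 2)) := by
        gcongr
    _ = ∫ w in pball z (1 / 2), ((8 / 3 * defect z) ^ (-(a + t))) ^ 2 ∂(weightedVolume n α) := by
        rw [setIntegral_const, smul_eq_mul, mul_comm]
    _ ≤ ∫ w in pball z (1 / 2), ‖kernelK α t z w‖ ^ 2 ∂(weightedVolume n α) := by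
        refine setIntegral_mono_on (integrable_const _) hi.integrableOn
          (measurableSet_pball _ _) fun w hw => ?_
        gcongr
        rw [norm_kernelK]
        refine Real.rpow_le_rpow_of_nonpos (qdist_pos hz hw.1) ?_ (by linarith)
        have := (defect_le_of_pdist_lt (by norm_num) hz hw.1 hw.2).1
        norm_num at this ⊢
        exact this
    _ ≤ _ := setIntegral_le_integral hi (Filter.Eventually.of_forall fun w => by positivity)

lemma berezin_eq (α t : ℝ) (g : EuclideanSpace ℂ (Fin n) → ℂ) (z : EuclideanSpace ℂ (Fin n)) :
    berezin α t g z = ∫ w, g w * ((‖kernelH α t z w‖ ^ 2 : ℝ) : ℂ) ∂(weightedVolume n α) := by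
  rw [berezin]
  congr with w
  rw [mul_assoc, Complex.mul_conj, Complex.normSq_eq_norm_sq]

lemma sq_norm_sub_eq (x y : ℂ) : ‖x - y‖ ^ 2 = ‖x‖ ^ 2 - 2 * (conj y * x).re + ‖y‖ ^ 2 := by
  rw [Complex.sq_norm, Complex.sq_norm, Complex.sq_norm, Complex.normSq_sub, mul_comm x]
  ring

/-- A weighted variance is at most the second moment about any point. -/
lemma integral_sub_norm_sq_le {X : Type*} [MeasurableSpace X] {ν : Measure X} {g : X → ℝ}
    {f : X → ℂ} (hg : Integrable g ν) (hg1 : ∫ x, g x ∂ν = 1)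
    (hfg : Integrable (fun x => f x * (g x : ℂ)) ν) (hf2 : Integrable (fun x => ‖f x‖ ^ 2 * g x) ν)
    (c : ℂ) : ∫ x, ‖f x‖ ^ 2 * g x ∂ν - ‖∫ x, f x * (g x : ℂ) ∂ν‖ ^ 2
      ≤ ∫ x, ‖f x - c‖ ^ 2 * g x ∂ν := by
  set m := ∫ x, f x * (g x : ℂ) ∂ν with hm
  have e : ∀ x, ‖f x - c‖ ^ 2 * g x
      = ‖f x‖ ^ 2 * g x - 2 * (conj c * (f x * (g x : ℂ))).re + ‖c‖ ^ 2 * g x := by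
    intro x
    rw [sq_norm_sub_eq, ← mul_assoc, Complex.re_mul_ofReal]
    ring
  have hre : Integrable (fun x => (conj c * (f x * (g x : ℂ))).re) ν := (hfg.const_mul _).re
  have e2 : ∫ x, (conj c * (f x * (g x : ℂ))).re ∂ν = (conj c * m).re := by
    rw [hm, ← integral_const_mul]
    exact integral_re (hfg.const_mul (conj c))
  simp_rw [e]
  have hre2 := hre.const_mul 2
  have h1 : Integrable (fun x => ‖f x‖ ^ 2 * g x - 2 * (conj c * (f x * (g x : ℂ))).re) ν :=
    hf2.sub hre2
  rw [integral_add h1 (hg.const_mul _), integral_sub hf2 hre2, integral_const_mul, integral_const_mul, hg1, e2]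
  -- The two sides differ by exactly |m-c|².
  have h3 := sq_nonneg ‖m - c‖
  rw [sq_norm_sub_eq] at h3
  linarith

/-- The global oscillation is dominated by a weighted second moment about any point. -/
lemma ofReal_globalMO_rpow_le (hn : 1 ≤ n) {α t : ℝ} (hα : -1 < α) (ht : 0 ≤ t) : ∃ C : ℝ, 0 < C ∧
    ∀ f : EuclideanSpace ℂ (Fin n) → ℂ, MemLp f 2 (weightedVolume n α) →
      ∀ z ∈ unitBall n, ∀ c : ℂ, ∀ p : ℝ, 0 < p →
        ENNReal.ofReal (globalMO α t f z ^ p) ≤ (ENNReal.ofReal C *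
          ∫⁻ w, ENNReal.ofReal (berKernel ((n : ℝ) + 1 + α) ((n : ℝ) + 1 + α + 2 * t) z w) *
            ‖f w - c‖ₑ ^ 2 ∂(invariantVolume n)) ^ (p / 2) := by
  have := isProbabilityMeasure_weightedVolume (n := n) hα
  obtain ⟨k, hk, hnorm⟩ := kernelNorm_sq_ge hn hα ht
  have hw0 := weightConst_ne_zero (n := n) hα
  have hw1 := weightConst_ne_top (n := n) α
  have hwp := ENNReal.toReal_pos hw0 hw1
  refine ⟨(weightConst n α).toReal * k⁻¹, by positivity, fun f hf z hz c p hp => ?_⟩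
  have hdz := defect_pos hz
  set b := (n : ℝ) + 1 + α + 2 * t with hb
  have hN : 0 < kernelNorm α t z ^ 2 := lt_of_lt_of_le (by positivity) (hnorm z hz)
  set g : EuclideanSpace ℂ (Fin n) → ℝ := fun w => ‖kernelH α t z w‖ ^ 2 with hg
  have hgeq : ∀ w, g w = ‖kernelK α t z w‖ ^ 2 / kernelNorm α t z ^ 2 := by
    intro w
    rw [hg]
    simp only [kernelH, norm_div, Complex.norm_real, Real.norm_eq_abs, div_pow, sq_abs]
  have hgi : Integrable g (weightedVolume n α) := by
    rw [show g = _ from funext hgeq]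
    exact (integrable_norm_kernelK_sq hα ht hz).div_const _
  have hg1 : ∫ w, g w ∂(weightedVolume n α) = 1 := by
    simp_rw [hgeq]
    rw [integral_div, div_eq_one_iff_eq hN.ne', kernelNorm,
      Real.sq_sqrt (integral_nonneg fun w => by positivity)]
  have hgm : Measurable g := by
    rw [show g = _ from funext hgeq]
    exact ((measurable_kernelK α t z).norm.pow_const 2).div_const _
  set D := ((defect z / 2) ^ (-((n : ℝ) + 1 + α + t))) ^ 2 / kernelNorm α t z ^ 2 with hD
  have hgb : ∀ᵐ w ∂(weightedVolume n α), ‖g w‖ ≤ D := by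
    filter_upwards [ae_weightedVolume_mem_unitBall α] with w hw
    rw [hgeq, Real.norm_of_nonneg (by positivity)]
    have := norm_kernelK_le hα ht hz hw
    rw [hD]
    gcongr
  have hfc : Integrable (fun w => ‖f w - c‖ ^ 2) (weightedVolume n α) :=
    (hf.sub (memLp_const c)).integrable_norm_pow (by norm_num)
  have hf2 : Integrable (fun w => ‖f w‖ ^ 2) (weightedVolume n α) :=
    hf.integrable_norm_pow (by norm_num)
  have hfcg : Integrable (fun w => ‖f w - c‖ ^ 2 * g w) (weightedVolume n α) :=
    hfc.mul_bdd (c := D) hgm.aestronglyMeasurable hgb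
  have hf2g : Integrable (fun w => ‖f w‖ ^ 2 * g w) (weightedVolume n α) :=
    hf2.mul_bdd (c := D) hgm.aestronglyMeasurable hgb
  have hfg : Integrable (fun w => f w * (g w : ℂ)) (weightedVolume n α) := by
    refine (hf.integrable one_le_two).mul_bdd (c := D)
      (Complex.measurable_ofReal.comp hgm).aestronglyMeasurable ?_
    filter_upwards [hgb] with w hw
    rwa [Complex.norm_real]
  have hvar : (berezin α t (fun w => ((‖f w‖ ^ 2 : ℝ) : ℂ)) z).re - ‖berezin α t f z‖ ^ 2
      ≤ ∫ w, ‖f w - c‖ ^ 2 * g w ∂(weightedVolume n α) := by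
    have e1 : (berezin α t (fun w => ((‖f w‖ ^ 2 : ℝ) : ℂ)) z).re
        = ∫ w, ‖f w‖ ^ 2 * g w ∂(weightedVolume n α) := by
      rw [berezin_eq]
      simp_rw [← Complex.ofReal_mul]
      rw [integral_complex_ofReal, Complex.ofReal_re]
    rw [e1, berezin_eq]
    exact integral_sub_norm_sq_le hgi hg1 hfg hf2g c
  have hmain : ENNReal.ofReal (∫ w, ‖f w - c‖ ^ 2 * g w ∂(weightedVolume n α))
      ≤ ENNReal.ofReal ((weightConst n α).toReal * k⁻¹) *
          ∫⁻ w, ENNReal.ofReal (berKernel ((n : ℝ) + 1 + α) b z w) *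
            ‖f w - c‖ₑ ^ 2 ∂(invariantVolume n) := by
    rw [ofReal_integral_eq_lintegral_ofReal hfcg
      (Filter.Eventually.of_forall fun w => by positivity), lintegral_weightedVolume,
      ENNReal.ofReal_mul (by positivity), ENNReal.ofReal_toReal hw1, mul_assoc]
    refine mul_le_mul_right ?_ _
    rw [← lintegral_const_mul' _ _ ENNReal.ofReal_ne_top]
    refine lintegral_mono_ae ?_
    filter_upwards [ae_mem_unitBall] with w hw
    have hdw := defect_pos hw
    have hq := qdist_pos hz hw
    have hkp := berKernel_pos ((n : ℝ) + 1 + α) b hz hw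
    rw [← ofReal_norm (f w - c), ← ENNReal.ofReal_pow (norm_nonneg _), ← mul_assoc,
      ← ENNReal.ofReal_mul (by positivity), ← ENNReal.ofReal_mul (by positivity),
      ← ENNReal.ofReal_mul (by positivity)]
    apply ENNReal.ofReal_le_ofReal
    -- Squaring the kernel gives the exponent -2(n+1+α+t), which is -(A+B) for A = n+1+α and B = b.
    have hgle : g w ≤ qdist z w ^ (-(((n : ℝ) + 1 + α) + b)) * (k⁻¹ * defect z ^ b) := by
      rw [hgeq, norm_kernelK, ← Real.rpow_natCast, ← Real.rpow_mul hq.le,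
        show -((n : ℝ) + 1 + α + t) * (2 : ℕ) = -(((n : ℝ) + 1 + α) + b) by
          rw [hb]; push_cast; ring, div_eq_mul_inv]
      gcongr
      rw [inv_le_comm₀ hN (by positivity), mul_inv, inv_inv, ← Real.rpow_neg hdz.le]
      exact hnorm z hz
    rw [berKernel]
    calc _ ≤ defect w ^ ((n : ℝ) + 1 + α) * (‖f w - c‖ ^ 2 *
          (qdist z w ^ (-(((n : ℝ) + 1 + α) + b)) * (k⁻¹ * defect z ^ b))) := by gcongr
      _ = _ := by ring
  rw [globalMO]
  set x := (berezin α t (fun w => ((‖f w‖ ^ 2 : ℝ) : ℂ)) z).re - ‖berezin α t f z‖ ^ 2 with hx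
  have hI0 : 0 ≤ ∫ w, ‖f w - c‖ ^ 2 * g w ∂(weightedVolume n α) :=
    integral_nonneg fun w => by positivity
  calc ENNReal.ofReal (Real.sqrt x ^ p)
      ≤ ENNReal.ofReal (Real.sqrt (∫ w, ‖f w - c‖ ^ 2 * g w ∂(weightedVolume n α)) ^ p) := by
        gcongr
    _ = ENNReal.ofReal (∫ w, ‖f w - c‖ ^ 2 * g w ∂(weightedVolume n α)) ^ (p / 2) := by
        rw [Real.sqrt_eq_rpow, ← Real.rpow_mul hI0, ENNReal.ofReal_rpow_of_nonneg hI0 (by positivity)]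
        congr 2; ring
    _ ≤ _ := by gcongr

lemma globalMO_congr {α t : ℝ} {f g : EuclideanSpace ℂ (Fin n) → ℂ}
    (h : f =ᵐ[weightedVolume n α] g) (z : EuclideanSpace ℂ (Fin n)) :
    globalMO α t f z = globalMO α t g z := by
  have h1 : berezin α t f z = berezin α t g z := by
    refine integral_congr_ae ?_
    filter_upwards [h] with w hw
    rw [hw]
  have h2 : berezin α t (fun w => ((‖f w‖ ^ 2 : ℝ) : ℂ)) z
      = berezin α t (fun w => ((‖g w‖ ^ 2 : ℝ) : ℂ)) z := by
    refine integral_congr_ae ?_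
    filter_upwards [h] with w hw
    simp only [hw]
  rw [globalMO, globalMO, h1, h2]

/-! ### Choice of parameters and conclusion. -/

/-- For `p > 2n / (n + 1 + α + 2t)` the global oscillation is bounded in `L^p(dλ)` by the local one. -/
theorem exists_lintegral_globalMO_le (hn : 1 ≤ n) (α r p t : ℝ) (hα : -1 < α) (hr : 0 < r) (hp : 0 < p)
    (ht : 0 ≤ t) (hpt : 2 * (n : ℝ) / ((n : ℝ) + 1 + α + 2 * t) < p) :
    ∃ C : ℝ, 0 < C ∧ ∀ f : EuclideanSpace ℂ (Fin n) → ℂ,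
      MemLp f 2 (weightedVolume n α) →
        ∫⁻ z, ENNReal.ofReal (globalMO α t f z ^ p) ∂(invariantVolume n) ≤
          ENNReal.ofReal C *
            ∫⁻ z, ENNReal.ofReal (localMO α r f z ^ p) ∂(invariantVolume n) := by
  have hn0 : (0 : ℝ) ≤ n := n.cast_nonneg
  have hs0 : 0 < Real.tanh r := tanh_pos hr
  have hs1 : Real.tanh r < 1 := Real.tanh_lt_one r
  set s := Real.tanh r with hs
  -- With 8d = s, a ball of radius 4d lies in the ball of radius s about any of its points.
  set d := s / 8 with hd
  have hd0 : 0 < d := by positivity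
  have hd1 : 4 * d < 1 := by linarith
  set a := (n : ℝ) + 1 + α with ha
  set b := a + 2 * t with hb
  set q := p / 2 with hq
  have hq0 : 0 < q := by positivity
  have hb0 : 0 < b := by linarith
  have hbq : (n : ℝ) < b * q := by
    rw [div_lt_iff₀ hb0] at hpt
    rw [hq]; linarith
  obtain ⟨ε, hε, hεa, hεb⟩ : ∃ ε : ℝ, 0 < ε ∧ (n : ℝ) < a - ε ∧ (n : ℝ) < (b - ε) * q := by
    -- Half of the available room in each condition: a - n = 1+α and bq - n > 0.
    refine ⟨min ((1 + α) / 2) ((b * q - n) / (2 * q)), ?_, ?_, ?_⟩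
    · have : 0 < 1 + α := by linarith
      have : 0 < b * q - n := by linarith
      positivity
    · have := min_le_left ((1 + α) / 2) ((b * q - n) / (2 * q))
      linarith
    · have h := min_le_right ((1 + α) / 2) ((b * q - n) / (2 * q))
      rw [le_div_iff₀ (by positivity)] at h
      linarith
  obtain ⟨C₀, hC₀, hglob⟩ := ofReal_globalMO_rpow_le hn hα ht
  obtain ⟨C₁, hC₁, hpt1⟩ := lintegral_berKernel_sub_pavg_centre_le hn hα hd0 hd1
    (A := a) (B := b) (by linarith) hb0 hε
  obtain ⟨K, hK, hosc⟩ := posc_le_mul_posc hn hα (d := 4 * d) (s := s) (by positivity) hs1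
  have hdom : ∀ f : EuclideanSpace ℂ (Fin n) → ℂ, MemLp f 2 (weightedVolume n α) →
      ∀ u ∈ unitBall n, ∀ v ∈ pball u (4 * d),
        posc α (4 * d) f u ≤ ENNReal.ofReal K * posc α s f v := fun f hf u hu v hv =>
    hosc f hf v hv.1 u hu (pball_subset_pball hv.1 hu (mem_pball_comm hu hv).2.le (by linarith))
  obtain ⟨D, hD, hint⟩ : ∃ D : ℝ, 0 < D ∧ ∀ f : EuclideanSpace ℂ (Fin n) → ℂ, Measurable f →
      MemLp f 2 (weightedVolume n α) →
      ∫⁻ z, (∫⁻ u, ENNReal.ofReal (berKernel (a - ε) (b - ε) z u) * posc α (4 * d) f u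
        ∂(invariantVolume n)) ^ q ∂(invariantVolume n) ≤ ENNReal.ofReal D *
          ∫⁻ u, (ENNReal.ofReal K * posc α s f u) ^ q ∂(invariantVolume n) := by
    rcases le_or_gt 1 q with hq1 | hq1
    -- Here b - ε > n follows from b ≥ a.
    · obtain ⟨D, hD, h⟩ := lintegral_rpow_berKernel_le_of_one_le (n := n) (A := a - ε)
        (B := b - ε) hεa (by linarith) hq1
      refine ⟨D, hD, fun f hfm hf => (h _ (measurable_posc hα _ hfm)).trans ?_⟩
      refine mul_le_mul_right (lintegral_mono_ae ?_) _
      filter_upwards [ae_mem_unitBall] with u hu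
      gcongr
      exact hdom f hf u hu u (mem_pball_self hu (by positivity))
    · obtain ⟨D, hD, h⟩ := lintegral_rpow_berKernel_le_of_lt_one hn (A := a - ε) (B := b - ε)
        (s := 4 * d) (by linarith) hεb hq0 hq1 (by positivity) hd1
      exact ⟨D, hD, fun f hfm hf => h _ _ ((measurable_posc hα _ hfm).const_mul _) (hdom f hf)⟩
  refine ⟨(C₀ * C₁) ^ q * D * K ^ q, by positivity, fun f₀ hf₀ => ?_⟩
  -- Tonelli needs a genuinely measurable function; both oscillations depend only on the class of
  -- f₀.
  obtain ⟨f, hfs, hff⟩ := hf₀.1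
  have hfm : Measurable f := hfs.measurable
  have hf : MemLp f 2 (weightedVolume n α) := (memLp_congr_ae hff).1 hf₀
  calc _ ≤ ∫⁻ z, ENNReal.ofReal ((C₀ * C₁) ^ q) *
        (∫⁻ u, ENNReal.ofReal (berKernel (a - ε) (b - ε) z u) * posc α (4 * d) f u
          ∂(invariantVolume n)) ^ q ∂(invariantVolume n) := by
        refine lintegral_mono_ae ?_
        filter_upwards [ae_mem_unitBall] with z hz
        rw [globalMO_congr hff]
        refine (hglob f hf z hz (pavg α d f z) p hp).trans ?_
        rw [← ENNReal.ofReal_rpow_of_pos (by positivity), ← ENNReal.mul_rpow_of_nonneg _ _ hq0.le,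
          ENNReal.ofReal_mul hC₀.le, mul_assoc]
        gcongr
        exact hpt1 f hfm hf z hz
    _ ≤ ENNReal.ofReal ((C₀ * C₁) ^ q) * (ENNReal.ofReal D *
          ∫⁻ u, (ENNReal.ofReal K * posc α s f u) ^ q ∂(invariantVolume n)) := by
        rw [lintegral_const_mul' _ _ ENNReal.ofReal_ne_top]
        gcongr
        exact hint f hfm hf
    _ = ENNReal.ofReal ((C₀ * C₁) ^ q) * (ENNReal.ofReal D * (ENNReal.ofReal (K ^ q) *
          ∫⁻ u, posc α s f u ^ q ∂(invariantVolume n))) := by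
        simp_rw [ENNReal.mul_rpow_of_nonneg _ _ hq0.le]
        rw [ENNReal.ofReal_rpow_of_pos hK, lintegral_const_mul' _ _ ENNReal.ofReal_ne_top]
    _ = _ := by
        rw [ENNReal.ofReal_mul (by positivity), ENNReal.ofReal_mul (by positivity), mul_assoc,
          mul_assoc]
        congr 3
        refine lintegral_congr_ae ?_
        filter_upwards [ae_mem_unitBall] with z hz
        rw [ofReal_localMO_rpow hn hα hr hp hf₀ hz, posc, posc, setOsc_congr hff]

end UnitBall

theorem mainTheorem2 (n : ℕ) (hn : 1 ≤ n) (α r p t : ℝ) (hα : -1 < α) (hr : 0 < r) (hp : 0 < p)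
    (ht : 0 ≤ t) (hpt : 2 * (n : ℝ) / ((n : ℝ) + 1 + α + 2 * t) < p) :
    ∃ C : ℝ, 0 < C ∧ ∀ f : EuclideanSpace ℂ (Fin n) → ℂ,
      MeasureTheory.MemLp f 2 (UnitBall.weightedVolume n α) →
        ∫⁻ z, ENNReal.ofReal (UnitBall.globalMO α t f z ^ p) ∂(UnitBall.invariantVolume n) ≤
          ENNReal.ofReal C *
            ∫⁻ z, ENNReal.ofReal (UnitBall.localMO α r f z ^ p) ∂(UnitBall.invariantVolume n) :=
  UnitBall.exists_lintegral_globalMO_le hn α r p t hα hr hp ht hpt
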